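/- Let $n\ge 1$ and let $s_1,s_2>0$ satisfy $s_1+s_2=n/2$. Write $\widehat f(\xi)=\int_{\mathbb R^n}e^{-i\xi\cdot x}f(x)\,dx$, and for a bounded measurable function $\sigma$ on $(\mathbb R^n)^3$ and Schwartz functions $f_1,f_2\in\mathcal S(\mathbb R^n)$ let $$T_\sigma(f_1,f_2)(x)=\frac1{(2\pi)^{2n}}\int_{(\mathbb R^n)^2}e^{ix\cdot(\xi_1+\xi_2)}\sigma(x,\xi_1,\xi_2)\widehat{f_1}(\xi_1)\widehat{f_2}(\xi_2)\,d\xi_1d\xi_2 .$$ The Sjöstrand class $M^{\infty,1}(\mathbb R^d)$ consists of all tempered distributions $u$ on $\mathbb R^d$ with $\sum_{k\in\mathbb Z^d}\|\varphi(D-k)u\|_{L^\infty}<\infty$, where $\varphi(D-k)u=\mathcal F^{-1}[\varphi(\cdot-k)\widehat u]$ and $\varphi\in\mathcal S(\mathbb R^d)$ is supported in $[-1,1]^d$ and satisfies $\sum_{k\in\mathbb Z^d}\varphi(\xi-k)=1$ for all $\xi$ (the class does not depend on $\varphi$). Put $$\|f\|_{H^s}=\|(1+|\xi|^2)^{s/2}\widehat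 f\|_{L^2},\qquad \|g\|_{(L^2,\ell^1)}=\sum_{\nu\in\mathbb Z^n}\Big(\int_{[-1/2,1/2)^n}|g(x+\nu)|^2dx\Big)^{1/2},\qquad \|g\|_{h^1}=\Big\|\sup_{0<t<1}|\phi_t*g|\Big\|_{L^1},$$ where $\phi\in\mathcal S(\mathbb R^n)$ is any fixed function with $\int\phi\ne0$ and $\phi_t(x)=t^{-n}\phi(x/t)$. Let $\sigma\in M^{\infty,1}((\mathbb R^n)^3)$. Then $\sigma$ is (represented by) an essentially bounded measurable function, and $T_\sigma$ is bounded from $H^{s_1}\times H^{s_2}$ to the amalgam space $(L^2,\ell^1)$: there is a constant $C$ such that $$\|T_\sigma(f_1,f_2)\|_{Y}\le C\,\|f_1\|_{H^{s_1}}\|f_2\|_{H^{s_2}}\qquad\text{for all } f_1,f_2\in\mathcal S(\mathbb R^n)$$ with $Y=(L^2,\ell^1)$. In particular, $T_\sigma$ is bounded in the same sense from $H^{s_1}\times H^{s_2}$ to $Y=L^r$ for every $r\in(1,2]$ and to the local Hardy space $Y=h^1$. -/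

import Mathlib

open MeasureTheory FourierTransform
open scoped SchwartzMap ENNReal NNReal

noncomputable section

namespace BilinearPDO

/-- `ℝⁿ` with its Euclidean structure and Lebesgue measure. -/
abbrev Rn (n : ℕ) : Type := EuclideanSpace ℝ (Fin n)

/-- `(ℝⁿ)³ = ℝ³ⁿ`, with its Euclidean structure and Lebesgue measure. -/
abbrev Rn3 (n : ℕ) : Type := EuclideanSpace ℝ (Fin n ⊕ Fin n ⊕ Fin n)

/-- The point `(x, ξ₁, ξ₂)` of `(ℝⁿ)³`. -/
def triple {n : ℕ} (x ξ₁ ξ₂ : Rn n) : Rn3 n :=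
  WithLp.toLp 2 (Sum.elim (fun i => x i) (Sum.elim (fun i => ξ₁ i) (fun i => ξ₂ i)))

/-- The Fourier transform in the normalization `∫ exp (-i ξ·x) f(x) dx`. -/
def hat {n : ℕ} (f : 𝓢(Rn n, ℂ)) (ξ : Rn n) : ℂ :=
  ∫ x : Rn n, Complex.exp (-(Complex.I * ((inner ℝ ξ x : ℝ) : ℂ))) * f x

/-- The bilinear pseudo-differential operator with symbol `σ`. -/
def bilinearOp {n : ℕ} (σ : Rn3 n → ℂ) (f₁ f₂ : 𝓢(Rn n, ℂ)) (x : Rn n) : ℂ :=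
  (((2 * Real.pi) ^ (2 * n))⁻¹ : ℝ) *
    ∫ ξ : Rn n × Rn n, Complex.exp (Complex.I * ((inner ℝ x (ξ.1 + ξ.2) : ℝ) : ℂ)) *
      σ (triple x ξ.1 ξ.2) * hat f₁ ξ.1 * hat f₂ ξ.2

/-- The tempered distribution `u` is (integration against) the function `g`. -/
def Represents {ι : Type} [Fintype ι] (g : EuclideanSpace ℝ ι → ℂ)
    (u : 𝓢'(EuclideanSpace ℝ ι, ℂ)) : Prop :=
  ∀ ψ : 𝓢(EuclideanSpace ℝ ι, ℂ),
    Integrable (fun x => ψ x * g x) volume ∧ u ψ = ∫ x, ψ x * g x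

/-- The lattice point `k ∈ ℤᵈ` as a point of `ℝᵈ`. -/
def latticePt {ι : Type} [Fintype ι] (k : ι → ℤ) : EuclideanSpace ℝ ι :=
  WithLp.toLp 2 (fun i => (k i : ℝ))

/-- `φ` is a Schwartz function supported in `[-1,1]ᵈ` whose integer translates sum up to `1`. -/
structure IsWindow {ι : Type} [Fintype ι] (φ : 𝓢(EuclideanSpace ℝ ι, ℂ)) : Prop where
  supp : ∀ ξ, φ ξ ≠ 0 → ∀ i, |ξ i| ≤ 1
  sum_eq_one : ∀ ξ, HasSum (fun k : ι → ℤ => φ (ξ - latticePt k)) 1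

/-- The frequency-localized piece `φ(D - k) u`. Mathlib's Fourier transform uses the kernel
`exp (-2πi x·ξ)`, hence `m(D)`, which is defined with the kernel `exp (-i x·ξ)`, is
Mathlib's multiplier operator with the rescaled symbol `ξ ↦ m(2πξ)`. -/
def freqPiece {ι : Type} [Fintype ι] (φ : 𝓢(EuclideanSpace ℝ ι, ℂ)) (k : ι → ℤ)
    (u : 𝓢'(EuclideanSpace ℝ ι, ℂ)) : 𝓢'(EuclideanSpace ℝ ι, ℂ) :=
  TemperedDistribution.fourierMultiplierCLM ℂ
    (fun ξ => φ ((2 * Real.pi) • ξ - latticePt k)) u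

/-- Membership in the modulation space `M^{∞,1}(ℝᵈ)`: the distributions `φ(D - k) u` are
functions `g k ∈ L^∞` and the sum of their `L^∞` norms is finite. The space does not depend
on the window `φ`. -/
def MemSjostrand {ι : Type} [Fintype ι] (u : 𝓢'(EuclideanSpace ℝ ι, ℂ)) : Prop :=
  ∃ φ : 𝓢(EuclideanSpace ℝ ι, ℂ), IsWindow φ ∧
    ∃ g : (ι → ℤ) → EuclideanSpace ℝ ι → ℂ,
      (∀ k, MemLp (g k) ∞ volume ∧ Represents (g k) (freqPiece φ k u)) ∧
      ∑' k, eLpNorm (g k) ∞ volume < ∞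

/-- The `H^s` norm `‖⟨ξ⟩^s \hat f‖_{L²}` of a Schwartz function. -/
def sobolevNorm {n : ℕ} (s : ℝ) (f : 𝓢(Rn n, ℂ)) : ℝ≥0∞ :=
  eLpNorm (fun ξ : Rn n => (((1 + ‖ξ‖ ^ 2) ^ (s / 2) : ℝ) : ℂ) * hat f ξ) 2 volume

/-- The cube `ν + Q` with `Q = [-1/2, 1/2)ⁿ`. -/
def cube {n : ℕ} (ν : Fin n → ℤ) : Set (Rn n) :=
  {x | ∀ i, x i - ν i ∈ Set.Ico (-1 / 2 : ℝ) (1 / 2)}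

/-- The norm of the amalgam space `(L², ℓ¹)`. -/
def amalgamNorm {n : ℕ} (f : Rn n → ℂ) : ℝ≥0∞ :=
  ∑' ν : Fin n → ℤ, eLpNorm f 2 (volume.restrict (cube ν))

/-- Membership in the amalgam space `(L², ℓ¹)`. -/
def MemAmalgam {n : ℕ} (f : Rn n → ℂ) : Prop :=
  AEStronglyMeasurable f volume ∧ amalgamNorm f < ∞

/-- The Schwartz function `y ↦ φ_t(x - y)`, where `φ_t(z) = t⁻ⁿ φ(z / t)`. -/
def dilate {n : ℕ} (φ : 𝓢(Rn n, ℂ)) (t : ℝ) (ht : t ≠ 0) (x : Rn n) : 𝓢(Rn n, ℂ) :=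
  (((t ^ n)⁻¹ : ℝ) : ℂ) • SchwartzMap.compSubConstCLM ℂ x
    (SchwartzMap.compCLMOfContinuousLinearEquiv ℂ
      (ContinuousLinearEquiv.smulLeft (Units.mk0 (-t⁻¹) (neg_ne_zero.mpr (inv_ne_zero ht)))) φ)

theorem dilate_apply {n : ℕ} (φ : 𝓢(Rn n, ℂ)) (t : ℝ) (ht : t ≠ 0) (x y : Rn n) :
    dilate φ t ht x y = (((t ^ n)⁻¹ : ℝ) : ℂ) * φ (t⁻¹ • (x - y)) := by
  have h : (-t⁻¹) • (y - x) = t⁻¹ • (x - y) := by rw [neg_smul, ← smul_neg, neg_sub]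
  rw [← h]
  rfl

/-- The norm `‖sup_{0<t<1} |φ_t * w|‖_{L¹}` of the local Hardy space `h¹`, where
`(φ_t * w)(x)` is `w` applied to `φ_t(x - ·)`. -/
def localHardyNorm {n : ℕ} (φ : 𝓢(Rn n, ℂ)) (w : 𝓢'(Rn n, ℂ)) : ℝ≥0∞ :=
  ∫⁻ x : Rn n, ⨆ t : Set.Ioo (0 : ℝ) 1, ‖w (dilate φ t.1 t.2.1.ne' x)‖ₑ

end BilinearPDO

end

open BilinearPDO

/-!
The symbol is decomposed into band-limited pieces, and each piece is shown to give an operator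
which is local in space, with an `L²` bound on unit cubes; summing over the cubes gives the amalgam
estimate.

*Decomposition.* Let `φ` be a window for the Sjöstrand class. The pieces `φ(D - k) u` are bounded
functions whose bounds are summable, so they add up to a bounded function that represents `u`
(`represents_tsum_freqPiece`). A piece is reproduced by convolution with the inverse Fourier
transform of any Schwartz function that is `1` on the support of `φ(· - k)`
(`ae_eq_convolution_of_represents`); for that function a tensor product of three bumps on `ℝⁿ` is
taken. This yields `exists_band_decomposition`: the symbol is a sum of convolutions of bounded
functions `h` with `bandKernel κ₀ ⊗ bandKernel κ₁ ⊗ bandKernel κ₂`, where `(κ₀, κ₁, κ₂)` is the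
frequency of the piece.

*Locality.* For fixed `a`, let `m_a(ξ₁, ξ₂)` be the convolution of `h(a, ·)` with the kernels in the
two frequency variables (`partialSymbol`). Since the Fourier transforms of the kernels are supported
near `κ₁` and `κ₂`, the value at `x` of the multiplier operator with symbol `m_a` only depends on
`f₁` near `x + κ₁` and on `f₂` near `x + κ₂` (`multiplierOp_partialSymbol_congr`). On a ball around
`ρ` one may thus replace `f₁` and `f₂` by their localizations around `ρ + κ₁` and `ρ + κ₂`.

*The `L²` bound.* As `s₁ + s₂ = n / 2`, Plancherel's theorem and a weighted convolution inequality
(`lintegral_conv_sq_le`) show that a bounded multiplier maps `H^{s₁} × H^{s₂}` to `L²`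
(`lintegral_multiplierOp_sq_le`). The average over `a` against the rapidly decreasing kernel
`bandKernel κ₀ (x - a)` preserves the bound (`lintegral_bandOp_sq_le`). Nothing in these bounds
depends on `κ₀`, `κ₁`, `κ₂`, because a frequency shift only modulates the kernels.

*Summation.* The amalgam norm is at most the integral over `ρ` of the `L²` norms on balls around
`ρ`. By the Cauchy–Schwarz inequality in `ρ` and the inequality
`∫ ‖χ(· - c) f‖²_{H^s} dc ≲ ‖f‖²_{H^s}` (`lintegral_sobolevNorm_localize_sq_le`) each piece
contributes at most a constant times its bound, and the bounds are summable
(`exists_amalgamNorm_bilinearOp_le`).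

*Embeddings.* The amalgam space embeds into `L^r` for `1 ≤ r ≤ 2` by Hölder's inequality on unit
cubes (`eLpNorm_le_amalgamNorm`), and into `h¹` by `exists_localHardyNorm_le`: for the part of a
function in one cube, the maximal function is controlled near the cube by the Hardy–Littlewood
maximal function of the square, which is of weak type `(1, 1)` by the Vitali covering lemma, and far
from the cube by the decay of `φ`.
-/

noncomputable section

namespace BilinearPDO

/-! ### Square-function inequalities for `lintegral` -/

theorem lintegral_mul_sq_le {α : Type*} [MeasurableSpace α] {μ : Measure α} {f g : α → ℝ≥0∞}
    (hf : AEMeasurable f μ) (hg : AEMeasurable g μ) :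
    (∫⁻ a, f a * g a ∂μ) ^ 2 ≤ (∫⁻ a, f a ^ 2 ∂μ) * ∫⁻ a, g a ^ 2 ∂μ := by
  have h := ENNReal.lintegral_mul_le_Lp_mul_Lq μ Real.HolderConjugate.two_two hf hg
  simp only [Pi.mul_apply, ENNReal.rpow_two] at h
  calc _ ≤ ((∫⁻ a, f a ^ 2 ∂μ) ^ (1 / 2 : ℝ) * (∫⁻ a, g a ^ 2 ∂μ) ^ (1 / 2 : ℝ)) ^ 2 := by
        gcongr
    _ = _ := by
      rw [mul_pow, ← ENNReal.rpow_two, ← ENNReal.rpow_two, ← ENNReal.rpow_mul,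
        ← ENNReal.rpow_mul]
      norm_num

theorem eLpNorm_two_sq {α : Type*} [MeasurableSpace α] {μ : Measure α} (f : α → ℂ) :
    eLpNorm f 2 μ ^ 2 = ∫⁻ a, ‖f a‖ₑ ^ 2 ∂μ := by
  have := eLpNorm_nnreal_pow_eq_lintegral (f := f) (μ := μ) (p := 2) (by norm_num)
  simpa using this

theorem eLpNorm_two_eq {α : Type*} [MeasurableSpace α] {μ : Measure α} (f : α → ℂ) :
    eLpNorm f 2 μ = (∫⁻ a, ‖f a‖ₑ ^ 2 ∂μ) ^ (1 / 2 : ℝ) := by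
  rw [← eLpNorm_two_sq, ← ENNReal.rpow_two, ← ENNReal.rpow_mul]
  norm_num

theorem sqrt_sq_ennreal (a : ℝ≥0∞) : (a ^ 2) ^ (1 / 2 : ℝ) = a := by
  rw [← ENNReal.rpow_two, ← ENNReal.rpow_mul]; norm_num

theorem sq_sqrt_ennreal (a : ℝ≥0∞) : (a ^ (1 / 2 : ℝ)) ^ 2 = a := by
  rw [← ENNReal.rpow_two, ← ENNReal.rpow_mul]; norm_num

/-- Cauchy–Schwarz with square roots. -/
theorem lintegral_mul_le_sqrt {α : Type*} [MeasurableSpace α] {μ : Measure α} {f g : α → ℝ≥0∞}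
    (hf : AEMeasurable f μ) (hg : AEMeasurable g μ) :
    ∫⁻ a, f a * g a ∂μ ≤ (∫⁻ a, f a ^ 2 ∂μ) ^ (1 / 2 : ℝ) * (∫⁻ a, g a ^ 2 ∂μ) ^ (1 / 2 : ℝ) := by
  rw [← sqrt_sq_ennreal (∫⁻ a, f a * g a ∂μ), ← ENNReal.mul_rpow_of_nonneg _ _ (by norm_num)]
  gcongr
  exact lintegral_mul_sq_le hf hg

/-- Minkowski's inequality in `L²` for countable sums. -/
theorem lintegral_tsum_sq_le {α ι : Type*} [Countable ι] [MeasurableSpace α] {μ : Measure α}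
    {f : ι → α → ℝ≥0∞} (hf : ∀ i, AEMeasurable (f i) μ) :
    (∫⁻ a, (∑' i, f i a) ^ 2 ∂μ) ^ (1 / 2 : ℝ) ≤ ∑' i, (∫⁻ a, f i a ^ 2 ∂μ) ^ (1 / 2 : ℝ) := by
  set N : ι → ℝ≥0∞ := fun i => (∫⁻ a, f i a ^ 2 ∂μ) ^ (1 / 2 : ℝ)
  have hexp (a : α) : (∑' i, f i a) ^ 2 = ∑' i, ∑' j, f i a * f j a := by
    simp_rw [ENNReal.tsum_mul_left, ENNReal.tsum_mul_right, sq]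
  have hm (i j : ι) : AEMeasurable (fun a => f i a * f j a) μ := (hf i).mul (hf j)
  have : ∫⁻ a, (∑' i, f i a) ^ 2 ∂μ ≤ (∑' i, N i) ^ 2 := by
    simp_rw [hexp]
    rw [lintegral_tsum (fun i => AEMeasurable.tsum fun j => hm i j)]
    simp_rw [lintegral_tsum (hm _)]
    calc _ ≤ ∑' i, ∑' j, N i * N j :=
          ENNReal.tsum_le_tsum fun i => ENNReal.tsum_le_tsum fun j =>
            lintegral_mul_le_sqrt (hf i) (hf j)
      _ = _ := by simp_rw [ENNReal.tsum_mul_left, ENNReal.tsum_mul_right, sq]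
  calc _ ≤ ((∑' i, N i) ^ 2) ^ (1 / 2 : ℝ) := by gcongr
    _ = _ := sqrt_sq_ennreal _

/-! ### A weighted convolution inequality -/

/-- The weight `⟨ξ⟩ ^ s = (1 + |ξ|²) ^ (s / 2)`, as an extended nonnegative number. -/
def weight {n : ℕ} (s : ℝ) (ξ : Rn n) : ℝ≥0∞ := ENNReal.ofReal ((1 + ‖ξ‖ ^ 2) ^ (s / 2))

theorem weight_ne_top {n : ℕ} (s : ℝ) (ξ : Rn n) : weight s ξ ≠ ∞ := ENNReal.ofReal_ne_top

theorem measurable_weight {n : ℕ} (s : ℝ) : Measurable (weight (n := n) s) := by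
  unfold weight; fun_prop

theorem weight_add {n : ℕ} (s t : ℝ) (ξ : Rn n) : weight (s + t) ξ = weight s ξ * weight t ξ := by
  have : 0 < 1 + ‖ξ‖ ^ 2 := by positivity
  rw [weight, weight, weight, ← ENNReal.ofReal_mul (by positivity), ← Real.rpow_add this]
  congr 2; ring

theorem weight_neg_mul {n : ℕ} (s : ℝ) (ξ : Rn n) : weight (-s) ξ * weight s ξ = 1 := by
  rw [← weight_add]; simp [weight]

/-- `∫_{|η| ≤ R} ⟨η⟩^{-2s} dη ≲ ⟨R⟩^{n-2s}` when `0 < 2s < n`. -/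
theorem lintegral_weight_ball_le {n : ℕ} (hn : n ≠ 0) {s : ℝ} (hs : 0 < s) (hsn : 2 * s < n) :
    ∃ C : ℝ≥0, ∀ ξ : Rn n,
      ∫⁻ η in {η : Rn n | ‖η‖ ≤ ‖ξ‖}, weight (-s) η ^ 2 ≤ C * weight ((n : ℝ) / 2 - s) ξ ^ 2 := by
  have : NeZero n := ⟨hn⟩
  have hdim : Module.finrank ℝ (Rn n) = n := by simp
  have hn1 : (1 : ℝ) ≤ n := by exact_mod_cast Nat.one_le_iff_ne_zero.mpr hn
  have : Nontrivial (Rn n) := Module.nontrivial_of_finrank_pos (R := ℝ) (by omega)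
  set c : ℝ := n * (volume : Measure (Rn n)).real (Metric.ball 0 1) * (n - 2 * s)⁻¹ with hc
  have hc0 : 0 ≤ c := by
    have : 0 ≤ (n - 2 * s)⁻¹ := inv_nonneg.mpr (by linarith)
    positivity
  refine ⟨⟨c, hc0⟩, fun ξ => ?_⟩
  set R := ‖ξ‖ with hR
  have hR0 : 0 ≤ R := norm_nonneg ξ
  set f : ℝ → ℝ := fun y => (Set.Iic R).indicator (fun y => y ^ (-(2 * s))) y with hf
  have hpow : Set.EqOn (fun y : ℝ => y ^ (n - 1) • f y)
      ((Set.Iic R).indicator fun y => y ^ (n - 1 - 2 * s)) (Set.Ioi 0) := by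
    intro y (hy : 0 < y)
    by_cases hyR : y ∈ Set.Iic R
    · simp only [hf, Set.indicator_of_mem hyR, smul_eq_mul]
      rw [← Real.rpow_natCast, ← Real.rpow_add hy]
      congr 1
      rw [Nat.cast_sub (by omega)]; push_cast; ring
    · simp [hf, Set.indicator_of_notMem hyR]
  have hint : IntervalIntegrable (fun y : ℝ => y ^ (n - 1 - 2 * s)) volume 0 R :=
    intervalIntegral.intervalIntegrable_rpow' (by linarith)
  have hint1 : IntegrableOn (fun y : ℝ => y ^ (n - 1) • f y) (Set.Ioi 0) := by
    rw [integrableOn_congr_fun hpow measurableSet_Ioi, IntegrableOn,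
      integrable_indicator_iff measurableSet_Iic, IntegrableOn,
      Measure.restrict_restrict measurableSet_Iic, Set.inter_comm, Set.Ioi_inter_Iic]
    exact (intervalIntegrable_iff_integrableOn_Ioc_of_le hR0).mp hint
  have hval : ∫ y in Set.Ioi (0 : ℝ), y ^ (n - 1) • f y = R ^ (n - 2 * s) * (n - 2 * s)⁻¹ := by
    rw [setIntegral_congr_fun measurableSet_Ioi hpow, setIntegral_indicator measurableSet_Iic,
      Set.Ioi_inter_Iic, ← intervalIntegral.integral_of_le hR0,
      integral_rpow (Or.inl (by linarith)), show (n : ℝ) - 1 - 2 * s + 1 = n - 2 * s by ring,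
      Real.zero_rpow (by linarith), sub_zero, div_eq_mul_inv]
  have hint2 : Integrable (fun η : Rn n => f ‖η‖) volume := by
    rw [integrable_fun_norm_addHaar, hdim]; exact hint1
  have hval2 : ∫ η : Rn n, f ‖η‖ = c * R ^ (n - 2 * s) := by
    rw [integral_fun_norm_addHaar, hdim, hval, hc]; simp; ring
  have hf0 (y : ℝ) (hy : 0 ≤ y) : 0 ≤ f y := Set.indicator_apply_nonneg fun _ => by positivity
  have hset : MeasurableSet {η : Rn n | ‖η‖ ≤ R} := measurableSet_le (by fun_prop) (by fun_prop)
  have hsq (t : ℝ) (η : Rn n) : weight t η ^ 2 = ENNReal.ofReal ((1 + ‖η‖ ^ 2) ^ t) := by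
    rw [sq, ← weight_add, weight]; congr 2; ring
  calc ∫⁻ η in {η : Rn n | ‖η‖ ≤ R}, weight (-s) η ^ 2
      = ∫⁻ η, {η : Rn n | ‖η‖ ≤ R}.indicator (fun η => weight (-s) η ^ 2) η :=
        (lintegral_indicator hset _).symm
    _ ≤ ∫⁻ η : Rn n, ENNReal.ofReal (f ‖η‖) := by
        apply lintegral_mono_ae
        have h0 : ∀ᵐ η : Rn n, η ≠ 0 := by simp [ae_iff, measure_singleton]
        filter_upwards [h0] with η hη
        by_cases h : ‖η‖ ≤ R
        · have hη : 0 < ‖η‖ := norm_pos_iff.mpr hη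
          rw [Set.indicator_of_mem (by exact h), hsq, hf]
          simp only [Set.indicator_of_mem (show ‖η‖ ∈ Set.Iic R from h)]
          gcongr
          rw [show -(2 * s) = 2 * (-s) by ring, Real.rpow_mul hη.le, Real.rpow_two]
          exact Real.rpow_le_rpow_of_nonpos (by positivity) (by linarith) (by linarith)
        · rw [Set.indicator_of_notMem (by exact h)]; exact zero_le
    _ = ENNReal.ofReal (c * R ^ (n - 2 * s)) := by
        rw [← ofReal_integral_eq_lintegral_ofReal hint2
          (Filter.Eventually.of_forall fun η => hf0 _ (norm_nonneg _)), hval2]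
    _ ≤ ENNReal.ofReal c * weight ((n : ℝ) / 2 - s) ξ ^ 2 := by
        rw [ENNReal.ofReal_mul hc0, hsq]
        gcongr
        rw [show (n : ℝ) - 2 * s = 2 * (n / 2 - s) by ring, Real.rpow_mul hR0, Real.rpow_two]
        exact Real.rpow_le_rpow (by positivity) (by linarith) (by linarith)
    _ = _ := by
        congr 1
        exact ENNReal.ofReal_eq_coe_nnreal hc0

/-- One half of the weighted convolution inequality: the part of the convolution in which the
first frequency is the smaller one. -/
theorem lintegral_conv_low_high_le {n : ℕ} {s₁ s₂ : ℝ} (hs₁ : 0 < s₁) (hs₂ : 0 < s₂)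
    (hs : s₁ + s₂ = (n : ℝ) / 2) :
    ∃ C : ℝ≥0, ∀ F G : Rn n → ℝ≥0∞, Measurable F → Measurable G →
      ∫⁻ ζ, (∫⁻ ξ in {ξ | ‖ζ - ξ‖ ≤ ‖ξ‖}, F (ζ - ξ) * G ξ) ^ 2 ≤
        C * (∫⁻ ξ, (weight s₁ ξ * F ξ) ^ 2) * ∫⁻ ξ, (weight s₂ ξ * G ξ) ^ 2 := by
  have hn : n ≠ 0 := by rintro rfl; simp at hs; linarith
  obtain ⟨C, hC⟩ := lintegral_weight_ball_le hn hs₁ (by linarith)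
  refine ⟨C, fun F G hF hG => ?_⟩
  have hw := @measurable_weight n
  set I : ℝ≥0∞ := ∫⁻ ξ, (weight s₁ ξ * F ξ) ^ 2 with hI
  have hsetm : MeasurableSet {p : Rn n × Rn n | ‖p.1 - p.2‖ ≤ ‖p.2‖} :=
    measurableSet_le (by fun_prop) (by fun_prop)
  have hset (ζ : Rn n) : MeasurableSet {ξ | ‖ζ - ξ‖ ≤ ‖ξ‖} :=
    measurableSet_le (by fun_prop) (by fun_prop)
  set H : Rn n × Rn n → ℝ≥0∞ := {p : Rn n × Rn n | ‖p.1 - p.2‖ ≤ ‖p.2‖}.indicator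
    fun p => (weight (-s₁) (p.1 - p.2) * G p.2) ^ 2 with hH
  have hHm : Measurable H := by
    refine Measurable.indicator ?_ hsetm
    have := (hw (-s₁)).comp (measurable_fst.sub measurable_snd : Measurable
      fun p : Rn n × Rn n => p.1 - p.2)
    exact (this.mul (hG.comp measurable_snd)).pow_const 2
  -- Cauchy–Schwarz with the weight of the smaller frequency `ζ - ξ` on both factors
  have step1 (ζ : Rn n) : (∫⁻ ξ in {ξ | ‖ζ - ξ‖ ≤ ‖ξ‖}, F (ζ - ξ) * G ξ) ^ 2 ≤
      I * ∫⁻ ξ, H (ζ, ξ) := by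
    have hsub : Measurable fun ξ : Rn n => ζ - ξ := measurable_const.sub measurable_id
    calc (∫⁻ ξ in {ξ | ‖ζ - ξ‖ ≤ ‖ξ‖}, F (ζ - ξ) * G ξ) ^ 2
        = (∫⁻ ξ in {ξ | ‖ζ - ξ‖ ≤ ‖ξ‖},
            (weight s₁ (ζ - ξ) * F (ζ - ξ)) * (weight (-s₁) (ζ - ξ) * G ξ)) ^ 2 := by
          congr 1
          refine lintegral_congr fun ξ => ?_
          calc F (ζ - ξ) * G ξ
              = (weight (-s₁) (ζ - ξ) * weight s₁ (ζ - ξ)) * (F (ζ - ξ) * G ξ) := by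
                rw [weight_neg_mul, one_mul]
            _ = _ := by ring
      _ ≤ (∫⁻ ξ in {ξ | ‖ζ - ξ‖ ≤ ‖ξ‖}, (weight s₁ (ζ - ξ) * F (ζ - ξ)) ^ 2) *
            ∫⁻ ξ in {ξ | ‖ζ - ξ‖ ≤ ‖ξ‖}, (weight (-s₁) (ζ - ξ) * G ξ) ^ 2 :=
          lintegral_mul_sq_le ((((hw s₁).mul hF).comp hsub).aemeasurable)
            ((((hw (-s₁)).comp hsub).mul hG).aemeasurable)
      _ ≤ (∫⁻ ξ, (weight s₁ (ζ - ξ) * F (ζ - ξ)) ^ 2) *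
            ∫⁻ ξ in {ξ | ‖ζ - ξ‖ ≤ ‖ξ‖}, (weight (-s₁) (ζ - ξ) * G ξ) ^ 2 := by
          gcongr; exact Measure.restrict_le_self
      _ = I * ∫⁻ ξ, H (ζ, ξ) := by
          rw [lintegral_sub_left_eq_self (fun ξ => (weight s₁ ξ * F ξ) ^ 2) ζ,
            ← lintegral_indicator (hset ζ)]
          rfl
  -- the loss `⟨ζ - ξ⟩^{-2 s₁}` integrates over `|ζ - ξ| ≤ |ξ|` to `⟨ξ⟩^{n - 2 s₁} = ⟨ξ⟩^{2 s₂}`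
  have step2 (ξ : Rn n) : ∫⁻ ζ, H (ζ, ξ) ≤ C * (weight s₂ ξ * G ξ) ^ 2 := by
    have hset' : MeasurableSet {η : Rn n | ‖η‖ ≤ ‖ξ‖} :=
      measurableSet_le (by fun_prop) (by fun_prop)
    calc ∫⁻ ζ, H (ζ, ξ)
        = ∫⁻ ζ, {η : Rn n | ‖η‖ ≤ ‖ξ‖}.indicator
            (fun η => weight (-s₁) η ^ 2 * G ξ ^ 2) (ζ - ξ) := by
          refine lintegral_congr fun ζ => ?_
          simp only [hH, Set.indicator_apply, Set.mem_ofPred_eq, mul_pow]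
      _ = (∫⁻ η in {η : Rn n | ‖η‖ ≤ ‖ξ‖}, weight (-s₁) η ^ 2) * G ξ ^ 2 := by
          rw [lintegral_sub_right_eq_self (fun η => {η : Rn n | ‖η‖ ≤ ‖ξ‖}.indicator
            (fun η => weight (-s₁) η ^ 2 * G ξ ^ 2) η) ξ, lintegral_indicator hset',
            lintegral_mul_const _ ((hw _).pow_const 2)]
      _ ≤ (C * weight s₂ ξ ^ 2) * G ξ ^ 2 := by
          gcongr
          have := hC ξ
          rwa [show (n : ℝ) / 2 - s₁ = s₂ by linarith] at this
      _ = _ := by ring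
  calc ∫⁻ ζ, (∫⁻ ξ in {ξ | ‖ζ - ξ‖ ≤ ‖ξ‖}, F (ζ - ξ) * G ξ) ^ 2
      ≤ ∫⁻ ζ, I * ∫⁻ ξ, H (ζ, ξ) := lintegral_mono step1
    _ = I * ∫⁻ ξ, ∫⁻ ζ, H (ζ, ξ) := by
        rw [lintegral_const_mul _ hHm.lintegral_prod_right',
          lintegral_lintegral_swap (f := fun a b => H (a, b)) hHm.aemeasurable]
    _ ≤ I * ∫⁻ ξ, C * (weight s₂ ξ * G ξ) ^ 2 := by
        gcongr with ξ; exact step2 ξ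
    _ = _ := by
        rw [lintegral_const_mul' _ _ ENNReal.coe_ne_top]; ring

/-- The weighted convolution inequality behind the critical condition `s₁ + s₂ = n / 2`:
`‖F * G‖_{L²} ≲ ‖⟨·⟩^{s₁} F‖_{L²} ‖⟨·⟩^{s₂} G‖_{L²}`. -/
theorem lintegral_conv_sq_le {n : ℕ} {s₁ s₂ : ℝ} (hs₁ : 0 < s₁) (hs₂ : 0 < s₂)
    (hs : s₁ + s₂ = (n : ℝ) / 2) :
    ∃ C : ℝ≥0, ∀ F G : Rn n → ℝ≥0∞, Measurable F → Measurable G →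
      ∫⁻ ζ, (∫⁻ ξ, F (ζ - ξ) * G ξ) ^ 2 ≤
        C * (∫⁻ ξ, (weight s₁ ξ * F ξ) ^ 2) * ∫⁻ ξ, (weight s₂ ξ * G ξ) ^ 2 := by
  obtain ⟨C₁, h₁⟩ := lintegral_conv_low_high_le hs₁ hs₂ hs
  obtain ⟨C₂, h₂⟩ := lintegral_conv_low_high_le (n := n) hs₂ hs₁ (by linarith)
  refine ⟨2 * (C₁ + C₂), fun F G hF hG => ?_⟩
  set P : Rn n → ℝ≥0∞ := fun ζ => ∫⁻ ξ in {ξ | ‖ζ - ξ‖ ≤ ‖ξ‖}, F (ζ - ξ) * G ξ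
  set Q : Rn n → ℝ≥0∞ := fun ζ => ∫⁻ ξ in {ξ | ‖ζ - ξ‖ ≤ ‖ξ‖}, G (ζ - ξ) * F ξ
  have hset (ζ : Rn n) : MeasurableSet {ξ | ‖ζ - ξ‖ ≤ ‖ξ‖} :=
    measurableSet_le (by fun_prop) (by fun_prop)
  have hset' (ζ : Rn n) : MeasurableSet {ξ | ‖ξ‖ ≤ ‖ζ - ξ‖} :=
    measurableSet_le (by fun_prop) (by fun_prop)
  have hsplit (ζ : Rn n) : ∫⁻ ξ, F (ζ - ξ) * G ξ ≤ P ζ + Q ζ := by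
    have hQ : Q ζ = ∫⁻ ξ in {ξ | ‖ξ‖ ≤ ‖ζ - ξ‖}, F (ζ - ξ) * G ξ := by
      simp only [Q]
      rw [← lintegral_indicator (hset ζ), ← lintegral_indicator (hset' ζ),
        ← lintegral_sub_left_eq_self _ ζ]
      refine lintegral_congr fun ξ => ?_
      simp only [Set.indicator_apply, Set.mem_ofPred_eq, sub_sub_cancel, mul_comm]
    rw [hQ]
    calc ∫⁻ ξ, F (ζ - ξ) * G ξ
        = ∫⁻ ξ in {ξ | ‖ζ - ξ‖ ≤ ‖ξ‖} ∪ {ξ | ‖ξ‖ ≤ ‖ζ - ξ‖}, F (ζ - ξ) * G ξ := by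
          have : {ξ | ‖ζ - ξ‖ ≤ ‖ξ‖} ∪ {ξ | ‖ξ‖ ≤ ‖ζ - ξ‖} = Set.univ := by
            ext ξ; simpa using le_total _ _
          rw [this, Measure.restrict_univ]
      _ ≤ _ := lintegral_union_le _ _ _
  have hPm : Measurable P := by
    have hsetm : MeasurableSet {p : Rn n × Rn n | ‖p.1 - p.2‖ ≤ ‖p.2‖} :=
      measurableSet_le (by fun_prop) (by fun_prop)
    have : P = fun ζ => ∫⁻ ξ, {p : Rn n × Rn n | ‖p.1 - p.2‖ ≤ ‖p.2‖}.indicator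
        (fun p => F (p.1 - p.2) * G p.2) (ζ, ξ) := by
      ext ζ
      simp only [P]
      rw [← lintegral_indicator (hset ζ)]
      rfl
    rw [this]
    refine Measurable.lintegral_prod_right' (f := {p : Rn n × Rn n |
      ‖p.1 - p.2‖ ≤ ‖p.2‖}.indicator (fun p => F (p.1 - p.2) * G p.2)) ?_
    exact ((hF.comp (measurable_fst.sub measurable_snd)).mul
      (hG.comp measurable_snd)).indicator hsetm
  calc ∫⁻ ζ, (∫⁻ ξ, F (ζ - ξ) * G ξ) ^ 2
      ≤ ∫⁻ ζ, 2 * (P ζ ^ 2 + Q ζ ^ 2) := by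
        refine lintegral_mono fun ζ => ?_
        calc (∫⁻ ξ, F (ζ - ξ) * G ξ) ^ 2 ≤ (P ζ + Q ζ) ^ 2 := by gcongr; exact hsplit ζ
          _ ≤ _ := by simpa using ENNReal.rpow_add_le_mul_rpow_add_rpow (P ζ) (Q ζ)
                        (p := 2) (by norm_num) |>.trans_eq (by norm_num)
    _ = 2 * ((∫⁻ ζ, P ζ ^ 2) + ∫⁻ ζ, Q ζ ^ 2) := by
        rw [lintegral_const_mul' _ _ (by norm_num), lintegral_add_left (hPm.pow_const 2)]
    _ ≤ 2 * (C₁ * (∫⁻ ξ, (weight s₁ ξ * F ξ) ^ 2) * (∫⁻ ξ, (weight s₂ ξ * G ξ) ^ 2) +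
          C₂ * (∫⁻ ξ, (weight s₂ ξ * G ξ) ^ 2) * ∫⁻ ξ, (weight s₁ ξ * F ξ) ^ 2) := by
        gcongr
        · exact h₁ F G hF hG
        · exact h₂ G F hG hF
    _ = _ := by push_cast; ring

/-! ### Tempered distributions tested on compactly supported functions -/

section Density

variable {V : Type*} [NormedAddCommGroup V] [InnerProductSpace ℝ V] [FiniteDimensional ℝ V]

/-- A smooth bump function, as a complex-valued Schwartz function. -/
def bumpSchwartz {c : V} (b : ContDiffBump c) : 𝓢(V, ℂ) :=
  HasCompactSupport.toSchwartzMap (f := fun x => (b x : ℂ))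
    (HasCompactSupport.comp_left (g := Complex.ofReal) b.hasCompactSupport Complex.ofReal_zero)
    (Complex.ofRealCLM.contDiff.comp b.contDiff)

theorem bumpSchwartz_apply {c : V} (b : ContDiffBump c) (x : V) :
    bumpSchwartz b x = (b x : ℂ) := rfl

theorem hasCompactSupport_bumpSchwartz {c : V} (b : ContDiffBump c) :
    HasCompactSupport (bumpSchwartz b) :=
  HasCompactSupport.comp_left (g := Complex.ofReal) b.hasCompactSupport Complex.ofReal_zero

open Filter Topology in
/-- A Schwartz function is the limit, in the Schwartz topology, of its products with dilated
bump functions. -/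
theorem exists_tendsto_hasCompactSupport (ψ : 𝓢(V, ℂ)) :
    ∃ Ψ : ℕ → 𝓢(V, ℂ), (∀ N, HasCompactSupport (Ψ N)) ∧ Tendsto Ψ atTop (𝓝 ψ) := by
  let b : ContDiffBump (0 : V) := ⟨1, 2, one_pos, one_lt_two⟩
  let χ : 𝓢(V, ℂ) := bumpSchwartz b
  have hχ (x : V) : χ x = (b x : ℂ) := rfl
  have hc (N : ℕ) : (0 : ℝ) < (N + 1 : ℝ)⁻¹ := by positivity
  let e (N : ℕ) : V ≃L[ℝ] V :=
    ContinuousLinearEquiv.smulLeft (Units.mk0 ((N + 1 : ℝ)⁻¹) (hc N).ne')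
  have he (N : ℕ) (x : V) : e N x = (N + 1 : ℝ)⁻¹ • x := rfl
  let χN (N : ℕ) : 𝓢(V, ℂ) := SchwartzMap.compCLMOfContinuousLinearEquiv ℂ (e N) χ
  have hχN (N : ℕ) (x : V) : χN N x = χ (e N x) := rfl
  let Ψ (N : ℕ) : 𝓢(V, ℂ) := SchwartzMap.smulLeftCLM ℂ (χN N) ψ
  have hΨ (N : ℕ) (x : V) : Ψ N x = χN N x * ψ x :=
    SchwartzMap.smulLeftCLM_apply_apply (χN N).hasTemperateGrowth ψ x
  refine ⟨Ψ, fun N => ?_, ?_⟩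
  · have h1 : HasCompactSupport (χN N) :=
      (HasCompactSupport.comp_homeomorph (hasCompactSupport_bumpSchwartz b) (e N).toHomeomorph :)
    have : (Ψ N : V → ℂ) = fun x => χN N x * ψ x := funext (hΨ N)
    rw [this]
    exact h1.mul_right
  · rw [(schwartz_withSeminorms ℂ V ℂ).tendsto_nhds]
    rintro ⟨m, l⟩ ε hε
    let p (i j : ℕ) (f : 𝓢(V, ℂ)) : ℝ := SchwartzMap.seminorm ℂ i j f
    have hp (i j : ℕ) (f : 𝓢(V, ℂ)) : 0 ≤ p i j f := apply_nonneg _ _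
    let K : ℝ := p (m + 1) l ψ +
      ∑ i ∈ Finset.range (l + 1), (l.choose i : ℝ) * p 0 i χ * p (m + 1) (l - i) ψ
    have hK : 0 ≤ K := add_nonneg (hp _ _ _) (Finset.sum_nonneg fun i _ =>
      mul_nonneg (mul_nonneg (by positivity) (hp _ _ _)) (hp _ _ _))
    have hfar (N : ℕ) (x : V) (hx : (N + 1 : ℝ) ≤ ‖x‖) (f : 𝓢(V, ℂ)) (j : ℕ) :
        ‖x‖ ^ m * ‖iteratedFDeriv ℝ j f x‖ ≤ (N + 1 : ℝ)⁻¹ * p (m + 1) j f := by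
      rw [← div_eq_inv_mul, le_div_iff₀ (by positivity)]
      calc ‖x‖ ^ m * ‖iteratedFDeriv ℝ j f x‖ * (N + 1)
          ≤ ‖x‖ ^ m * ‖iteratedFDeriv ℝ j f x‖ * ‖x‖ := by gcongr
        _ = ‖x‖ ^ (m + 1) * ‖iteratedFDeriv ℝ j f x‖ := by ring
        _ ≤ _ := SchwartzMap.le_seminorm ℂ (m + 1) j f x
    have hχd (N j : ℕ) (x : V) : ‖iteratedFDeriv ℝ j (χN N) x‖ ≤ p 0 j χ := by
      have h1 : (χN N : V → ℂ) = χ ∘ (e N : V →L[ℝ] V) := rfl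
      rw [h1, ContinuousLinearMap.iteratedFDeriv_comp_right _ (χ.smooth ⊤) _
        (by exact_mod_cast le_top)]
      refine (ContinuousMultilinearMap.norm_compContinuousLinearMap_le _ _).trans ?_
      have hnorm : ‖(e N : V →L[ℝ] V)‖ ≤ 1 := by
        refine ContinuousLinearMap.opNorm_le_bound _ zero_le_one fun y => ?_
        rw [ContinuousLinearEquiv.coe_coe, he, norm_smul, Real.norm_of_nonneg (hc N).le]
        gcongr
        exact inv_le_one_of_one_le₀ (by linarith [Nat.cast_nonneg (α := ℝ) N])
      calc _ ≤ ‖iteratedFDeriv ℝ j χ (e N x)‖ * 1 := by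
            exact mul_le_mul_of_nonneg_left
              (Finset.prod_le_one (fun _ _ => norm_nonneg _) fun _ _ => hnorm) (norm_nonneg _)
        _ ≤ p 0 j χ := by
            rw [mul_one]
            exact SchwartzMap.norm_iteratedFDeriv_le_seminorm ℂ χ j _
    have key (N : ℕ) : SchwartzMap.seminorm ℂ m l (Ψ N - ψ) ≤ (N + 1 : ℝ)⁻¹ * K := by
      refine SchwartzMap.seminorm_le_bound ℂ m l _ (by positivity) fun x => ?_
      by_cases hx : ‖x‖ < N + 1
      · have : (Ψ N - ψ : 𝓢(V, ℂ)) =ᶠ[𝓝 x] fun _ => (0 : ℂ) := by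
          filter_upwards [(isOpen_lt continuous_norm continuous_const).mem_nhds hx] with y hy
          have : b (e N y) = 1 := b.one_of_mem_closedBall <| by
            rw [mem_closedBall_zero_iff, he, norm_smul, Real.norm_of_nonneg (hc N).le,
              ← div_eq_inv_mul, div_le_one (by positivity)]
            exact le_of_lt hy
          rw [sub_apply, hΨ, hχN, hχ, this]; simp
        rw [(this.iteratedFDeriv ℝ l).eq_of_nhds]
        have h0 : iteratedFDeriv ℝ l (fun _ : V => (0 : ℂ)) x = 0 := by
          rw [iteratedFDeriv_fun_zero]; rfl
        rw [h0, norm_zero, mul_zero]; positivity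
      · push Not at hx
        have h1 : iteratedFDeriv ℝ l (Ψ N - ψ : 𝓢(V, ℂ)) x =
            iteratedFDeriv ℝ l (Ψ N) x - iteratedFDeriv ℝ l ψ x := by
          have : ((Ψ N - ψ : 𝓢(V, ℂ)) : V → ℂ) = (Ψ N : V → ℂ) - ψ := rfl
          rw [this, iteratedFDeriv_sub_apply ((Ψ N).smooth l).contDiffAt (ψ.smooth l).contDiffAt]
        have h2 : ‖iteratedFDeriv ℝ l (Ψ N) x‖ ≤ ∑ i ∈ Finset.range (l + 1),
            (l.choose i : ℝ) * ‖iteratedFDeriv ℝ i (χN N) x‖ *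
              ‖iteratedFDeriv ℝ (l - i) ψ x‖ := by
          have : (Ψ N : V → ℂ) = fun x => χN N x * ψ x := funext (hΨ N)
          rw [this]
          exact norm_iteratedFDeriv_mul_le ((χN N).smooth ⊤) (ψ.smooth ⊤) x
            (by exact_mod_cast le_top)
        calc ‖x‖ ^ m * ‖iteratedFDeriv ℝ l (Ψ N - ψ : 𝓢(V, ℂ)) x‖
            ≤ ‖x‖ ^ m * (‖iteratedFDeriv ℝ l ψ x‖ + ∑ i ∈ Finset.range (l + 1),
              (l.choose i : ℝ) * p 0 i χ * ‖iteratedFDeriv ℝ (l - i) ψ x‖) := by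
              gcongr
              rw [h1]
              refine (norm_sub_le _ _).trans ?_
              rw [add_comm]
              gcongr
              refine h2.trans ?_
              gcongr with i hi
              exact hχd N i x
          _ = ‖x‖ ^ m * ‖iteratedFDeriv ℝ l ψ x‖ + ∑ i ∈ Finset.range (l + 1),
              (l.choose i : ℝ) * p 0 i χ * (‖x‖ ^ m * ‖iteratedFDeriv ℝ (l - i) ψ x‖) := by
              rw [mul_add, Finset.mul_sum]
              congr 1
              exact Finset.sum_congr rfl fun i _ => by ring
          _ ≤ (N + 1 : ℝ)⁻¹ * p (m + 1) l ψ + ∑ i ∈ Finset.range (l + 1),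
              (l.choose i : ℝ) * p 0 i χ * ((N + 1 : ℝ)⁻¹ * p (m + 1) (l - i) ψ) := by
              refine add_le_add (hfar N x hx ψ l) (Finset.sum_le_sum fun i _ => ?_)
              exact mul_le_mul_of_nonneg_left (hfar N x hx ψ (l - i))
                (mul_nonneg (by positivity) (hp _ _ _))
          _ = (N + 1 : ℝ)⁻¹ * K := by
              simp only [K]
              rw [mul_add, Finset.mul_sum]
              congr 1
              exact Finset.sum_congr rfl fun i _ => by ring
    have hlim : Tendsto (fun N : ℕ => (N + 1 : ℝ)⁻¹ * K) atTop (𝓝 0) := by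
      simpa using (tendsto_one_div_add_atTop_nhds_zero_nat (𝕜 := ℝ)).mul_const K
    filter_upwards [hlim.eventually (gt_mem_nhds hε)] with N hN
    exact (key N).trans_lt hN

/-- A tempered distribution that vanishes on the compactly supported test functions is zero. -/
theorem eq_zero_of_forall_hasCompactSupport (w : 𝓢'(V, ℂ))
    (h : ∀ ψ : 𝓢(V, ℂ), HasCompactSupport ψ → w ψ = 0) : w = 0 := by
  ext ψ
  obtain ⟨Ψ, hΨ, hlim⟩ := exists_tendsto_hasCompactSupport ψ
  have h1 := (w.continuous.tendsto ψ).comp hlim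
  refine tendsto_nhds_unique h1 (tendsto_const_nhds.congr fun N => ?_)
  exact (h _ (hΨ N)).symm

variable [MeasurableSpace V] [BorelSpace V]

/-- Translation turns into modulation under the Fourier transform. -/
theorem fourier_compSubConst (f : 𝓢(V, ℂ)) (y ξ : V) :
    𝓕 (SchwartzMap.compSubConstCLM ℂ y f) ξ = Real.fourierChar (-(inner ℝ y ξ)) • 𝓕 f ξ := by
  rw [SchwartzMap.fourier_coe, SchwartzMap.fourier_coe, Real.fourier_eq, Real.fourier_eq,
    ← integral_add_right_eq_self _ y]
  simp only [Circle.smul_def, smul_eq_mul]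
  rw [← integral_const_mul]
  refine integral_congr_ae (Filter.Eventually.of_forall fun x => ?_)
  simp only [SchwartzMap.compSubConstCLM_apply, add_sub_cancel_right, inner_add_left, neg_add,
    AddChar.map_add_eq_mul, Circle.coe_mul]
  ring

/-- A Fourier multiplier acts on Schwartz functions as a convolution operator. -/
theorem fourier_smulLeft_fourierInv (P ψ : 𝓢(V, ℂ)) (y : V) :
    𝓕 (SchwartzMap.smulLeftCLM ℂ P (𝓕⁻ ψ)) y = ∫ x, ψ x * 𝓕⁻ P (x - y) := by
  have h := SchwartzMap.integral_fourierInv_mul_eq ψ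
    (𝓕 (SchwartzMap.compSubConstCLM ℂ y (𝓕⁻ P)))
  rw [fourierInv_fourier_eq] at h
  simp only [SchwartzMap.compSubConstCLM_apply] at h
  rw [← h, SchwartzMap.fourier_coe, Real.fourier_eq]
  refine integral_congr_ae (Filter.Eventually.of_forall fun ξ => ?_)
  simp only [fourier_compSubConst, fourier_fourierInv_eq,
    SchwartzMap.smulLeftCLM_apply_apply P.hasTemperateGrowth, real_inner_comm y ξ]
  simp only [Circle.smul_def, smul_eq_mul]
  ring

end Density

/-! ### Symbols of the Sjöstrand class as sums of band-limited functions -/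

section Sjostrand

variable {ι : Type} [Fintype ι]

/-- A function in `L^∞` has a representative that is measurable and everywhere bounded by the
essential supremum. -/
theorem exists_bounded_representative {g : EuclideanSpace ℝ ι → ℂ} (hg : MemLp g ∞ volume) :
    ∃ h : EuclideanSpace ℝ ι → ℂ, StronglyMeasurable h ∧ h =ᵐ[volume] g ∧
      ∀ x, ‖h x‖ ≤ (eLpNorm g ∞ volume).toReal := by
  set A := (eLpNorm g ∞ volume).toReal
  set g' := hg.1.mk g
  have hg' : StronglyMeasurable g' := hg.1.stronglyMeasurable_mk
  have hset : MeasurableSet {x | ‖g' x‖ ≤ A} :=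
    measurableSet_le hg'.measurable.norm measurable_const
  refine ⟨{x | ‖g' x‖ ≤ A}.indicator g', hg'.indicator hset, ?_, fun x => ?_⟩
  · have h1 := ae_le_eLpNormEssSup (f := g) (μ := volume)
    filter_upwards [hg.1.ae_eq_mk, h1] with x hx hx1
    have : ‖g' x‖ ≤ A := by
      simp only [g']
      rw [← hx, ← toReal_enorm]
      rw [← eLpNorm_exponent_top] at hx1
      exact ENNReal.toReal_mono hg.2.ne hx1
    rw [Set.indicator_of_mem (by exact this), hx]
  · by_cases hx : ‖g' x‖ ≤ A
    · rw [Set.indicator_of_mem (by exact hx)]; exact hx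
    · rw [Set.indicator_of_notMem (by exact hx), norm_zero]; exact ENNReal.toReal_nonneg

theorem Represents.congr {g h : EuclideanSpace ℝ ι → ℂ} {u : 𝓢'(EuclideanSpace ℝ ι, ℂ)}
    (hg : Represents g u) (hgh : g =ᵐ[volume] h) : Represents h u := by
  intro ψ
  have : (fun x => ψ x * g x) =ᵐ[volume] fun x => ψ x * h x := by
    filter_upwards [hgh] with x hx; rw [hx]
  exact ⟨(hg ψ).1.congr this, (hg ψ).2.trans (integral_congr_ae this)⟩

/-- An `L^p` function represents the tempered distribution attached to its class. -/
theorem represents_toTemperedDistribution {p : ℝ≥0∞} [Fact (1 ≤ p)]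
    {g : EuclideanSpace ℝ ι → ℂ} (hg : MemLp g p volume) :
    Represents g (hg.toLp g : 𝓢'(EuclideanSpace ℝ ι, ℂ)) := by
  intro ψ
  have : ENNReal.HolderConjugate p (1 - p⁻¹)⁻¹ :=
    ENNReal.HolderConjugate.inv_one_sub_inv' (Fact.out : 1 ≤ p)
  refine ⟨?_, ?_⟩
  · have := MemLp.integrable_mul (p := p) hg (ψ.memLp (1 - p⁻¹)⁻¹ volume)
    exact this.congr (Filter.Eventually.of_forall fun x => mul_comm _ _)
  · rw [Lp.toTemperedDistribution_apply]
    refine integral_congr_ae ?_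
    filter_upwards [hg.coeFn_toLp] with x hx
    rw [hx, smul_eq_mul]

/-- Locally integrable functions that represent the same distribution agree almost everywhere. -/
theorem Represents.ae_eq {g h : EuclideanSpace ℝ ι → ℂ} {u : 𝓢'(EuclideanSpace ℝ ι, ℂ)}
    (hg : Represents g u) (hh : Represents h u) (hgl : LocallyIntegrable g volume)
    (hhl : LocallyIntegrable h volume) : g =ᵐ[volume] h := by
  refine ae_eq_of_integral_contDiff_smul_eq hgl hhl fun φ hφ hφs => ?_
  let ψ : 𝓢(EuclideanSpace ℝ ι, ℂ) := HasCompactSupport.toSchwartzMap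
    (f := fun x => (φ x : ℂ))
    (HasCompactSupport.comp_left (g := Complex.ofReal) hφs Complex.ofReal_zero)
    (Complex.ofRealCLM.contDiff.comp hφ)
  have h1 := (hg ψ).2
  rw [(hh ψ).2] at h1
  simp only [Complex.real_smul]
  exact h1.symm

theorem freqPiece_apply {φ : 𝓢(EuclideanSpace ℝ ι, ℂ)} (k : ι → ℤ)
    (u : 𝓢'(EuclideanSpace ℝ ι, ℂ)) (ψ : 𝓢(EuclideanSpace ℝ ι, ℂ)) :
    freqPiece φ k u ψ = u (𝓕 (SchwartzMap.smulLeftCLM ℂ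
      (fun ξ => φ ((2 * Real.pi) • ξ - latticePt k)) (𝓕⁻ ψ))) := rfl

theorem hasTemperateGrowth_window (φ : 𝓢(EuclideanSpace ℝ ι, ℂ)) (k : ι → ℤ) :
    (fun ξ => φ ((2 * Real.pi) • ξ - latticePt k)).HasTemperateGrowth :=
  φ.hasTemperateGrowth.comp <|
    (((2 * Real.pi) • ContinuousLinearMap.id ℝ (EuclideanSpace ℝ ι)).hasTemperateGrowth).sub
      (.const _)

/-- If `𝓕⁻ ψ` has compact support, only finitely many frequency pieces of `u` see `ψ`, and they
recover `u ψ`. -/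
theorem exists_finset_sum_freqPiece {φ : 𝓢(EuclideanSpace ℝ ι, ℂ)} (hφ : IsWindow φ)
    (u : 𝓢'(EuclideanSpace ℝ ι, ℂ)) (ψ : 𝓢(EuclideanSpace ℝ ι, ℂ))
    (hψ : HasCompactSupport (𝓕⁻ ψ : 𝓢(EuclideanSpace ℝ ι, ℂ))) :
    ∃ S : Finset (ι → ℤ), (∀ k ∉ S, freqPiece φ k u ψ = 0) ∧
      u ψ = ∑ k ∈ S, freqPiece φ k u ψ := by
  classical
  obtain ⟨R, hR⟩ := hψ.isCompact.isBounded.exists_norm_le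
  set M : ℤ := ⌈2 * Real.pi * R + 1⌉
  set S : Finset (ι → ℤ) := Fintype.piFinset fun _ => Finset.Icc (-M) M
  have hzero (k : ι → ℤ) (hk : k ∉ S) (ξ : EuclideanSpace ℝ ι) (hξ : 𝓕⁻ ψ ξ ≠ 0) :
      φ ((2 * Real.pi) • ξ - latticePt k) = 0 := by
    by_contra hne
    apply hk
    have hnorm := hR ξ (subset_tsupport (𝓕⁻ ψ : 𝓢(EuclideanSpace ℝ ι, ℂ)) (by exact hξ))
    refine Fintype.mem_piFinset.mpr fun i => ?_
    have h1 := hφ.supp _ hne i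
    have h2 : |ξ i| ≤ R := (PiLp.norm_apply_le ξ i).trans hnorm
    have h3 : ((2 * Real.pi) • ξ - latticePt k : EuclideanSpace ℝ ι) i =
        2 * Real.pi * ξ i - k i := by simp [latticePt]
    rw [h3] at h1
    have hpi := Real.pi_pos
    have h4 : |2 * Real.pi * ξ i| ≤ 2 * Real.pi * R := by
      rw [abs_mul, abs_of_pos (by positivity)]; gcongr
    have h5 := Int.le_ceil (2 * Real.pi * R + 1)
    rw [abs_le] at h1 h4
    refine Finset.mem_Icc.mpr ⟨?_, ?_⟩
    · have : (-(M : ℝ)) ≤ k i := by simp only [M]; linarith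
      exact_mod_cast this
    · have : (k i : ℝ) ≤ M := by simp only [M]; linarith
      exact_mod_cast this
  have happ (k : ι → ℤ) (ξ : EuclideanSpace ℝ ι) :
      SchwartzMap.smulLeftCLM ℂ (fun ξ => φ ((2 * Real.pi) • ξ - latticePt k)) (𝓕⁻ ψ) ξ =
        φ ((2 * Real.pi) • ξ - latticePt k) * 𝓕⁻ ψ ξ := by
    rw [SchwartzMap.smulLeftCLM_apply_apply (hasTemperateGrowth_window φ k), smul_eq_mul]
  refine ⟨S, fun k hk => ?_, ?_⟩
  · have : SchwartzMap.smulLeftCLM ℂ (fun ξ => φ ((2 * Real.pi) • ξ - latticePt k)) (𝓕⁻ ψ) =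
        0 := by
      ext ξ
      rw [happ]
      by_cases hξ : 𝓕⁻ ψ ξ = 0
      · rw [hξ, mul_zero]; rfl
      · rw [hzero k hk ξ hξ, zero_mul]; rfl
    rw [freqPiece_apply, this]
    have h0 : 𝓕 (0 : 𝓢(EuclideanSpace ℝ ι, ℂ)) = 0 :=
      map_zero (fourierCLM ℂ 𝓢(EuclideanSpace ℝ ι, ℂ))
    rw [h0, map_zero]
  · have hsum : ∑ k ∈ S, SchwartzMap.smulLeftCLM ℂ
        (fun ξ => φ ((2 * Real.pi) • ξ - latticePt k)) (𝓕⁻ ψ) = 𝓕⁻ ψ := by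
      ext ξ
      rw [sum_apply]
      simp_rw [happ]
      rw [← Finset.sum_mul]
      by_cases hξ : 𝓕⁻ ψ ξ = 0
      · rw [hξ, mul_zero]
      · have h1 : HasSum (fun k : ι → ℤ => φ ((2 * Real.pi) • ξ - latticePt k))
            (∑ k ∈ S, φ ((2 * Real.pi) • ξ - latticePt k)) :=
          hasSum_sum_of_ne_finset_zero fun k hk => hzero k hk ξ hξ
        rw [h1.unique (hφ.sum_eq_one _), one_mul]
    simp_rw [freqPiece_apply]
    rw [← map_sum]
    have h2 : ∑ k ∈ S, 𝓕 (SchwartzMap.smulLeftCLM ℂ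
        (fun ξ => φ ((2 * Real.pi) • ξ - latticePt k)) (𝓕⁻ ψ)) = ψ := by
      calc _ = 𝓕 (∑ k ∈ S, SchwartzMap.smulLeftCLM ℂ
            (fun ξ => φ ((2 * Real.pi) • ξ - latticePt k)) (𝓕⁻ ψ)) :=
          (map_sum (fourierCLM ℂ 𝓢(EuclideanSpace ℝ ι, ℂ)) _ _).symm
        _ = ψ := by rw [hsum, fourier_fourierInv_eq]
    rw [h2]

/-- A distribution whose frequency pieces are bounded functions with summable bounds is the sum
of these functions. -/
theorem represents_tsum_freqPiece {φ : 𝓢(EuclideanSpace ℝ ι, ℂ)} (hφ : IsWindow φ)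
    (u : 𝓢'(EuclideanSpace ℝ ι, ℂ)) {h : (ι → ℤ) → EuclideanSpace ℝ ι → ℂ}
    (hm : ∀ k, StronglyMeasurable (h k)) {A : (ι → ℤ) → ℝ} (hA : Summable A)
    (hb : ∀ k x, ‖h k x‖ ≤ A k) (hr : ∀ k, Represents (h k) (freqPiece φ k u)) :
    MemLp (fun x => ∑' k, h k x) ∞ volume ∧ Represents (fun x => ∑' k, h k x) u := by
  have hsm (x) : Summable fun k => h k x := .of_norm_bounded hA (hb · x)
  have hmeas : Measurable fun x => ∑' k, h k x :=
    Measurable.tsum fun k => (hm k).measurable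
  have hmem : MemLp (fun x => ∑' k, h k x) ∞ volume := by
    refine memLp_top_of_bound hmeas.aestronglyMeasurable (∑' k, A k)
      (Filter.Eventually.of_forall fun x => ?_)
    exact tsum_of_norm_bounded hA.hasSum (hb · x)
  refine ⟨hmem, ?_⟩
  set v : 𝓢'(EuclideanSpace ℝ ι, ℂ) := (hmem.toLp _ : 𝓢'(EuclideanSpace ℝ ι, ℂ))
  have hv : Represents (fun x => ∑' k, h k x) v := represents_toTemperedDistribution hmem
  have hvsum (ψ : 𝓢(EuclideanSpace ℝ ι, ℂ)) : HasSum (fun k => freqPiece φ k u ψ) (v ψ) := by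
    rw [(hv ψ).2]
    simp_rw [fun k => (hr k ψ).2, ← tsum_mul_left]
    refine hasSum_integral_of_summable_integral_norm (fun k => (hr k ψ).1) ?_
    refine Summable.of_nonneg_of_le (fun k => integral_nonneg fun x => norm_nonneg _) (fun k => ?_)
      (hA.mul_left (∫ x, ‖ψ x‖))
    rw [← integral_mul_const]
    refine integral_mono (hr k ψ).1.norm (ψ.integrable.norm.mul_const _) fun x => ?_
    simp only [norm_mul]
    gcongr
    exact hb k x
  suffices u = v by rw [this]; exact hv
  have key : 𝓕 (u - v) = 0 := by
    refine eq_zero_of_forall_hasCompactSupport _ fun ψ hψ => ?_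
    rw [TemperedDistribution.fourier_apply]
    obtain ⟨S, hS, hu⟩ := exists_finset_sum_freqPiece hφ u (𝓕 ψ)
      (by rwa [fourierInv_fourier_eq])
    have h1 := (hvsum (𝓕 ψ)).unique (hasSum_sum_of_ne_finset_zero hS)
    have h2 : (u - v) (𝓕 ψ) = u (𝓕 ψ) - v (𝓕 ψ) := rfl
    rw [h2, hu, h1, sub_self]
  have h3 : u - v = 0 := by
    have h4 : 𝓕⁻ (𝓕 (u - v)) = u - v := FourierTransform.fourierInv_fourier_eq (u - v)
    rw [← h4, key]
    exact map_zero (fourierInvCLM ℂ 𝓢'(EuclideanSpace ℝ ι, ℂ))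
  exact sub_eq_zero.mp h3

/-- A bounded function that represents a band-limited distribution is reproduced by convolution
with `𝓕⁻ P`, where `P = 1` on the band. -/
theorem ae_eq_convolution_of_represents {m : EuclideanSpace ℝ ι → ℂ} (hm : m.HasTemperateGrowth)
    (P : 𝓢(EuclideanSpace ℝ ι, ℂ)) (hP : ∀ ξ, m ξ ≠ 0 → P ξ = 1)
    (u : 𝓢'(EuclideanSpace ℝ ι, ℂ)) {g : EuclideanSpace ℝ ι → ℂ} (hgm : StronglyMeasurable g)
    {A : ℝ} (hA : ∀ x, ‖g x‖ ≤ A)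
    (hg : Represents g (TemperedDistribution.fourierMultiplierCLM ℂ m u)) :
    g =ᵐ[volume] fun x => ∫ y, g y * 𝓕⁻ P (x - y) := by
  have hA0 : 0 ≤ A := (norm_nonneg _).trans (hA 0)
  have hjoint : StronglyMeasurable fun p : EuclideanSpace ℝ ι × EuclideanSpace ℝ ι =>
      g p.2 * 𝓕⁻ P (p.1 - p.2) :=
    (hgm.comp_measurable measurable_snd).mul
      ((𝓕⁻ P).continuous.comp (continuous_fst.sub continuous_snd)).stronglyMeasurable
  have hgl : LocallyIntegrable g volume :=
    (memLp_top_of_bound hgm.aestronglyMeasurable A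
      (Filter.Eventually.of_forall hA)).locallyIntegrable le_top
  have hGl : LocallyIntegrable (fun x => ∫ y, g y * 𝓕⁻ P (x - y)) volume := by
    refine (memLp_top_of_bound hjoint.integral_prod_right'.aestronglyMeasurable
      (A * ∫ y, ‖𝓕⁻ P y‖) (Filter.Eventually.of_forall fun x => ?_)).locallyIntegrable le_top
    refine (norm_integral_le_integral_norm _).trans ?_
    rw [← integral_sub_left_eq_self (fun y => ‖𝓕⁻ P y‖) _ x, ← integral_const_mul]
    refine integral_mono_of_nonneg (Filter.Eventually.of_forall fun y => norm_nonneg _)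
      (((𝓕⁻ P).integrable.norm.comp_sub_left x).const_mul A)
      (Filter.Eventually.of_forall fun y => ?_)
    simp only [norm_mul]
    gcongr
    exact hA y
  refine ae_eq_of_integral_contDiff_smul_eq hgl hGl fun φ hφ hφs => ?_
  let ψ : 𝓢(EuclideanSpace ℝ ι, ℂ) := HasCompactSupport.toSchwartzMap
    (f := fun x => (φ x : ℂ))
    (HasCompactSupport.comp_left (g := Complex.ofReal) hφs Complex.ofReal_zero)
    (Complex.ofRealCLM.contDiff.comp hφ)
  have hψ (x) : (φ x : ℂ) = ψ x := rfl
  simp only [Complex.real_smul, hψ]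
  set v := TemperedDistribution.fourierMultiplierCLM ℂ m u
  -- the multiplier `P` does not change `v`, since `P = 1` wherever `m ≠ 0`
  have hv : v ψ = v (𝓕 (SchwartzMap.smulLeftCLM ℂ P (𝓕⁻ ψ))) := by
    simp only [v, TemperedDistribution.fourierMultiplierCLM_apply_apply]
    rw [fourierInv_fourier_eq]
    congr 2
    ext ξ
    rw [SchwartzMap.smulLeftCLM_apply_apply hm, SchwartzMap.smulLeftCLM_apply_apply hm,
      SchwartzMap.smulLeftCLM_apply_apply P.hasTemperateGrowth]
    by_cases h : m ξ = 0
    · rw [h, zero_smul, zero_smul]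
    · rw [hP ξ h, one_smul]
  rw [← (hg ψ).2, hv, (hg _).2]
  simp only [fourier_smulLeft_fourierInv]
  have hint : Integrable (Function.uncurry fun y x : EuclideanSpace ℝ ι =>
      ψ x * 𝓕⁻ P (x - y) * g y) (volume.prod volume) := by
    have h1 := (ψ.integrable (μ := volume)).convolution_integrand (ContinuousLinearMap.mul ℂ ℂ)
      ((𝓕⁻ P).integrable (μ := volume)).comp_neg
    refine (h1.norm.mul_const A).mono' ?_ (Filter.Eventually.of_forall fun p => ?_)
    · refine StronglyMeasurable.aestronglyMeasurable ?_
      exact ((ψ.continuous.comp continuous_snd).mul ((𝓕⁻ P).continuous.comp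
        (continuous_snd.sub continuous_fst))).stronglyMeasurable.mul
        (hgm.comp_measurable measurable_fst)
    · simp only [Function.uncurry, norm_mul, ContinuousLinearMap.mul_apply', neg_sub]
      gcongr
      exact hA _
  simp_rw [← integral_mul_const, ← integral_const_mul]
  rw [integral_integral_swap hint]
  refine integral_congr_ae (Filter.Eventually.of_forall fun y =>
    integral_congr_ae (Filter.Eventually.of_forall fun x => ?_))
  ring

end Sjostrand

/-! ### Tensor products on `(ℝⁿ)³` -/

section Triple

variable {n : ℕ}

/-- `(x, ξ₁, ξ₂) ↦ triple x ξ₁ ξ₂` as a measurable equivalence. -/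
def tripleEquiv (n : ℕ) : Rn n × Rn n × Rn n ≃ᵐ Rn3 n :=
  (MeasurableEquiv.prodCongr (MeasurableEquiv.toLp 2 (Fin n → ℝ)).symm
    (MeasurableEquiv.prodCongr (MeasurableEquiv.toLp 2 (Fin n → ℝ)).symm
      (MeasurableEquiv.toLp 2 (Fin n → ℝ)).symm)).trans <|
  (MeasurableEquiv.prodCongr (MeasurableEquiv.refl (Fin n → ℝ))
    (MeasurableEquiv.sumPiEquivProdPi fun _ : Fin n ⊕ Fin n => ℝ).symm).trans <|
  (MeasurableEquiv.sumPiEquivProdPi fun _ : Fin n ⊕ Fin n ⊕ Fin n => ℝ).symm.trans <|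
  MeasurableEquiv.toLp 2 (Fin n ⊕ Fin n ⊕ Fin n → ℝ)

theorem tripleEquiv_apply (p : Rn n × Rn n × Rn n) :
    tripleEquiv n p = triple p.1 p.2.1 p.2.2 := by
  ext i
  rcases i with i | i | i <;> rfl

theorem measurePreserving_tripleEquiv : MeasurePreserving (tripleEquiv n) volume volume := by
  have h : MeasurePreserving (MeasurableEquiv.toLp 2 (Fin n → ℝ)).symm volume volume :=
    EuclideanSpace.volume_preserving_symm_measurableEquiv_toLp (Fin n)
  exact (PiLp.volume_preserving_toLp (Fin n ⊕ Fin n ⊕ Fin n)).comp <|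
    (volume_measurePreserving_sumPiEquivProdPi_symm fun _ : Fin n ⊕ Fin n ⊕ Fin n => ℝ).comp <|
    ((MeasurePreserving.id volume).prod
      (volume_measurePreserving_sumPiEquivProdPi_symm fun _ : Fin n ⊕ Fin n => ℝ)).comp <|
    h.prod (h.prod h)

theorem measurePreserving_triple :
    MeasurePreserving (fun p : Rn n × Rn n × Rn n => triple p.1 p.2.1 p.2.2) volume volume := by
  have : (fun p : Rn n × Rn n × Rn n => triple p.1 p.2.1 p.2.2) = tripleEquiv n :=
    funext fun p => (tripleEquiv_apply p).symm
  rw [this]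
  exact measurePreserving_tripleEquiv

theorem integral_triple (f : Rn3 n → ℂ) :
    ∫ p : Rn n × Rn n × Rn n, f (triple p.1 p.2.1 p.2.2) = ∫ X, f X := by
  rw [← measurePreserving_tripleEquiv.integral_comp' (g := f)]
  simp_rw [tripleEquiv_apply]

theorem triple_sub (x y z x' y' z' : Rn n) :
    triple x y z - triple x' y' z' = triple (x - x') (y - y') (z - z') := by
  ext i; rcases i with i | i | i <;> rfl

theorem inner_triple (x y z x' y' z' : Rn n) :
    inner ℝ (triple x y z) (triple x' y' z') = inner ℝ x x' + inner ℝ y y' + inner ℝ z z' := by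
  simp only [PiLp.inner_apply, Fintype.sum_sum_type, triple, Sum.elim_inl, Sum.elim_inr, add_assoc]

/-- The continuous linear map `(ℝⁿ)³ → ℝⁿ` that selects the coordinates with indices `e i`. The
three vectors that make up a point of `(ℝⁿ)³` are of this form. -/
def component {n : ℕ} (e : Fin n → Fin n ⊕ Fin n ⊕ Fin n) : Rn3 n →L[ℝ] Rn n :=
  LinearMap.toContinuousLinearMap
    { toFun := fun X => WithLp.toLp 2 fun i => X (e i)
      map_add' := fun _ _ => rfl
      map_smul' := fun _ _ => rfl }

theorem triple_component (X : Rn3 n) :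
    triple (component Sum.inl X) (component (fun i => .inr (.inl i)) X)
      (component (fun i => .inr (.inr i)) X) = X := by
  ext i; rcases i with i | i | i <;> rfl

theorem norm_sq_triple (x y z : Rn n) : ‖triple x y z‖ ^ 2 = ‖x‖ ^ 2 + ‖y‖ ^ 2 + ‖z‖ ^ 2 := by
  simp only [← real_inner_self_eq_norm_sq, inner_triple]

/-- The tensor product of three compactly supported Schwartz functions. -/
theorem exists_tensor {p₀ p₁ p₂ : 𝓢(Rn n, ℂ)} (h₀ : HasCompactSupport p₀)
    (h₁ : HasCompactSupport p₁) (h₂ : HasCompactSupport p₂) :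
    ∃ P : 𝓢(Rn3 n, ℂ), ∀ x y z, P (triple x y z) = p₀ x * p₁ y * p₂ z := by
  set c₀ := component (n := n) Sum.inl
  set c₁ := component (n := n) fun i => .inr (.inl i)
  set c₂ := component (n := n) fun i => .inr (.inr i)
  obtain ⟨R₀, hR₀⟩ := h₀.isCompact.isBounded.exists_norm_le
  obtain ⟨R₁, hR₁⟩ := h₁.isCompact.isBounded.exists_norm_le
  obtain ⟨R₂, hR₂⟩ := h₂.isCompact.isBounded.exists_norm_le
  have hs : HasCompactSupport fun X : Rn3 n => p₀ (c₀ X) * p₁ (c₁ X) * p₂ (c₂ X) := by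
    refine HasCompactSupport.intro
      (isCompact_closedBall 0 (√(R₀ ^ 2 + R₁ ^ 2 + R₂ ^ 2))) fun X hX => ?_
    by_contra hne
    apply hX
    have hne₀ : p₀ (c₀ X) ≠ 0 := fun h => hne (by rw [h, zero_mul, zero_mul])
    have hne₁ : p₁ (c₁ X) ≠ 0 := fun h => hne (by rw [h, mul_zero, zero_mul])
    have hne₂ : p₂ (c₂ X) ≠ 0 := fun h => hne (by rw [h, mul_zero])
    rw [mem_closedBall_zero_iff]
    apply Real.le_sqrt_of_sq_le
    rw [← triple_component X, norm_sq_triple]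
    gcongr
    · exact hR₀ _ (subset_tsupport _ hne₀)
    · exact hR₁ _ (subset_tsupport _ hne₁)
    · exact hR₂ _ (subset_tsupport _ hne₂)
  have hd : ContDiff ℝ ((⊤ : ℕ∞) : WithTop ℕ∞)
      fun X : Rn3 n => p₀ (c₀ X) * p₁ (c₁ X) * p₂ (c₂ X) :=
    (((p₀.smooth ⊤).comp c₀.contDiff).mul ((p₁.smooth ⊤).comp c₁.contDiff)).mul
      ((p₂.smooth ⊤).comp c₂.contDiff)
  exact ⟨hs.toSchwartzMap hd, fun x y z => rfl⟩

/-- The inverse Fourier transform of a tensor product. -/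
theorem fourierInv_tensor {p₀ p₁ p₂ : 𝓢(Rn n, ℂ)} {P : 𝓢(Rn3 n, ℂ)}
    (hP : ∀ x y z, P (triple x y z) = p₀ x * p₁ y * p₂ z) (x y z : Rn n) :
    𝓕⁻ P (triple x y z) = 𝓕⁻ p₀ x * 𝓕⁻ p₁ y * 𝓕⁻ p₂ z := by
  simp only [SchwartzMap.fourierInv_coe, Real.fourierInv_eq]
  rw [← integral_triple, mul_assoc, ← integral_prod_mul, ← integral_prod_mul]
  refine integral_congr_ae (Filter.Eventually.of_forall fun q => ?_)
  simp only [inner_triple, hP, AddChar.map_add_eq_mul, Circle.smul_def, Circle.coe_mul,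
    smul_eq_mul]
  ring

/-! ### Band-limited kernels -/

/-- A bump function that equals `1` on the ball of radius `√n`, and hence on the cube
`[-1, 1]ⁿ`. -/
def cubeBump (n : ℕ) : ContDiffBump (0 : Rn n) :=
  ⟨√n + 1, √n + 2, by positivity, by linarith⟩

/-- The frequency cutoff `ξ ↦ b(2πξ - κ)`, for the bump function `b = cubeBump n`. -/
def bandBump (κ : Rn n) : 𝓢(Rn n, ℂ) :=
  SchwartzMap.compSubConstCLM ℂ ((2 * Real.pi)⁻¹ • κ)
    (SchwartzMap.compCLMOfContinuousLinearEquiv ℂ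
      (ContinuousLinearEquiv.smulLeft (Units.mk0 (2 * Real.pi) Real.two_pi_pos.ne'))
      (bumpSchwartz (cubeBump n)))

theorem bandBump_apply (κ ξ : Rn n) :
    bandBump κ ξ = (cubeBump n ((2 * Real.pi) • ξ - κ) : ℂ) := by
  have h : (2 * Real.pi) • (ξ - (2 * Real.pi)⁻¹ • κ) = (2 * Real.pi) • ξ - κ := by
    rw [smul_sub, smul_inv_smul₀ Real.two_pi_pos.ne']
  rw [← h]
  rfl

theorem bandBump_eq_compSubConst (κ : Rn n) :
    bandBump κ = SchwartzMap.compSubConstCLM ℂ ((2 * Real.pi)⁻¹ • κ) (bandBump 0) := by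
  ext ξ
  rw [SchwartzMap.compSubConstCLM_apply, bandBump_apply, bandBump_apply, sub_zero, smul_sub,
    smul_inv_smul₀ Real.two_pi_pos.ne']

theorem hasCompactSupport_bandBump (κ : Rn n) : HasCompactSupport (bandBump κ) := by
  refine HasCompactSupport.intro
    (isCompact_closedBall 0 ((2 * Real.pi)⁻¹ * (√n + 2 + ‖κ‖))) fun ξ hξ => ?_
  rw [bandBump_apply]
  have hpi := Real.two_pi_pos
  rw [(cubeBump n).zero_of_le_dist, Complex.ofReal_zero]
  rw [mem_closedBall_zero_iff, not_le, inv_mul_lt_iff₀ hpi] at hξ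
  rw [dist_zero_right]
  have h1 := norm_sub_norm_le ((2 * Real.pi) • ξ) κ
  rw [norm_smul, Real.norm_of_nonneg hpi.le] at h1
  have : (cubeBump n).rOut = √n + 2 := rfl
  linarith

/-- The convolution kernel of the frequency cutoff `bandBump κ`. Its absolute value does not depend
on `κ`. -/
def bandKernel (κ : Rn n) : 𝓢(Rn n, ℂ) := 𝓕⁻ (bandBump κ)

theorem norm_bandKernel (κ z : Rn n) : ‖bandKernel κ z‖ = ‖bandKernel 0 z‖ := by
  rw [bandKernel, bandKernel, SchwartzMap.fourierInv_apply_eq, SchwartzMap.fourierInv_apply_eq]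
  simp only [SchwartzMap.compCLMOfContinuousLinearEquiv_apply, Function.comp_apply]
  rw [bandBump_eq_compSubConst, fourier_compSubConst, Circle.norm_smul]

/-! ### The decomposition of a Sjöstrand symbol -/

/-- Every symbol of the Sjöstrand class is a sum of bounded band-limited functions, with summable
bounds. Each summand is written as the convolution of a bounded function with a tensor product of
band-limited kernels. -/
theorem exists_band_decomposition {u : 𝓢'(Rn3 n, ℂ)} (hu : MemSjostrand u) :
    ∃ (σ : Rn3 n → ℂ) (A : (Fin n ⊕ Fin n ⊕ Fin n → ℤ) → ℝ)
      (h : (Fin n ⊕ Fin n ⊕ Fin n → ℤ) → Rn n × Rn n × Rn n → ℂ)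
      (κ₀ κ₁ κ₂ : (Fin n ⊕ Fin n ⊕ Fin n → ℤ) → Rn n),
      MemLp σ ∞ volume ∧ Represents σ u ∧ Summable A ∧ (∀ k, StronglyMeasurable (h k)) ∧
      (∀ k p, ‖h k p‖ ≤ A k) ∧
      ∀ᵐ p : Rn n × Rn n × Rn n, σ (triple p.1 p.2.1 p.2.2) =
        ∑' k, ∫ q, h k q * (bandKernel (κ₀ k) (p.1 - q.1) *
          bandKernel (κ₁ k) (p.2.1 - q.2.1) * bandKernel (κ₂ k) (p.2.2 - q.2.2)) := by
  obtain ⟨φ, hφ, g, hg, hsum⟩ := hu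
  choose h hhm hhg hhb using fun k => exists_bounded_representative (hg k).1
  set A : (Fin n ⊕ Fin n ⊕ Fin n → ℤ) → ℝ := fun k => (eLpNorm (g k) ∞ volume).toReal
  have hA : Summable A := ENNReal.summable_toReal hsum.ne
  have hrep (k) : Represents (h k) (freqPiece φ k u) := (hg k).2.congr (hhg k).symm
  obtain ⟨hσ, hσu⟩ := represents_tsum_freqPiece hφ u hhm hA hhb hrep
  set κ₀ : (Fin n ⊕ Fin n ⊕ Fin n → ℤ) → Rn n := fun k => component Sum.inl (latticePt k)
  set κ₁ : (Fin n ⊕ Fin n ⊕ Fin n → ℤ) → Rn n :=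
    fun k => component (fun i => .inr (.inl i)) (latticePt k)
  set κ₂ : (Fin n ⊕ Fin n ⊕ Fin n → ℤ) → Rn n :=
    fun k => component (fun i => .inr (.inr i)) (latticePt k)
  refine ⟨_, A, fun k p => h k (triple p.1 p.2.1 p.2.2), κ₀, κ₁, κ₂, hσ, hσu, hA,
    fun k => (hhm k).comp_measurable measurePreserving_triple.measurable, fun k p => hhb k _, ?_⟩
  have key (k) : ∀ᵐ p : Rn n × Rn n × Rn n, h k (triple p.1 p.2.1 p.2.2) =
      ∫ q : Rn n × Rn n × Rn n, h k (triple q.1 q.2.1 q.2.2) * (bandKernel (κ₀ k) (p.1 - q.1) *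
          bandKernel (κ₁ k) (p.2.1 - q.2.1) * bandKernel (κ₂ k) (p.2.2 - q.2.2)) := by
    obtain ⟨P, hP⟩ := exists_tensor (hasCompactSupport_bandBump (κ₀ k))
      (hasCompactSupport_bandBump (κ₁ k)) (hasCompactSupport_bandBump (κ₂ k))
    have hone (e : Fin n → Fin n ⊕ Fin n ⊕ Fin n) (X : Rn3 n)
        (hX : ∀ i, |((2 * Real.pi) • X - latticePt k) i| ≤ 1) :
        bandBump (component e (latticePt k)) (component e X) = 1 := by
      rw [bandBump_apply, ← map_smul, ← map_sub, (cubeBump n).one_of_mem_closedBall,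
        Complex.ofReal_one]
      have h1 : ‖component e ((2 * Real.pi) • X - latticePt k)‖ ≤ √n := by
        rw [EuclideanSpace.norm_eq]
        apply Real.sqrt_le_sqrt
        calc _ ≤ ∑ _i : Fin n, (1 : ℝ) := by
              gcongr with i
              rw [Real.norm_eq_abs, sq_le_one_iff_abs_le_one, abs_abs]
              exact hX _
          _ = n := by simp
      have h2 : (cubeBump n).rIn = √n + 1 := rfl
      rw [mem_closedBall_zero_iff]; linarith
    have hP1 (ξ : Rn3 n) (hξ : φ ((2 * Real.pi) • ξ - latticePt k) ≠ 0) : P ξ = 1 := by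
      have := hφ.supp _ hξ
      rw [← triple_component ξ, hP, hone _ ξ this, hone _ ξ this, hone _ ξ this]
      norm_num
    have hconv := ae_eq_convolution_of_represents (hasTemperateGrowth_window φ k) P hP1 u (hhm k)
      (hhb k) (hrep k)
    filter_upwards [measurePreserving_triple.quasiMeasurePreserving.ae hconv] with p hp
    rw [hp, ← integral_triple]
    simp only [triple_sub, fourierInv_tensor hP]
    rfl
  filter_upwards [ae_all_iff.mpr key] with p hp
  exact tsum_congr hp

end Triple

/-! ### The Fourier transform `hat` -/

section Hat

variable {n : ℕ}

/-- Multiplication by `(2π)⁻¹` on `ℝⁿ`. -/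
def invTwoPi (n : ℕ) : Rn n ≃L[ℝ] Rn n :=
  ContinuousLinearEquiv.smulLeft
    (Units.mk0 ((2 * Real.pi)⁻¹) (inv_ne_zero Real.two_pi_pos.ne'))

theorem exp_inner_eq_fourierChar (x y : Rn n) :
    Complex.exp (Complex.I * ((inner ℝ x y : ℝ) : ℂ)) =
      Real.fourierChar (inner ℝ y ((2 * Real.pi)⁻¹ • x)) := by
  rw [Real.fourierChar_apply, inner_smul_right, real_inner_comm,
    mul_inv_cancel_left₀ Real.two_pi_pos.ne', mul_comm]

theorem integral_exp_eq_fourierInv (f : Rn n → ℂ) (x : Rn n) :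
    ∫ y, Complex.exp (Complex.I * ((inner ℝ x y : ℝ) : ℂ)) * f y =
      𝓕⁻ f ((2 * Real.pi)⁻¹ • x) := by
  rw [Real.fourierInv_eq]
  simp_rw [exp_inner_eq_fourierChar, Circle.smul_def, smul_eq_mul]

theorem hat_eq_fourier (f : 𝓢(Rn n, ℂ)) (ξ : Rn n) : hat f ξ = 𝓕 f ((2 * Real.pi)⁻¹ • ξ) := by
  rw [hat, SchwartzMap.fourier_coe, Real.fourier_eq]
  refine integral_congr_ae (Filter.Eventually.of_forall fun x => ?_)
  simp only
  rw [← mul_neg, ← Complex.ofReal_neg, ← inner_neg_left, exp_inner_eq_fourierChar, smul_neg,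
    inner_neg_right, Circle.smul_def, smul_eq_mul]

/-- `hat f` as a Schwartz function. -/
def hatSchwartz (f : 𝓢(Rn n, ℂ)) : 𝓢(Rn n, ℂ) :=
  SchwartzMap.compCLMOfContinuousLinearEquiv ℂ (invTwoPi n) (𝓕 f)

theorem coe_hatSchwartz (f : 𝓢(Rn n, ℂ)) : ⇑(hatSchwartz f) = hat f :=
  funext fun ξ => (hat_eq_fourier f ξ).symm

theorem continuous_hat (f : 𝓢(Rn n, ℂ)) : Continuous (hat f) :=
  coe_hatSchwartz f ▸ (hatSchwartz f).continuous

theorem integrable_hat (f : 𝓢(Rn n, ℂ)) : Integrable (hat f) :=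
  coe_hatSchwartz f ▸ (hatSchwartz f).integrable

theorem integrable_hat_prod (f₁ f₂ : 𝓢(Rn n, ℂ)) :
    Integrable fun ξ : Rn n × Rn n => hat f₁ ξ.1 * hat f₂ ξ.2 :=
  (integrable_hat f₁).mul_prod (integrable_hat f₂)

theorem sobolevNorm_sq (s : ℝ) (f : 𝓢(Rn n, ℂ)) :
    sobolevNorm s f ^ 2 = ∫⁻ ξ, (weight s ξ * ‖hat f ξ‖ₑ) ^ 2 := by
  rw [sobolevNorm, eLpNorm_two_sq]
  refine lintegral_congr fun ξ => ?_
  rw [enorm_mul, weight, ← Real.enorm_of_nonneg (by positivity)]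
  simp only [enorm_eq_nnnorm, Complex.nnnorm_real]

theorem sobolevNorm_lt_top (s : ℝ) (f : 𝓢(Rn n, ℂ)) : sobolevNorm s f < ∞ := by
  have hg : (fun ξ : Rn n => (((1 + ‖ξ‖ ^ 2) ^ (s / 2) : ℝ) : ℂ)).HasTemperateGrowth :=
    Function.Complex.hasTemperateGrowth_ofReal.comp
      (Function.hasTemperateGrowth_one_add_norm_sq_rpow (Rn n) (s / 2))
  have h := (SchwartzMap.smulLeftCLM ℂ
    (fun ξ : Rn n => (((1 + ‖ξ‖ ^ 2) ^ (s / 2) : ℝ) : ℂ)) (hatSchwartz f)).eLpNorm_lt_top 2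
  convert h using 1
  rw [sobolevNorm]
  congr 1
  ext ξ
  rw [SchwartzMap.smulLeftCLM_apply_apply hg, smul_eq_mul, coe_hatSchwartz]

theorem lintegral_comp_inv_two_pi_smul (g : Rn n → ℝ≥0∞) :
    ∫⁻ x, g ((2 * Real.pi)⁻¹ • x) = ENNReal.ofReal ((2 * Real.pi) ^ n) * ∫⁻ x, g x := by
  have h0 : (2 * Real.pi)⁻¹ ≠ 0 := inv_ne_zero Real.two_pi_pos.ne'
  have h := Measure.map_addHaar_smul (volume : Measure (Rn n)) h0
  rw [finrank_euclideanSpace_fin, inv_pow, inv_inv, abs_of_pos (by positivity)] at h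
  have hmap := lintegral_map_equiv (μ := (volume : Measure (Rn n))) g
    (Homeomorph.smulOfNeZero (2 * Real.pi)⁻¹ h0).toMeasurableEquiv
  have hcoe : ⇑(Homeomorph.smulOfNeZero (α := Rn n) (2 * Real.pi)⁻¹ h0).toMeasurableEquiv =
      ((2 * Real.pi)⁻¹ • · : Rn n → Rn n) := rfl
  rw [hcoe] at hmap
  rw [← hmap, h, lintegral_smul_measure, smul_eq_mul]

/-- Plancherel's theorem for functions in `L¹ ∩ L²`. -/
theorem lintegral_fourierInv_sq {R : Rn n → ℂ} (h1 : Integrable R) (h2 : MemLp R 2 volume) :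
    ∫⁻ x, ‖𝓕⁻ R x‖ₑ ^ 2 = ∫⁻ ζ, ‖R ζ‖ₑ ^ 2 := by
  have hcont : Continuous (𝓕⁻ R) := by
    have : 𝓕⁻ R = fun x => 𝓕 R (-x) := funext fun x => Real.fourierInv_eq_fourier_neg R x
    rw [this]
    exact (VectorFourier.fourierIntegral_continuous Real.continuous_fourierChar
      (by exact continuous_inner) h1).comp continuous_neg
  set S : Lp ℂ 2 (volume : Measure (Rn n)) := 𝓕⁻ (h2.toLp R)
  have hS : Represents S (S : 𝓢'(Rn n, ℂ)) := by
    have := represents_toTemperedDistribution (Lp.memLp S)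
    rwa [Lp.toLp_coeFn] at this
  have hR : Represents (𝓕⁻ R) (S : 𝓢'(Rn n, ℂ)) := by
    intro ψ
    have hb (x : Rn n) : ‖𝓕⁻ R x‖ ≤ ∫ ζ, ‖R ζ‖ := by
      rw [Real.fourierInv_eq_fourier_neg]
      exact VectorFourier.norm_fourierIntegral_le_integral_norm _ _ _ _ _
    refine ⟨(ψ.integrable.norm.mul_const (∫ ζ, ‖R ζ‖)).mono'
      (ψ.continuous.mul hcont).aestronglyMeasurable
      (Filter.Eventually.of_forall fun x => ?_), ?_⟩
    · rw [norm_mul]; gcongr; exact hb x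
    · have h3 : (S : 𝓢'(Rn n, ℂ)) ψ = (h2.toLp R : 𝓢'(Rn n, ℂ)) (𝓕⁻ ψ) := by
        rw [← Lp.fourierInv_toTemperedDistribution_eq, TemperedDistribution.fourierInv_apply]
      rw [h3, (represents_toTemperedDistribution h2 (𝓕⁻ ψ)).2]
      have h4 := VectorFourier.integral_fourierIntegral_smul_eq_flip
        (μ := (volume : Measure (Rn n))) (ν := (volume : Measure (Rn n)))
        (L := -(innerₗ (Rn n))) (f := ψ) (g := R) Real.continuous_fourierChar
        (by exact continuous_inner.neg) ψ.integrable h1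
      simp only [smul_eq_mul] at h4
      convert h4 using 1
      · refine integral_congr_ae (Filter.Eventually.of_forall fun ζ => ?_)
        rw [SchwartzMap.fourierInv_coe]
        rfl
      · refine integral_congr_ae (Filter.Eventually.of_forall fun x => ?_)
        simp only
        congr 1
        rw [Real.fourierInv_eq, VectorFourier.fourierIntegral]
        refine integral_congr_ae (Filter.Eventually.of_forall fun ζ => ?_)
        simp [real_inner_comm]
  have hae : 𝓕⁻ R =ᵐ[volume] S := hR.ae_eq hS hcont.locallyIntegrable
    ((Lp.memLp S).locallyIntegrable (by norm_num))
  have hnorm : eLpNorm S 2 volume = eLpNorm R 2 volume := by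
    rw [← Lp.enorm_def, ← eLpNorm_congr_ae h2.coeFn_toLp, ← Lp.enorm_def]
    have : ‖S‖ = ‖h2.toLp R‖ := (Lp.fourierTransformₗᵢ (Rn n) ℂ).symm.norm_map _
    rw [← ofReal_norm, ← ofReal_norm, this]
  rw [← eLpNorm_two_sq, ← eLpNorm_two_sq, eLpNorm_congr_ae hae, hnorm]

/-! ### The bilinear Fourier multiplier estimate in `L²` -/

/-- The bilinear Fourier multiplier with symbol `m`, without the normalizing factor. -/
def multiplierOp (m : Rn n × Rn n → ℂ) (f₁ f₂ : 𝓢(Rn n, ℂ)) (x : Rn n) : ℂ :=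
  ∫ ξ : Rn n × Rn n, Complex.exp (Complex.I * ((inner ℝ x (ξ.1 + ξ.2) : ℝ) : ℂ)) *
    m ξ * hat f₁ ξ.1 * hat f₂ ξ.2

theorem norm_exp_I_inner (x y : Rn n) :
    ‖Complex.exp (Complex.I * ((inner ℝ x y : ℝ) : ℂ))‖ = 1 := by
  rw [exp_inner_eq_fourierChar]; exact Circle.norm_coe _

theorem integrable_multiplierOp {m : Rn n × Rn n → ℂ} (hm : AEStronglyMeasurable m volume) {B : ℝ}
    (hB : ∀ᵐ ξ, ‖m ξ‖ ≤ B) (f₁ f₂ : 𝓢(Rn n, ℂ)) (x : Rn n) :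
    Integrable fun ξ : Rn n × Rn n =>
      Complex.exp (Complex.I * ((inner ℝ x (ξ.1 + ξ.2) : ℝ) : ℂ)) *
        m ξ * hat f₁ ξ.1 * hat f₂ ξ.2 := by
  refine ((integrable_hat_prod f₁ f₂).norm.const_mul B).mono' ?_ ?_
  · have h1 : Continuous fun ξ : Rn n × Rn n =>
        Complex.exp (Complex.I * ((inner ℝ x (ξ.1 + ξ.2) : ℝ) : ℂ)) := by fun_prop
    have h2 : Continuous fun ξ : Rn n × Rn n => hat f₁ ξ.1 :=
      (continuous_hat f₁).comp continuous_fst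
    have h3 : Continuous fun ξ : Rn n × Rn n => hat f₂ ξ.2 :=
      (continuous_hat f₂).comp continuous_snd
    exact ((h1.aestronglyMeasurable.mul hm).mul h2.aestronglyMeasurable).mul
      h3.aestronglyMeasurable
  · filter_upwards [hB] with ξ hξ
    simp only [norm_mul, norm_exp_I_inner, one_mul]
    rw [mul_assoc]
    gcongr

/-- A bounded symbol on the frequency side gives a bounded bilinear operator
`H^{s₁} × H^{s₂} → L²` when `s₁ + s₂ = n / 2`. -/
theorem lintegral_multiplierOp_sq_le {s₁ s₂ : ℝ} (hs₁ : 0 < s₁) (hs₂ : 0 < s₂)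
    (hs : s₁ + s₂ = (n : ℝ) / 2) :
    ∃ C : ℝ≥0, ∀ (m : Rn n × Rn n → ℂ) (B : ℝ≥0), StronglyMeasurable m → (∀ ξ, ‖m ξ‖ₑ ≤ B) →
      ∀ f₁ f₂ : 𝓢(Rn n, ℂ), ∫⁻ x, ‖multiplierOp m f₁ f₂ x‖ₑ ^ 2 ≤
        C * (B * sobolevNorm s₁ f₁ * sobolevNorm s₂ f₂) ^ 2 := by
  obtain ⟨C, hC⟩ := lintegral_conv_sq_le hs₁ hs₂ hs
  refine ⟨(2 * Real.pi).toNNReal ^ n * C, fun m B hm hB f₁ f₂ => ?_⟩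
  have hB' : ∀ ξ, ‖m ξ‖ ≤ (B : ℝ) := fun ξ => by
    have := hB ξ
    rwa [← ofReal_norm, ENNReal.ofReal_le_coe] at this
  set H : Rn n × Rn n → ℂ := fun ξ => m ξ * hat f₁ ξ.1 * hat f₂ ξ.2 with hH
  set K : Rn n × Rn n → ℂ := fun p => H (p.2 - p.1, p.1) with hK
  set R : Rn n → ℂ := fun ζ => ∫ η, K (η, ζ) with hR
  -- up to a dilation, `R` is the Fourier transform of the function to be estimated: `R ζ` is the
  -- integral of `H` over the fibre `ξ₁ + ξ₂ = ζ`
  have hHm : StronglyMeasurable H :=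
    (hm.mul ((continuous_hat f₁).comp continuous_fst).stronglyMeasurable).mul
      ((continuous_hat f₂).comp continuous_snd).stronglyMeasurable
  have hKm : StronglyMeasurable K := hHm.comp_measurable
    ((measurable_snd.sub measurable_fst).prodMk measurable_fst)
  have hmp : MeasurePreserving (fun p : Rn n × Rn n => (p.1, p.1 + p.2))
      (volume.prod volume) (volume.prod volume) := measurePreserving_prod_add _ _
  have hemb : MeasurableEmbedding fun p : Rn n × Rn n => (p.1, p.1 + p.2) :=
    (MeasurableEquiv.shearAddRight (Rn n)).measurableEmbedding
  have hKshear (p : Rn n × Rn n) : K (p.1, p.1 + p.2) = H p.swap := by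
    simp [hK, Prod.swap]
  have hHint : Integrable H := by
    have := integrable_multiplierOp hm.aestronglyMeasurable
      (Filter.Eventually.of_forall hB') f₁ f₂ 0
    simpa using this
  have hKint : Integrable K (volume.prod volume) := by
    rw [← hmp.integrable_comp_emb hemb]
    have : (K ∘ fun p : Rn n × Rn n => (p.1, p.1 + p.2)) = H ∘ Prod.swap := funext hKshear
    rw [this]
    exact Integrable.swap hHint
  have hRint : Integrable R := hKint.integral_prod_right
  have hU (x : Rn n) : multiplierOp m f₁ f₂ x = 𝓕⁻ R ((2 * Real.pi)⁻¹ • x) := by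
    rw [← integral_exp_eq_fourierInv]
    have hint2 : Integrable (fun p : Rn n × Rn n =>
        Complex.exp (Complex.I * ((inner ℝ x p.2 : ℝ) : ℂ)) * K p) (volume.prod volume) := by
      refine hKint.norm.mono' ?_ (Filter.Eventually.of_forall fun p => ?_)
      · have : Continuous fun p : Rn n × Rn n =>
            Complex.exp (Complex.I * ((inner ℝ x p.2 : ℝ) : ℂ)) := by fun_prop
        exact this.aestronglyMeasurable.mul hKm.aestronglyMeasurable
      · rw [norm_mul, norm_exp_I_inner, one_mul]
    calc multiplierOp m f₁ f₂ x
        = ∫ ξ : Rn n × Rn n,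
            Complex.exp (Complex.I * ((inner ℝ x (ξ.1 + ξ.2) : ℝ) : ℂ)) * H ξ := by
          simp only [multiplierOp, hH, mul_assoc]
      _ = ∫ p : Rn n × Rn n,
            Complex.exp (Complex.I * ((inner ℝ x (p.swap.1 + p.swap.2) : ℝ) : ℂ)) * H p.swap :=
          (integral_prod_swap (μ := (volume : Measure (Rn n))) (ν := (volume : Measure (Rn n)))
            (fun ξ : Rn n × Rn n => Complex.exp (Complex.I *
              ((inner ℝ x (ξ.1 + ξ.2) : ℝ) : ℂ)) * H ξ)).symm
      _ = ∫ p : Rn n × Rn n, Complex.exp (Complex.I * ((inner ℝ x p.2 : ℝ) : ℂ)) * K p := by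
          refine Eq.trans ?_ (hmp.integral_comp hemb _)
          refine integral_congr_ae (Filter.Eventually.of_forall fun p => ?_)
          simp only [hKshear, Prod.fst_swap, Prod.snd_swap, add_comm]
      _ = ∫ ζ, ∫ η, Complex.exp (Complex.I * ((inner ℝ x ζ : ℝ) : ℂ)) * K (η, ζ) :=
          integral_prod_symm _ hint2
      _ = _ := by simp_rw [integral_const_mul, hR]
  have hRsq : ∫⁻ ζ, ‖R ζ‖ₑ ^ 2 ≤ C * (B * sobolevNorm s₁ f₁ * sobolevNorm s₂ f₂) ^ 2 := by
    calc ∫⁻ ζ, ‖R ζ‖ₑ ^ 2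
        ≤ ∫⁻ ζ, B ^ 2 * (∫⁻ η, ‖hat f₁ (ζ - η)‖ₑ * ‖hat f₂ η‖ₑ) ^ 2 := by
          refine lintegral_mono fun ζ => ?_
          rw [← mul_pow]
          gcongr
          rw [← lintegral_const_mul' _ _ ENNReal.coe_ne_top]
          refine (enorm_integral_le_lintegral_enorm _).trans (lintegral_mono fun η => ?_)
          simp only [hK, hH, enorm_mul]
          rw [mul_assoc]
          gcongr
          exact hB _
      _ ≤ B ^ 2 * (C * sobolevNorm s₁ f₁ ^ 2 * sobolevNorm s₂ f₂ ^ 2) := by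
          rw [lintegral_const_mul' _ _ (by simp), sobolevNorm_sq, sobolevNorm_sq]
          gcongr
          exact hC (fun ξ => ‖hat f₁ ξ‖ₑ) (fun ξ => ‖hat f₂ ξ‖ₑ)
            (continuous_hat f₁).measurable.enorm (continuous_hat f₂).measurable.enorm
      _ = _ := by ring
  have hfin : C * (B * sobolevNorm s₁ f₁ * sobolevNorm s₂ f₂) ^ 2 < ∞ :=
    ENNReal.mul_lt_top ENNReal.coe_lt_top <| ENNReal.pow_lt_top <|
      ENNReal.mul_lt_top (ENNReal.mul_lt_top ENNReal.coe_lt_top (sobolevNorm_lt_top _ _))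
        (sobolevNorm_lt_top _ _)
  have hR2 : MemLp R 2 volume := by
    refine ⟨hRint.1, ?_⟩
    have : eLpNorm R 2 volume ^ 2 < ∞ := by
      rw [eLpNorm_two_sq]; exact hRsq.trans_lt hfin
    exact (ENNReal.pow_lt_top_iff.mp this).resolve_right (by norm_num)
  calc ∫⁻ x, ‖multiplierOp m f₁ f₂ x‖ₑ ^ 2
      = ∫⁻ x, ‖𝓕⁻ R ((2 * Real.pi)⁻¹ • x)‖ₑ ^ 2 := by simp_rw [hU]
    _ = ENNReal.ofReal ((2 * Real.pi) ^ n) * ∫⁻ x, ‖𝓕⁻ R x‖ₑ ^ 2 := by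
        exact lintegral_comp_inv_two_pi_smul (fun x => ‖𝓕⁻ R x‖ₑ ^ 2)
    _ ≤ ENNReal.ofReal ((2 * Real.pi) ^ n) *
          (C * (B * sobolevNorm s₁ f₁ * sobolevNorm s₂ f₂) ^ 2) := by
        rw [lintegral_fourierInv_sq hRint hR2]
        gcongr
    _ = _ := by
        rw [← mul_assoc]
        congr 1
        push_cast
        rw [ENNReal.ofReal_pow Real.two_pi_pos.le]
        rfl

end Hat

/-! ### Localization in space -/

section Localization

variable {n : ℕ}

/-- The convolution of a bounded function on `(ℝⁿ)³` with band-limited kernels in the two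
frequency variables. -/
def partialSymbol (h : Rn n × Rn n × Rn n → ℂ) (κ₁ κ₂ a : Rn n) (ξ : Rn n × Rn n) : ℂ :=
  ∫ b : Rn n × Rn n, h (a, b) * (bandKernel κ₁ (ξ.1 - b.1) * bandKernel κ₂ (ξ.2 - b.2))

theorem integrable_bandKernel_prod (κ₁ κ₂ : Rn n) (ξ : Rn n × Rn n) :
    Integrable fun b : Rn n × Rn n => bandKernel κ₁ (ξ.1 - b.1) * bandKernel κ₂ (ξ.2 - b.2) :=
  ((bandKernel κ₁).integrable.comp_sub_left ξ.1).mul_prod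
    ((bandKernel κ₂).integrable.comp_sub_left ξ.2)

/-- The `L¹` norm of the band-limited kernels. -/
def kernelNorm (n : ℕ) : ℝ := ∫ z, ‖bandKernel (0 : Rn n) z‖

theorem kernelNorm_nonneg : 0 ≤ kernelNorm n := integral_nonneg fun _ => norm_nonneg _

theorem integral_norm_bandKernel_sub (κ x : Rn n) :
    ∫ b, ‖bandKernel κ (x - b)‖ = kernelNorm n := by
  simp_rw [norm_bandKernel κ]
  exact integral_sub_left_eq_self (fun z => ‖bandKernel 0 z‖) _ x

theorem norm_partialSymbol_le {h : Rn n × Rn n × Rn n → ℂ} {A : ℝ} (hA : ∀ p, ‖h p‖ ≤ A)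
    (κ₁ κ₂ a : Rn n) (ξ : Rn n × Rn n) :
    ‖partialSymbol h κ₁ κ₂ a ξ‖ ≤ A * kernelNorm n ^ 2 := by
  refine (norm_integral_le_integral_norm _).trans ?_
  calc ∫ b : Rn n × Rn n, ‖h (a, b) * (bandKernel κ₁ (ξ.1 - b.1) * bandKernel κ₂ (ξ.2 - b.2))‖
      ≤ ∫ b : Rn n × Rn n, A * (‖bandKernel κ₁ (ξ.1 - b.1)‖ * ‖bandKernel κ₂ (ξ.2 - b.2)‖) := by
        refine integral_mono_of_nonneg (Filter.Eventually.of_forall fun _ => norm_nonneg _) ?_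
          (Filter.Eventually.of_forall fun b => ?_)
        · have := (integrable_bandKernel_prod κ₁ κ₂ ξ).norm.const_mul A
          simpa only [norm_mul] using this
        · simp only [norm_mul]
          gcongr
          exact hA _
    _ = A * kernelNorm n ^ 2 := by
        rw [integral_const_mul]
        have := integral_prod_mul (μ := (volume : Measure (Rn n)))
          (ν := (volume : Measure (Rn n))) (fun b => ‖bandKernel κ₁ (ξ.1 - b)‖)
          (fun b => ‖bandKernel κ₂ (ξ.2 - b)‖)
        rw [integral_norm_bandKernel_sub, integral_norm_bandKernel_sub, ← sq] at this
        rw [← this]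
        rfl

theorem stronglyMeasurable_partialSymbol {h : Rn n × Rn n × Rn n → ℂ} (hm : StronglyMeasurable h)
    (κ₁ κ₂ : Rn n) :
    StronglyMeasurable fun p : Rn n × Rn n × Rn n => partialSymbol h κ₁ κ₂ p.1 p.2 := by
  have h1 : StronglyMeasurable fun q : (Rn n × Rn n × Rn n) × Rn n × Rn n =>
      h (q.1.1, q.2) * (bandKernel κ₁ (q.1.2.1 - q.2.1) * bandKernel κ₂ (q.1.2.2 - q.2.2)) := by
    refine (hm.comp_measurable (by fun_prop)).mul (Continuous.stronglyMeasurable ?_)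
    exact ((bandKernel κ₁).continuous.comp (by fun_prop)).mul
      ((bandKernel κ₂).continuous.comp (by fun_prop))
  exact h1.integral_prod_right'

theorem stronglyMeasurable_partialSymbol_right {h : Rn n × Rn n × Rn n → ℂ}
    (hm : StronglyMeasurable h) (κ₁ κ₂ a : Rn n) :
    StronglyMeasurable (partialSymbol h κ₁ κ₂ a) :=
  (stronglyMeasurable_partialSymbol hm κ₁ κ₂).comp_measurable measurable_prodMk_left

/-- `(a, x) ↦ T_a(f₁, f₂)(x)` is measurable, where `T_a` is the multiplier operator with the
symbol `partialSymbol h κ₁ κ₂ a`. -/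
theorem stronglyMeasurable_multiplierOp_partialSymbol {h : Rn n × Rn n × Rn n → ℂ}
    (hm : StronglyMeasurable h) (κ₁ κ₂ : Rn n) (f₁ f₂ : 𝓢(Rn n, ℂ)) :
    StronglyMeasurable fun p : Rn n × Rn n =>
      multiplierOp (partialSymbol h κ₁ κ₂ p.1) f₁ f₂ p.2 := by
  have h1 : StronglyMeasurable fun q : (Rn n × Rn n) × Rn n × Rn n =>
      Complex.exp (Complex.I * ((inner ℝ q.1.2 (q.2.1 + q.2.2) : ℝ) : ℂ)) *
        partialSymbol h κ₁ κ₂ q.1.1 q.2 * hat f₁ q.2.1 * hat f₂ q.2.2 := by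
    refine ((StronglyMeasurable.mul (Continuous.stronglyMeasurable (by fun_prop)) ?_).mul ?_).mul ?_
    · exact (stronglyMeasurable_partialSymbol hm κ₁ κ₂).comp_measurable
        (g := fun q : (Rn n × Rn n) × Rn n × Rn n => (q.1.1, q.2)) (by fun_prop)
    · exact ((continuous_hat f₁).comp (by fun_prop)).stronglyMeasurable
    · exact ((continuous_hat f₂).comp (by fun_prop)).stronglyMeasurable
  exact h1.integral_prod_right'

/-- The frequency-localized piece of `f` around `b`, evaluated at `x`: it is an integral of `f`
against a kernel supported near `x + κ`. -/
theorem integral_exp_bandKernel_hat (κ : Rn n) (f : 𝓢(Rn n, ℂ)) (x b : Rn n) :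
    ∫ ξ, Complex.exp (Complex.I * ((inner ℝ x ξ : ℝ) : ℂ)) * bandKernel κ (ξ - b) * hat f ξ =
      ∫ y, Complex.exp (Complex.I * ((inner ℝ (x - y) b : ℝ) : ℂ)) *
        cubeBump n (y - x - κ) * f y := by
  have hint : Integrable (Function.uncurry fun ξ y : Rn n =>
      (Complex.exp (Complex.I * ((inner ℝ (x - y) ξ : ℝ) : ℂ)) * bandKernel κ (ξ - b)) * f y)
      (volume.prod volume) := by
    have h1 := ((bandKernel κ).integrable (μ := volume)).comp_sub_right b |>.mul_prod
      (f.integrable (μ := volume))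
    refine h1.norm.mono' (Continuous.aestronglyMeasurable ?_)
      (Filter.Eventually.of_forall fun p => ?_)
    · have := (bandKernel κ).continuous
      have := f.continuous
      fun_prop
    · simp only [Function.uncurry, norm_mul, norm_exp_I_inner, one_mul, le_refl]
  calc ∫ ξ, Complex.exp (Complex.I * ((inner ℝ x ξ : ℝ) : ℂ)) * bandKernel κ (ξ - b) * hat f ξ
      = ∫ ξ, ∫ y, (Complex.exp (Complex.I * ((inner ℝ (x - y) ξ : ℝ) : ℂ)) *
          bandKernel κ (ξ - b)) * f y := by
        refine integral_congr_ae (Filter.Eventually.of_forall fun ξ => ?_)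
        simp only [hat]
        rw [← integral_const_mul]
        refine integral_congr_ae (Filter.Eventually.of_forall fun y => ?_)
        simp only
        have : Complex.exp (Complex.I * ((inner ℝ (x - y) ξ : ℝ) : ℂ)) =
            Complex.exp (Complex.I * ((inner ℝ x ξ : ℝ) : ℂ)) *
              Complex.exp (-(Complex.I * ((inner ℝ ξ y : ℝ) : ℂ))) := by
          rw [← Complex.exp_add, inner_sub_left, real_inner_comm ξ y]
          push_cast
          congr 1; ring
        rw [this]; ring
    _ = ∫ y, (∫ ξ, Complex.exp (Complex.I * ((inner ℝ (x - y) ξ : ℝ) : ℂ)) *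
          bandKernel κ (ξ - b)) * f y := by
        rw [integral_integral_swap hint]
        simp_rw [integral_mul_const]
    _ = _ := by
        refine integral_congr_ae (Filter.Eventually.of_forall fun y => ?_)
        simp only
        congr 1
        rw [← integral_add_right_eq_self _ b]
        simp only [add_sub_cancel_right, inner_add_right, Complex.ofReal_add, mul_add,
          Complex.exp_add]
        have hval : ∫ ξ, Complex.exp (Complex.I * ((inner ℝ (x - y) ξ : ℝ) : ℂ)) *
            bandKernel κ ξ = cubeBump n (y - x - κ) := by
          rw [integral_exp_eq_fourierInv, Real.fourierInv_eq_fourier_neg]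
          have h2 : 𝓕 (bandKernel κ : Rn n → ℂ) = bandBump κ := by
            rw [← SchwartzMap.fourier_coe, bandKernel, fourier_fourierInv_eq]
          rw [h2, bandBump_apply, smul_neg, smul_inv_smul₀ Real.two_pi_pos.ne', neg_sub]
        rw [← hval, ← integral_const_mul]
        refine integral_congr_ae (Filter.Eventually.of_forall fun ξ => ?_)
        simp only; ring

/-- The value at `x` of a multiplier operator with symbol `partialSymbol h κ₁ κ₂ a` depends only
on the values of `f₁` and `f₂` near `x + κ₁` and `x + κ₂`. -/
theorem multiplierOp_partialSymbol_congr {h : Rn n × Rn n × Rn n → ℂ} (hm : StronglyMeasurable h)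
    {A : ℝ} (hA : ∀ p, ‖h p‖ ≤ A) (κ₁ κ₂ a x : Rn n) {f₁ f₂ g₁ g₂ : 𝓢(Rn n, ℂ)}
    (h₁ : ∀ y, ‖y - x - κ₁‖ < √n + 2 → f₁ y = g₁ y)
    (h₂ : ∀ y, ‖y - x - κ₂‖ < √n + 2 → f₂ y = g₂ y) :
    multiplierOp (partialSymbol h κ₁ κ₂ a) f₁ f₂ x =
      multiplierOp (partialSymbol h κ₁ κ₂ a) g₁ g₂ x := by
  have expand (f₁ f₂ : 𝓢(Rn n, ℂ)) : multiplierOp (partialSymbol h κ₁ κ₂ a) f₁ f₂ x =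
      ∫ b : Rn n × Rn n, h (a, b) *
        ((∫ ξ, Complex.exp (Complex.I * ((inner ℝ x ξ : ℝ) : ℂ)) *
            bandKernel κ₁ (ξ - b.1) * hat f₁ ξ) *
          ∫ ξ, Complex.exp (Complex.I * ((inner ℝ x ξ : ℝ) : ℂ)) *
            bandKernel κ₂ (ξ - b.2) * hat f₂ ξ) := by
    have hker : Integrable fun b : Rn n × Rn n => bandKernel κ₁ (-b.1) * bandKernel κ₂ (-b.2) := by
      simpa using integrable_bandKernel_prod κ₁ κ₂ 0
    have hint : Integrable (Function.uncurry fun (ξ b : Rn n × Rn n) =>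
        Complex.exp (Complex.I * ((inner ℝ x (ξ.1 + ξ.2) : ℝ) : ℂ)) * (h (a, b) *
          (bandKernel κ₁ (ξ.1 - b.1) * bandKernel κ₂ (ξ.2 - b.2))) * hat f₁ ξ.1 * hat f₂ ξ.2)
        (volume.prod volume) := by
      have : (volume : Measure (Rn n × Rn n)).IsAddRightInvariant :=
        inferInstanceAs ((volume.prod volume).IsAddRightInvariant)
      have h1 := (integrable_hat_prod f₁ f₂).convolution_integrand
        (ContinuousLinearMap.mul ℂ ℂ) hker
      have h1 := h1.swap
      refine (h1.norm.const_mul A).mono' (StronglyMeasurable.aestronglyMeasurable ?_)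
        (Filter.Eventually.of_forall fun p => ?_)
      · refine ((StronglyMeasurable.mul (Continuous.stronglyMeasurable (by fun_prop)) ?_).mul
          ?_).mul ?_
        · refine (hm.comp_measurable (by fun_prop)).mul (Continuous.stronglyMeasurable ?_)
          exact ((bandKernel κ₁).continuous.comp (by fun_prop)).mul
            ((bandKernel κ₂).continuous.comp (by fun_prop))
        · exact ((continuous_hat f₁).comp (by fun_prop)).stronglyMeasurable
        · exact ((continuous_hat f₂).comp (by fun_prop)).stronglyMeasurable
      · simp only [Function.uncurry, Function.comp, norm_mul, ContinuousLinearMap.mul_apply',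
          norm_exp_I_inner, one_mul, Prod.fst_swap, Prod.snd_swap, Prod.fst_sub, Prod.snd_sub,
          neg_sub]
        calc _ = ‖h (a, p.2)‖ * (‖hat f₁ p.1.1‖ * ‖hat f₂ p.1.2‖ *
              (‖bandKernel κ₁ (p.1.1 - p.2.1)‖ * ‖bandKernel κ₂ (p.1.2 - p.2.2)‖)) := by ring
          _ ≤ _ := by gcongr; exact hA _
    calc multiplierOp (partialSymbol h κ₁ κ₂ a) f₁ f₂ x
        = ∫ ξ : Rn n × Rn n, ∫ b : Rn n × Rn n,
            Complex.exp (Complex.I * ((inner ℝ x (ξ.1 + ξ.2) : ℝ) : ℂ)) * (h (a, b) *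
          (bandKernel κ₁ (ξ.1 - b.1) * bandKernel κ₂ (ξ.2 - b.2))) * hat f₁ ξ.1 * hat f₂ ξ.2 := by
          simp_rw [multiplierOp, partialSymbol, ← integral_const_mul, ← integral_mul_const]
      _ = ∫ b : Rn n × Rn n, ∫ ξ : Rn n × Rn n,
            Complex.exp (Complex.I * ((inner ℝ x (ξ.1 + ξ.2) : ℝ) : ℂ)) * (h (a, b) *
          (bandKernel κ₁ (ξ.1 - b.1) * bandKernel κ₂ (ξ.2 - b.2))) * hat f₁ ξ.1 * hat f₂ ξ.2 :=
          integral_integral_swap hint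
      _ = _ := by
          refine integral_congr_ae (Filter.Eventually.of_forall fun b => ?_)
          simp only
          rw [← integral_prod_mul, ← integral_const_mul]
          refine integral_congr_ae (Filter.Eventually.of_forall fun ξ => ?_)
          simp only [inner_add_right, Complex.ofReal_add, mul_add, Complex.exp_add]
          ring
  have hloc (κ : Rn n) {f g : 𝓢(Rn n, ℂ)} (hfg : ∀ y, ‖y - x - κ‖ < √n + 2 → f y = g y)
      (b : Rn n) :
      ∫ ξ, Complex.exp (Complex.I * ((inner ℝ x ξ : ℝ) : ℂ)) * bandKernel κ (ξ - b) * hat f ξ =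
      ∫ ξ, Complex.exp (Complex.I * ((inner ℝ x ξ : ℝ) : ℂ)) * bandKernel κ (ξ - b) * hat g ξ := by
    rw [integral_exp_bandKernel_hat, integral_exp_bandKernel_hat]
    refine integral_congr_ae (Filter.Eventually.of_forall fun y => ?_)
    simp only
    by_cases hy : ‖y - x - κ‖ < √n + 2
    · rw [hfg y hy]
    · rw [(cubeBump n).zero_of_le_dist (by rw [dist_zero_right]; exact not_lt.mp hy)]
      simp
  rw [expand, expand]
  simp_rw [hloc κ₁ h₁, hloc κ₂ h₂]

/-! ### Local `L²` estimates for band-limited symbols -/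

/-- The cutoff function that localizes to a neighbourhood of a unit cube. It is `1` on the ball of
radius `2√n + 2 = √n + (√n + 2)`: a point `x` at distance at most `√n` from `ρ` sees `f` within
distance `√n + 2`, the radius of the support of `cubeBump n`. -/
def cutoffBump (n : ℕ) : ContDiffBump (0 : Rn n) :=
  ⟨2 * √n + 2, 2 * √n + 3, by positivity, by linarith⟩

/-- The product of `f` with the cutoff function centred at `c`. -/
def localize (f : 𝓢(Rn n, ℂ)) (c : Rn n) : 𝓢(Rn n, ℂ) :=
  SchwartzMap.smulLeftCLM ℂ (SchwartzMap.compSubConstCLM ℂ c (bumpSchwartz (cutoffBump n))) f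

theorem localize_apply (f : 𝓢(Rn n, ℂ)) (c x : Rn n) :
    localize f c x = cutoffBump n (x - c) * f x := by
  rw [localize, SchwartzMap.smulLeftCLM_apply_apply (SchwartzMap.hasTemperateGrowth _),
    SchwartzMap.compSubConstCLM_apply, bumpSchwartz_apply, smul_eq_mul]

/-- The operator whose symbol is the convolution of `h` with band-limited kernels in all three
variables. -/
def bandOp (h : Rn n × Rn n × Rn n → ℂ) (κ₀ κ₁ κ₂ : Rn n) (f₁ f₂ : 𝓢(Rn n, ℂ)) (x : Rn n) : ℂ :=
  ∫ a, bandKernel κ₀ (x - a) * multiplierOp (partialSymbol h κ₁ κ₂ a) f₁ f₂ x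

/-- The kernels `bandKernel κ (x - a)` have an integrable majorant that is uniform in the frequency
`κ` and in the position of `x` in a ball of radius `√n`. -/
theorem exists_bandKernel_decay (n : ℕ) : ∃ D : Rn n → ℝ≥0∞, Measurable D ∧ ∫⁻ z, D z ≠ ∞ ∧
    ∀ κ x a ρ : Rn n, ‖x - ρ‖ ≤ √n → ‖bandKernel κ (x - a)‖ₑ ≤ D (ρ - a) := by
  obtain ⟨C, hC⟩ : ∃ C : ℝ, ∀ z : Rn n, (1 + ‖z‖) ^ (n + 1) * ‖bandKernel 0 z‖ ≤ C := by
    refine ⟨2 ^ (n + 1) * ((Finset.Iic (n + 1, 0)).sup fun m : ℕ × ℕ =>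
      SchwartzMap.seminorm ℂ m.1 m.2) (bandKernel (0 : Rn n)), fun z => ?_⟩
    have := SchwartzMap.one_add_le_sup_seminorm_apply (𝕜 := ℂ) (m := (n + 1, 0)) (k := n + 1)
      (n := 0) le_rfl le_rfl (bandKernel 0) z
    rw [norm_iteratedFDeriv_zero] at this
    exact this
  have hC0 : 0 ≤ C := le_trans (by positivity) (hC 0)
  refine ⟨fun z => ENNReal.ofReal (C * (1 + √n) ^ (n + 1)) *
    ENNReal.ofReal ((1 + ‖z‖) ^ (-((n + 1 : ℕ) : ℝ))), by fun_prop, ?_, fun κ x a ρ hx => ?_⟩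
  · rw [lintegral_const_mul _ (by fun_prop)]
    refine ENNReal.mul_ne_top ENNReal.ofReal_ne_top (finite_integral_one_add_norm ?_).ne
    rw [finrank_euclideanSpace_fin]
    push_cast; linarith
  · beta_reduce
    rw [← ENNReal.ofReal_mul (by positivity), ← ofReal_norm]
    apply ENNReal.ofReal_le_ofReal
    rw [norm_bandKernel, Real.rpow_neg (by positivity), Real.rpow_natCast, ← div_eq_mul_inv,
      le_div_iff₀ (by positivity)]
    have h1 : 1 + ‖ρ - a‖ ≤ (1 + √n) * (1 + ‖x - a‖) := by
      have h2 : ‖ρ - a‖ ≤ ‖x - ρ‖ + ‖x - a‖ := by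
        rw [show ρ - a = (x - a) - (x - ρ) by abel, add_comm]; exact norm_sub_le _ _
      have := mul_nonneg (Real.sqrt_nonneg n) (norm_nonneg (x - a))
      linarith
    calc ‖bandKernel 0 (x - a)‖ * (1 + ‖ρ - a‖) ^ (n + 1)
        ≤ ‖bandKernel 0 (x - a)‖ * ((1 + √n) * (1 + ‖x - a‖)) ^ (n + 1) := by gcongr
      _ = ((1 + ‖x - a‖) ^ (n + 1) * ‖bandKernel 0 (x - a)‖) * (1 + √n) ^ (n + 1) := by
          rw [mul_pow]; ring
      _ ≤ _ := by gcongr; exact hC _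

theorem measurable_bandOp {h : Rn n × Rn n × Rn n → ℂ} (hm : StronglyMeasurable h)
    (κ₀ κ₁ κ₂ : Rn n) (f₁ f₂ : 𝓢(Rn n, ℂ)) : StronglyMeasurable (bandOp h κ₀ κ₁ κ₂ f₁ f₂) := by
  have h1 : StronglyMeasurable fun p : Rn n × Rn n => bandKernel κ₀ (p.1 - p.2) *
      multiplierOp (partialSymbol h κ₁ κ₂ p.2) f₁ f₂ p.1 :=
    ((bandKernel κ₀).continuous.comp (by fun_prop)).stronglyMeasurable.mul
      ((stronglyMeasurable_multiplierOp_partialSymbol hm κ₁ κ₂ f₁ f₂).comp_measurable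
        (g := fun p : Rn n × Rn n => (p.2, p.1)) (by fun_prop))
  exact h1.integral_prod_right'

/-- The local `L²` estimate for a band-limited symbol: only the parts of `f₁` and `f₂` near
`ρ + κ₁` and `ρ + κ₂` enter. -/
theorem lintegral_bandOp_sq_le {s₁ s₂ : ℝ} (hs₁ : 0 < s₁) (hs₂ : 0 < s₂)
    (hs : s₁ + s₂ = (n : ℝ) / 2) :
    ∃ C : ℝ≥0, ∀ (h : Rn n × Rn n × Rn n → ℂ) (A : ℝ≥0), StronglyMeasurable h →
      (∀ p, ‖h p‖ ≤ A) → ∀ (κ₀ κ₁ κ₂ : Rn n) (f₁ f₂ : 𝓢(Rn n, ℂ)) (ρ : Rn n),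
      ∫⁻ x in Metric.closedBall ρ (√n), ‖bandOp h κ₀ κ₁ κ₂ f₁ f₂ x‖ₑ ^ 2 ≤
        (C * A * sobolevNorm s₁ (localize f₁ (ρ + κ₁)) *
          sobolevNorm s₂ (localize f₂ (ρ + κ₂))) ^ 2 := by
  obtain ⟨C, hC⟩ := lintegral_multiplierOp_sq_le hs₁ hs₂ hs
  obtain ⟨D, hDm, hDfin, hD⟩ := exists_bandKernel_decay n
  lift (∫⁻ z, D z) to ℝ≥0 using hDfin with I hI
  refine ⟨NNReal.sqrt C * I * (kernelNorm n).toNNReal ^ 2,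
    fun h A hm hA κ₀ κ₁ κ₂ f₁ f₂ ρ => ?_⟩
  set g₁ := localize f₁ (ρ + κ₁)
  set g₂ := localize f₂ (ρ + κ₂)
  set B : ℝ≥0 := A * (kernelNorm n).toNNReal ^ 2
  set U : Rn n → Rn n → ℂ := fun a x => multiplierOp (partialSymbol h κ₁ κ₂ a) g₁ g₂ x
  have hUm : Measurable fun p : Rn n × Rn n => ‖U p.1 p.2‖ₑ :=
    (stronglyMeasurable_multiplierOp_partialSymbol hm κ₁ κ₂ g₁ g₂).measurable.enorm
  have hB (a : Rn n) (ξ : Rn n × Rn n) : ‖partialSymbol h κ₁ κ₂ a ξ‖ₑ ≤ B := by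
    have := norm_partialSymbol_le hA κ₁ κ₂ a ξ
    rw [← ofReal_norm, ENNReal.ofReal_le_coe]
    simp only [B]
    push_cast
    rwa [Real.coe_toNNReal _ kernelNorm_nonneg]
  have hUL2 (a : Rn n) : ∫⁻ x, ‖U a x‖ₑ ^ 2 ≤
      C * (B * sobolevNorm s₁ g₁ * sobolevNorm s₂ g₂) ^ 2 :=
    hC _ B (stronglyMeasurable_partialSymbol_right hm κ₁ κ₂ a) (hB a) g₁ g₂
  have hDm' : Measurable fun a => D (ρ - a) :=
    hDm.comp (g := D) (f := fun a => ρ - a) (by fun_prop)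
  have hDI (f : ℝ≥0∞) : ∫⁻ a, D (ρ - a) * f = I * f := by
    rw [lintegral_mul_const _ hDm', lintegral_sub_left_eq_self D ρ, hI]
  have hpt (x : Rn n) (hx : x ∈ Metric.closedBall ρ (√n)) :
      ‖bandOp h κ₀ κ₁ κ₂ f₁ f₂ x‖ₑ ^ 2 ≤ I * ∫⁻ a, D (ρ - a) * ‖U a x‖ₑ ^ 2 := by
    have hx' : ‖x - ρ‖ ≤ √n := by rwa [mem_closedBall_iff_norm] at hx
    have hcut (f : 𝓢(Rn n, ℂ)) (κ y : Rn n) (hy : ‖y - x - κ‖ < √n + 2) :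
        f y = localize f (ρ + κ) y := by
      rw [localize_apply, (cutoffBump n).one_of_mem_closedBall, Complex.ofReal_one, one_mul]
      rw [mem_closedBall_zero_iff, show y - (ρ + κ) = (y - x - κ) + (x - ρ) by abel]
      refine (norm_add_le _ _).trans ?_
      have : (cutoffBump n).rIn = 2 * √n + 2 := rfl
      linarith
    have heq : bandOp h κ₀ κ₁ κ₂ f₁ f₂ x = ∫ a, bandKernel κ₀ (x - a) * U a x := by
      refine integral_congr_ae (Filter.Eventually.of_forall fun a => ?_)
      simp only [U]
      rw [multiplierOp_partialSymbol_congr hm hA κ₁ κ₂ a x (hcut f₁ κ₁) (hcut f₂ κ₂)]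
    have hUx : Measurable fun a => ‖U a x‖ₑ :=
      hUm.comp (g := fun p : Rn n × Rn n => ‖U p.1 p.2‖ₑ) (f := fun a => (a, x)) (by fun_prop)
    rw [heq]
    calc ‖∫ a, bandKernel κ₀ (x - a) * U a x‖ₑ ^ 2
        ≤ (∫⁻ a, D (ρ - a) ^ (1 / 2 : ℝ) * (D (ρ - a) ^ (1 / 2 : ℝ) * ‖U a x‖ₑ)) ^ 2 := by
          gcongr
          refine (enorm_integral_le_lintegral_enorm _).trans (lintegral_mono fun a => ?_)
          rw [enorm_mul, ← mul_assoc, ← sq, sq_sqrt_ennreal]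
          gcongr
          exact hD κ₀ x a ρ hx'
      _ ≤ (∫⁻ a, (D (ρ - a) ^ (1 / 2 : ℝ)) ^ 2) *
            ∫⁻ a, (D (ρ - a) ^ (1 / 2 : ℝ) * ‖U a x‖ₑ) ^ 2 :=
          lintegral_mul_sq_le (hDm'.pow_const _).aemeasurable
            ((hDm'.pow_const _).mul hUx).aemeasurable
      _ = _ := by
          simp_rw [mul_pow, sq_sqrt_ennreal]
          congr 1
          simpa using hDI 1
  calc ∫⁻ x in Metric.closedBall ρ (√n), ‖bandOp h κ₀ κ₁ κ₂ f₁ f₂ x‖ₑ ^ 2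
      ≤ ∫⁻ x in Metric.closedBall ρ (√n), I * ∫⁻ a, D (ρ - a) * ‖U a x‖ₑ ^ 2 :=
        setLIntegral_mono_ae' measurableSet_closedBall (Filter.Eventually.of_forall hpt)
    _ ≤ ∫⁻ x, I * ∫⁻ a, D (ρ - a) * ‖U a x‖ₑ ^ 2 :=
        lintegral_mono' Measure.restrict_le_self le_rfl
    _ = I * ∫⁻ a, D (ρ - a) * ∫⁻ x, ‖U a x‖ₑ ^ 2 := by
        rw [lintegral_const_mul' _ _ ENNReal.coe_ne_top, lintegral_lintegral_swap]
        · congr 1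
          refine lintegral_congr fun a => ?_
          have hUa : Measurable fun x => ‖U a x‖ₑ :=
            hUm.comp (g := fun p : Rn n × Rn n => ‖U p.1 p.2‖ₑ) (f := fun x => (a, x))
              (by fun_prop)
          rw [lintegral_const_mul _ (hUa.pow_const 2)]
        · refine Measurable.aemeasurable ?_
          have hDs : Measurable fun p : Rn n × Rn n => D (ρ - p.2) :=
            hDm.comp (g := D) (f := fun p : Rn n × Rn n => ρ - p.2) (by fun_prop)
          have hUs : Measurable fun p : Rn n × Rn n => ‖U p.2 p.1‖ₑ :=
            hUm.comp (g := fun p : Rn n × Rn n => ‖U p.1 p.2‖ₑ)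
              (f := fun p : Rn n × Rn n => (p.2, p.1)) (by fun_prop)
          exact hDs.mul (hUs.pow_const 2)
    _ ≤ I * ∫⁻ a, D (ρ - a) * (C * (B * sobolevNorm s₁ g₁ * sobolevNorm s₂ g₂) ^ 2) := by
        gcongr with a
        exact hUL2 a
    _ = _ := by
        rw [hDI]
        have : (C : ℝ≥0∞) = (NNReal.sqrt C : ℝ≥0∞) ^ 2 := by
          rw [← ENNReal.coe_pow, NNReal.sq_sqrt]
        rw [this]
        simp only [B]
        push_cast
        ring

end Localization

/-! ### Localized Sobolev norms -/

section SobolevLocal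

variable {n : ℕ}

/-- Fourier inversion in the normalization of `hat`. -/
theorem integral_exp_mul_hat (f : 𝓢(Rn n, ℂ)) (y : Rn n) :
    ∫ η, Complex.exp (Complex.I * ((inner ℝ y η : ℝ) : ℂ)) * hat f η =
      ((2 * Real.pi) ^ n : ℝ) * f y := by
  have h1 : f y = ∫ v, Complex.exp (Complex.I * ((inner ℝ ((2 * Real.pi) • y) v : ℝ) : ℂ)) *
      𝓕 f v := by
    rw [integral_exp_eq_fourierInv, inv_smul_smul₀ Real.two_pi_pos.ne',
      ← SchwartzMap.fourierInv_coe,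
      fourierInv_fourier_eq]
  have h2 := Measure.integral_comp_smul (volume : Measure (Rn n))
    (fun v => Complex.exp (Complex.I * ((inner ℝ ((2 * Real.pi) • y) v : ℝ) : ℂ)) * 𝓕 f v)
    ((2 * Real.pi)⁻¹)
  rw [← h1, finrank_euclideanSpace_fin, inv_pow, inv_inv, abs_of_pos (by positivity)] at h2
  rw [← Complex.real_smul, ← h2]
  refine integral_congr_ae (Filter.Eventually.of_forall fun η => ?_)
  have h3 : inner ℝ ((2 * Real.pi) • y) ((2 * Real.pi)⁻¹ • η) = inner ℝ y η := by
    rw [real_inner_smul_left, real_inner_smul_right, mul_inv_cancel_left₀ Real.two_pi_pos.ne']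
  simp only [hat_eq_fourier, h3]

/-- The Fourier transform of a localized function, as an integral over frequencies. -/
theorem hat_localize (f : 𝓢(Rn n, ℂ)) (c ξ : Rn n) :
    ((2 * Real.pi) ^ n : ℝ) * hat (localize f c) ξ =
      Complex.exp (-(Complex.I * ((inner ℝ ξ c : ℝ) : ℂ))) *
        ∫ η, Complex.exp (Complex.I * ((inner ℝ c η : ℝ) : ℂ)) *
          (hat f η * hat (bumpSchwartz (cutoffBump n)) (ξ - η)) := by
  set χ := bumpSchwartz (cutoffBump n) with hχ
  have hint : Integrable (Function.uncurry fun y η : Rn n =>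
      Complex.exp (-(Complex.I * ((inner ℝ ξ y : ℝ) : ℂ))) * (χ (y - c) *
        (Complex.exp (Complex.I * ((inner ℝ y η : ℝ) : ℂ)) * hat f η))) (volume.prod volume) := by
    have h1 := ((χ.integrable (μ := volume)).comp_sub_right c).mul_prod (integrable_hat f)
    refine h1.norm.mono' (Continuous.aestronglyMeasurable ?_)
      (Filter.Eventually.of_forall fun p => ?_)
    · have := χ.continuous
      have := continuous_hat f
      fun_prop
    · simp only [Function.uncurry, norm_mul, norm_exp_I_inner, one_mul]
      rw [← mul_neg, ← Complex.ofReal_neg, ← inner_neg_left, norm_exp_I_inner, one_mul]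
  calc ((2 * Real.pi) ^ n : ℝ) * hat (localize f c) ξ
      = ∫ y, ∫ η, Complex.exp (-(Complex.I * ((inner ℝ ξ y : ℝ) : ℂ))) * (χ (y - c) *
        (Complex.exp (Complex.I * ((inner ℝ y η : ℝ) : ℂ)) * hat f η)) := by
        rw [hat, ← integral_const_mul]
        refine integral_congr_ae (Filter.Eventually.of_forall fun y => ?_)
        simp only [integral_const_mul, integral_exp_mul_hat, localize_apply, hχ,
          bumpSchwartz_apply]
        ring
    _ = ∫ η, ∫ y, Complex.exp (-(Complex.I * ((inner ℝ ξ y : ℝ) : ℂ))) * (χ (y - c) *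
        (Complex.exp (Complex.I * ((inner ℝ y η : ℝ) : ℂ)) * hat f η)) :=
        integral_integral_swap hint
    _ = _ := by
        rw [← integral_const_mul]
        refine integral_congr_ae (Filter.Eventually.of_forall fun η => ?_)
        simp only
        have h4 : hat χ (ξ - η) =
            ∫ y, Complex.exp (-(Complex.I * ((inner ℝ (ξ - η) y : ℝ) : ℂ))) * χ y := rfl
        rw [h4]
        conv_lhs => rw [← integral_add_right_eq_self _ c]
        rw [← integral_const_mul, ← integral_const_mul, ← integral_const_mul]
        refine integral_congr_ae (Filter.Eventually.of_forall fun y => ?_)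
        simp only [add_sub_cancel_right]
        have : Complex.exp (-(Complex.I * ((inner ℝ ξ (y + c) : ℝ) : ℂ))) *
            Complex.exp (Complex.I * ((inner ℝ (y + c) η : ℝ) : ℂ)) =
            Complex.exp (-(Complex.I * ((inner ℝ ξ c : ℝ) : ℂ))) *
            Complex.exp (Complex.I * ((inner ℝ c η : ℝ) : ℂ)) *
            Complex.exp (-(Complex.I * ((inner ℝ (ξ - η) y : ℝ) : ℂ))) := by
          simp only [← Complex.exp_add, inner_add_left, inner_add_right, inner_sub_left,
            real_inner_comm y η]
          push_cast
          congr 1; ring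
        calc _ = (Complex.exp (-(Complex.I * ((inner ℝ ξ (y + c) : ℝ) : ℂ))) *
            Complex.exp (Complex.I * ((inner ℝ (y + c) η : ℝ) : ℂ))) * (χ y * hat f η) := by ring
          _ = _ := by rw [this]; ring

/-- Peetre's inequality. -/
theorem weight_le_mul {s : ℝ} (hs : 0 ≤ s) (ξ η : Rn n) :
    weight s ξ ≤ ENNReal.ofReal (2 ^ (s / 2)) * (weight s (ξ - η) * weight s η) := by
  rw [weight, weight, weight, ← ENNReal.ofReal_mul (by positivity),
    ← ENNReal.ofReal_mul (by positivity), ← Real.mul_rpow (by positivity) (by positivity),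
    ← Real.mul_rpow (by positivity) (by positivity)]
  apply ENNReal.ofReal_le_ofReal
  apply Real.rpow_le_rpow (by positivity) _ (by positivity)
  have h1 : ‖ξ‖ ≤ ‖ξ - η‖ + ‖η‖ := by simpa using norm_add_le (ξ - η) η
  have h2 : ‖ξ‖ ^ 2 ≤ (‖ξ - η‖ + ‖η‖) ^ 2 := by gcongr
  nlinarith [sq_nonneg (‖ξ - η‖ - ‖η‖), sq_nonneg (‖ξ - η‖ * ‖η‖)]

theorem measurable_hat_localize (f : 𝓢(Rn n, ℂ)) :
    Measurable fun p : Rn n × Rn n => hat (localize f p.1) p.2 := by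
  have h1 : StronglyMeasurable fun q : (Rn n × Rn n) × Rn n =>
      Complex.exp (-(Complex.I * ((inner ℝ q.1.2 q.2 : ℝ) : ℂ))) *
        (bumpSchwartz (cutoffBump n) (q.2 - q.1.1) * f q.2) := by
    refine Continuous.stronglyMeasurable ?_
    have := (bumpSchwartz (cutoffBump n)).continuous
    have := f.continuous
    fun_prop
  have h2 : StronglyMeasurable fun p : Rn n × Rn n => ∫ y,
      Complex.exp (-(Complex.I * ((inner ℝ p.2 y : ℝ) : ℂ))) *
        (bumpSchwartz (cutoffBump n) (y - p.1) * f y) := h1.integral_prod_right'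
  convert h2.measurable using 3 with p
  simp only [hat, localize_apply, bumpSchwartz_apply]

/-- The square sum (integral) of the Sobolev norms of the localizations of `f` is controlled by
the Sobolev norm of `f`. -/
theorem lintegral_sobolevNorm_localize_sq_le {s : ℝ} (hs : 0 ≤ s) :
    ∃ C : ℝ≥0, ∀ f : 𝓢(Rn n, ℂ),
      ∫⁻ c, sobolevNorm s (localize f c) ^ 2 ≤ C * sobolevNorm s f ^ 2 := by
  set χ := bumpSchwartz (cutoffBump n) with hχ
  set K : ℝ≥0∞ := (ENNReal.ofReal (2 ^ (s / 2)) * sobolevNorm s χ) ^ 2 with hK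
  have hKfin : K ≠ ∞ :=
    (ENNReal.pow_lt_top (ENNReal.mul_lt_top ENNReal.ofReal_lt_top (sobolevNorm_lt_top _ _))).ne
  set q : ℝ≥0∞ := ENNReal.ofReal ((2 * Real.pi) ^ n)
  have hpi : (1 : ℝ) ≤ 2 * Real.pi := by linarith [Real.pi_gt_three]
  have hq1 : 1 ≤ q := by
    rw [← ENNReal.ofReal_one]; exact ENNReal.ofReal_le_ofReal (one_le_pow₀ hpi)
  refine ⟨(q * K).toNNReal, fun f => ?_⟩
  rw [ENNReal.coe_toNNReal (ENNReal.mul_ne_top ENNReal.ofReal_ne_top hKfin)]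
  have hw := measurable_weight (n := n) s
  have hfm : Measurable fun η => ‖hat f η‖ₑ := (continuous_hat f).measurable.enorm
  have hχm : Measurable fun η => ‖hat χ η‖ₑ := (continuous_hat χ).measurable.enorm
  -- Plancherel's theorem in the variable `c`
  have hc (ξ : Rn n) : ∫⁻ c, ‖hat (localize f c) ξ‖ₑ ^ 2 ≤
      q * ∫⁻ η, (‖hat f η‖ₑ * ‖hat χ (ξ - η)‖ₑ) ^ 2 := by
    set R : Rn n → ℂ := fun η => hat f η * hat χ (ξ - η)
    obtain ⟨M, hM⟩ : ∃ M : ℝ, ∀ η, ‖hat χ η‖ ≤ M := by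
      refine ⟨SchwartzMap.seminorm ℂ 0 0 (hatSchwartz χ), fun η => ?_⟩
      rw [← coe_hatSchwartz]
      exact SchwartzMap.norm_le_seminorm ℂ _ _
    have hcont : Continuous fun η => hat χ (ξ - η) :=
      (continuous_hat χ).comp (continuous_const.sub continuous_id)
    have hR1 : Integrable R := by
      refine (integrable_hat f).mul_bdd hcont.aestronglyMeasurable (c := M)
        (Filter.Eventually.of_forall fun η => hM _)
    have hR2 : MemLp R 2 volume := by
      have hf2 : MemLp (hat f) 2 volume := coe_hatSchwartz f ▸ (hatSchwartz f).memLp 2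
      refine (hf2.norm.const_mul M).mono
        ((continuous_hat f).mul hcont).aestronglyMeasurable
        (Filter.Eventually.of_forall fun η => ?_)
      have hM0 : 0 ≤ M := (norm_nonneg _).trans (hM 0)
      simp only [R, norm_mul, norm_norm, Real.norm_of_nonneg hM0]
      rw [mul_comm]
      gcongr
      exact hM _
    have hval (c : Rn n) : ‖hat (localize f c) ξ‖ₑ ≤ ‖𝓕⁻ R ((2 * Real.pi)⁻¹ • c)‖ₑ := by
      have h1 := congrArg norm (hat_localize f c ξ)
      rw [norm_mul, norm_mul, ← mul_neg, ← Complex.ofReal_neg, ← inner_neg_left,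
        norm_exp_I_inner, one_mul, Complex.norm_real, Real.norm_of_nonneg (by positivity),
        integral_exp_eq_fourierInv] at h1
      rw [← ofReal_norm, ← ofReal_norm]
      apply ENNReal.ofReal_le_ofReal
      rw [← h1]
      exact le_mul_of_one_le_left (norm_nonneg _) (one_le_pow₀ hpi)
    calc ∫⁻ c, ‖hat (localize f c) ξ‖ₑ ^ 2
        ≤ ∫⁻ c, ‖𝓕⁻ R ((2 * Real.pi)⁻¹ • c)‖ₑ ^ 2 := by gcongr with c; exact hval c
      _ = q * ∫⁻ c, ‖𝓕⁻ R c‖ₑ ^ 2 := lintegral_comp_inv_two_pi_smul (fun c => ‖𝓕⁻ R c‖ₑ ^ 2)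
      _ = _ := by rw [lintegral_fourierInv_sq hR1 hR2]; simp only [R, enorm_mul]
  have hlm : Measurable fun p : Rn n × Rn n => (weight s p.2 * ‖hat (localize f p.1) p.2‖ₑ) ^ 2 :=
    ((hw.comp measurable_snd).mul (measurable_hat_localize f).enorm).pow_const 2
  have hlm' (ξ : Rn n) : Measurable fun c => ‖hat (localize f c) ξ‖ₑ ^ 2 :=
    (((measurable_hat_localize f).enorm.pow_const 2).comp
      (measurable_prodMk_right : Measurable fun c : Rn n => (c, ξ)) :)
  have hGm : Measurable fun p : Rn n × Rn n =>
      (weight s (p.1 - p.2) * ‖hat χ (p.1 - p.2)‖ₑ) ^ 2 * (weight s p.2 * ‖hat f p.2‖ₑ) ^ 2 := by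
    have hsub : Measurable fun p : Rn n × Rn n => p.1 - p.2 := by fun_prop
    exact (((hw.comp hsub).mul (hχm.comp hsub)).pow_const 2).mul
      (((hw.comp measurable_snd).mul (hfm.comp measurable_snd)).pow_const 2)
  calc ∫⁻ c, sobolevNorm s (localize f c) ^ 2
      = ∫⁻ c, ∫⁻ ξ, (weight s ξ * ‖hat (localize f c) ξ‖ₑ) ^ 2 := by simp_rw [sobolevNorm_sq]
    _ = ∫⁻ ξ, ∫⁻ c, (weight s ξ * ‖hat (localize f c) ξ‖ₑ) ^ 2 :=
        lintegral_lintegral_swap hlm.aemeasurable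
    _ ≤ ∫⁻ ξ, q * (ENNReal.ofReal (2 ^ (s / 2)) ^ 2 * ∫⁻ η,
          (weight s (ξ - η) * ‖hat χ (ξ - η)‖ₑ) ^ 2 * (weight s η * ‖hat f η‖ₑ) ^ 2) := by
        refine lintegral_mono fun ξ => ?_
        simp_rw [mul_pow (weight s ξ)]
        rw [lintegral_const_mul _ (hlm' ξ)]
        calc weight s ξ ^ 2 * ∫⁻ c, ‖hat (localize f c) ξ‖ₑ ^ 2
            ≤ weight s ξ ^ 2 * (q * ∫⁻ η, (‖hat f η‖ₑ * ‖hat χ (ξ - η)‖ₑ) ^ 2) := by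
              gcongr; exact hc ξ
          _ = q * ∫⁻ η, (weight s ξ * (‖hat f η‖ₑ * ‖hat χ (ξ - η)‖ₑ)) ^ 2 := by
              simp_rw [mul_pow (weight s ξ)]
              rw [lintegral_const_mul' _ _ (by simp [weight_ne_top])]
              ring
          _ ≤ _ := by
              rw [← lintegral_const_mul' _ _ (ENNReal.pow_ne_top ENNReal.ofReal_ne_top)]
              gcongr with η
              rw [← mul_pow, ← mul_pow]
              refine pow_le_pow_left₀ zero_le ?_ 2
              calc weight s ξ * (‖hat f η‖ₑ * ‖hat χ (ξ - η)‖ₑ)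
                  ≤ (ENNReal.ofReal (2 ^ (s / 2)) * (weight s (ξ - η) * weight s η)) *
                    (‖hat f η‖ₑ * ‖hat χ (ξ - η)‖ₑ) := by gcongr; exact weight_le_mul hs ξ η
                _ = _ := by ring
    _ = q * (ENNReal.ofReal (2 ^ (s / 2)) ^ 2 * ∫⁻ ξ, ∫⁻ η,
          (weight s (ξ - η) * ‖hat χ (ξ - η)‖ₑ) ^ 2 * (weight s η * ‖hat f η‖ₑ) ^ 2) := by
        rw [lintegral_const_mul' _ _ ENNReal.ofReal_ne_top, lintegral_const_mul' _ _ (by simp)]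
    _ = q * (ENNReal.ofReal (2 ^ (s / 2)) ^ 2 * (sobolevNorm s χ ^ 2 * sobolevNorm s f ^ 2)) := by
        congr 2
        have hwf : Measurable fun η => (weight s η * ‖hat f η‖ₑ) ^ 2 := (hw.mul hfm).pow_const 2
        rw [lintegral_lintegral_swap hGm.aemeasurable, sobolevNorm_sq s f,
          ← lintegral_const_mul _ hwf]
        refine lintegral_congr fun η => ?_
        have hsub : Measurable fun ξ : Rn n => ξ - η := by fun_prop
        have hχη : Measurable fun ξ : Rn n => (weight s (ξ - η) * ‖hat χ (ξ - η)‖ₑ) ^ 2 :=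
          ((hw.comp hsub).mul (hχm.comp hsub)).pow_const 2
        rw [lintegral_mul_const _ hχη,
          lintegral_sub_right_eq_self (fun ξ => (weight s ξ * ‖hat χ ξ‖ₑ) ^ 2) η, sobolevNorm_sq]
    _ = _ := by rw [hK]; ring

/-! ### The amalgam norm -/

theorem cube_eq_preimage (ν : Fin n → ℤ) : cube ν = (MeasurableEquiv.toLp 2 (Fin n → ℝ)).symm ⁻¹'
    Set.univ.pi fun i => Set.Ico (ν i - 1 / 2 : ℝ) (ν i + 1 / 2) := by
  ext x
  simp only [cube, Set.mem_ofPred_eq, Set.mem_preimage, Set.mem_univ_pi, Set.mem_Ico]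
  refine forall_congr' fun i => ?_
  change _ ↔ (ν i - 1 / 2 : ℝ) ≤ x i ∧ x i < ν i + 1 / 2
  constructor <;> rintro ⟨h1, h2⟩ <;> constructor <;> linarith

theorem measurableSet_cube (ν : Fin n → ℤ) : MeasurableSet (cube (n := n) ν) := by
  rw [cube_eq_preimage]
  exact (MeasurableSet.univ_pi fun i => measurableSet_Ico).preimage
    (MeasurableEquiv.toLp 2 (Fin n → ℝ)).symm.measurable

theorem volume_cube (ν : Fin n → ℤ) : volume (cube (n := n) ν) = 1 := by
  rw [cube_eq_preimage, (EuclideanSpace.volume_preserving_symm_measurableEquiv_toLp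
    (Fin n)).measure_preimage (MeasurableSet.univ_pi fun i => measurableSet_Ico).nullMeasurableSet,
    volume_pi_pi]
  simp only [Real.volume_Ico]
  norm_num

theorem pairwise_disjoint_cube : Pairwise (Function.onFun Disjoint (cube (n := n))) := by
  intro ν μ hne
  rw [Function.onFun, Set.disjoint_left]
  intro x hν hμ
  apply hne
  ext i
  obtain ⟨h1, h2⟩ := hν i
  obtain ⟨h3, h4⟩ := hμ i
  have h5 : (ν i : ℝ) < μ i + 1 := by linarith
  have h6 : (μ i : ℝ) < ν i + 1 := by linarith
  have h5' : ν i < μ i + 1 := by exact_mod_cast h5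
  have h6' : μ i < ν i + 1 := by exact_mod_cast h6
  omega

theorem iUnion_cube : ⋃ ν, cube (n := n) ν = Set.univ := by
  ext x
  simp only [Set.mem_iUnion, Set.mem_univ, iff_true]
  refine ⟨fun i => ⌊x i + 1 / 2⌋, fun i => ⟨?_, ?_⟩⟩
  · have := Int.floor_le (x i + 1 / 2); linarith
  · have := Int.lt_floor_add_one (x i + 1 / 2); linarith

theorem norm_sub_le_of_mem_cube {ν : Fin n → ℤ} {x y : Rn n} (hx : x ∈ cube ν) (hy : y ∈ cube ν) :
    ‖x - y‖ ≤ √n := by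
  rw [EuclideanSpace.norm_eq]
  apply Real.sqrt_le_sqrt
  calc _ ≤ ∑ _i : Fin n, (1 : ℝ) := by
        gcongr with i
        obtain ⟨h1, h2⟩ := hx i
        obtain ⟨h3, h4⟩ := hy i
        rw [Real.norm_eq_abs, sq_le_one_iff_abs_le_one, abs_abs, PiLp.sub_apply, abs_le]
        constructor <;> linarith
    _ = n := by simp

/-- The amalgam norm is controlled by the integral of the `L²` norms over balls. -/
theorem amalgamNorm_le_lintegral (f : Rn n → ℂ) :
    amalgamNorm f ≤
      ∫⁻ ρ, (∫⁻ x in Metric.closedBall ρ (√n), ‖f x‖ₑ ^ 2) ^ (1 / 2 : ℝ) := by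
  calc amalgamNorm f
      = ∑' ν : Fin n → ℤ, ∫⁻ _ρ in cube (n := n) ν, eLpNorm f 2 (volume.restrict (cube ν)) := by
        simp [amalgamNorm, volume_cube]
    _ ≤ ∑' ν : Fin n → ℤ, ∫⁻ ρ in cube (n := n) ν,
          (∫⁻ x in Metric.closedBall ρ (√n), ‖f x‖ₑ ^ 2) ^ (1 / 2 : ℝ) := by
        refine ENNReal.tsum_le_tsum fun ν => ?_
        refine setLIntegral_mono_ae' (measurableSet_cube ν)
          (Filter.Eventually.of_forall fun ρ hρ => ?_)
        rw [eLpNorm_two_eq]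
        gcongr
        intro x hx
        rw [mem_closedBall_iff_norm]
        exact norm_sub_le_of_mem_cube hx hρ
    _ = _ := by
        rw [← lintegral_iUnion measurableSet_cube pairwise_disjoint_cube, iUnion_cube,
          setLIntegral_univ]

end SobolevLocal

/-! ### The estimate in the amalgam space -/

section AmalgamEstimate

variable {n : ℕ}

/-- A bounded function convolved with band-limited kernels in all three variables. -/
def bandSymbol (h : Rn n × Rn n × Rn n → ℂ) (κ₀ κ₁ κ₂ x : Rn n) (ξ : Rn n × Rn n) : ℂ :=
  ∫ a, bandKernel κ₀ (x - a) * partialSymbol h κ₁ κ₂ a ξ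

theorem integral_eq_bandSymbol {h : Rn n × Rn n × Rn n → ℂ} (hm : StronglyMeasurable h)
    {A : ℝ} (hA : ∀ p, ‖h p‖ ≤ A) (κ₀ κ₁ κ₂ : Rn n) (p : Rn n × Rn n × Rn n) :
    ∫ q, h q * (bandKernel κ₀ (p.1 - q.1) * bandKernel κ₁ (p.2.1 - q.2.1) *
      bandKernel κ₂ (p.2.2 - q.2.2)) = bandSymbol h κ₀ κ₁ κ₂ p.1 p.2 := by
  have hint : Integrable (fun q : Rn n × Rn n × Rn n =>
      h q * (bandKernel κ₀ (p.1 - q.1) * bandKernel κ₁ (p.2.1 - q.2.1) *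
        bandKernel κ₂ (p.2.2 - q.2.2))) (volume.prod volume) := by
    have h1 : Integrable fun q : Rn n × Rn n × Rn n => bandKernel κ₀ (p.1 - q.1) *
        (bandKernel κ₁ (p.2.1 - q.2.1) * bandKernel κ₂ (p.2.2 - q.2.2)) :=
      ((bandKernel κ₀).integrable.comp_sub_left p.1).mul_prod
        (integrable_bandKernel_prod κ₁ κ₂ p.2)
    simp_rw [mul_assoc]
    exact h1.bdd_mul hm.aestronglyMeasurable (Filter.Eventually.of_forall hA)
  rw [bandSymbol, Measure.volume_eq_prod, integral_prod _ hint]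
  refine integral_congr_ae (Filter.Eventually.of_forall fun a => ?_)
  simp only [partialSymbol]
  rw [← integral_const_mul]
  refine integral_congr_ae (Filter.Eventually.of_forall fun b => ?_)
  simp only
  ring

theorem norm_bandSymbol_le {h : Rn n × Rn n × Rn n → ℂ} {A : ℝ} (hA : ∀ p, ‖h p‖ ≤ A)
    (κ₀ κ₁ κ₂ x : Rn n) (ξ : Rn n × Rn n) :
    ‖bandSymbol h κ₀ κ₁ κ₂ x ξ‖ ≤ A * kernelNorm n ^ 3 := by
  refine (norm_integral_le_integral_norm _).trans ?_
  calc ∫ a, ‖bandKernel κ₀ (x - a) * partialSymbol h κ₁ κ₂ a ξ‖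
      ≤ ∫ a, ‖bandKernel κ₀ (x - a)‖ * (A * kernelNorm n ^ 2) := by
        refine integral_mono_of_nonneg (Filter.Eventually.of_forall fun _ => norm_nonneg _)
          (((bandKernel κ₀).integrable.comp_sub_left x).norm.mul_const _)
          (Filter.Eventually.of_forall fun a => ?_)
        simp only [norm_mul]
        gcongr
        exact norm_partialSymbol_le hA κ₁ κ₂ a ξ
    _ = A * kernelNorm n ^ 3 := by
        rw [integral_mul_const, integral_norm_bandKernel_sub]; ring

theorem stronglyMeasurable_bandSymbol {h : Rn n × Rn n × Rn n → ℂ} (hm : StronglyMeasurable h)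
    (κ₀ κ₁ κ₂ x : Rn n) : StronglyMeasurable (bandSymbol h κ₀ κ₁ κ₂ x) := by
  have h1 : StronglyMeasurable fun q : (Rn n × Rn n) × Rn n =>
      bandKernel κ₀ (x - q.2) * partialSymbol h κ₁ κ₂ q.2 q.1 :=
    ((bandKernel κ₀).continuous.comp (by fun_prop)).stronglyMeasurable.mul
      ((stronglyMeasurable_partialSymbol hm κ₁ κ₂).comp_measurable
        (g := fun q : (Rn n × Rn n) × Rn n => (q.2, q.1)) (by fun_prop))
  exact h1.integral_prod_right'

/-- `bandOp` is the pseudo-differential operator with symbol `bandSymbol`. -/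
theorem multiplierOp_bandSymbol {h : Rn n × Rn n × Rn n → ℂ} (hm : StronglyMeasurable h)
    {A : ℝ} (hA : ∀ p, ‖h p‖ ≤ A) (κ₀ κ₁ κ₂ : Rn n) (f₁ f₂ : 𝓢(Rn n, ℂ)) (x : Rn n) :
    multiplierOp (bandSymbol h κ₀ κ₁ κ₂ x) f₁ f₂ x = bandOp h κ₀ κ₁ κ₂ f₁ f₂ x := by
  have hint : Integrable (Function.uncurry fun (ξ : Rn n × Rn n) (a : Rn n) =>
      Complex.exp (Complex.I * ((inner ℝ x (ξ.1 + ξ.2) : ℝ) : ℂ)) *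
        (bandKernel κ₀ (x - a) * partialSymbol h κ₁ κ₂ a ξ) * hat f₁ ξ.1 * hat f₂ ξ.2)
      (volume.prod volume) := by
    have h1 := (integrable_hat_prod f₁ f₂).mul_prod
      ((bandKernel κ₀).integrable (μ := volume) |>.comp_sub_left x)
    refine (h1.norm.const_mul (A * kernelNorm n ^ 2)).mono'
      (StronglyMeasurable.aestronglyMeasurable ?_) (Filter.Eventually.of_forall fun p => ?_)
    · refine ((StronglyMeasurable.mul (Continuous.stronglyMeasurable (by fun_prop)) ?_).mul
          ?_).mul ?_
      · exact ((bandKernel κ₀).continuous.comp (by fun_prop)).stronglyMeasurable.mul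
          ((stronglyMeasurable_partialSymbol hm κ₁ κ₂).comp_measurable
            (g := fun q : (Rn n × Rn n) × Rn n => (q.2, q.1)) (by fun_prop))
      · exact ((continuous_hat f₁).comp (by fun_prop)).stronglyMeasurable
      · exact ((continuous_hat f₂).comp (by fun_prop)).stronglyMeasurable
    · simp only [Function.uncurry, norm_mul, norm_exp_I_inner, one_mul]
      calc _ = ‖partialSymbol h κ₁ κ₂ p.2 p.1‖ *
            (‖hat f₁ p.1.1‖ * ‖hat f₂ p.1.2‖ * ‖bandKernel κ₀ (x - p.2)‖) := by ring
        _ ≤ _ := by gcongr; exact norm_partialSymbol_le hA κ₁ κ₂ _ _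
  calc multiplierOp (bandSymbol h κ₀ κ₁ κ₂ x) f₁ f₂ x
      = ∫ ξ : Rn n × Rn n, ∫ a, Complex.exp (Complex.I * ((inner ℝ x (ξ.1 + ξ.2) : ℝ) : ℂ)) *
        (bandKernel κ₀ (x - a) * partialSymbol h κ₁ κ₂ a ξ) * hat f₁ ξ.1 * hat f₂ ξ.2 := by
        simp_rw [multiplierOp, bandSymbol, ← integral_const_mul, ← integral_mul_const]
    _ = ∫ a, ∫ ξ : Rn n × Rn n, Complex.exp (Complex.I * ((inner ℝ x (ξ.1 + ξ.2) : ℝ) : ℂ)) *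
        (bandKernel κ₀ (x - a) * partialSymbol h κ₁ κ₂ a ξ) * hat f₁ ξ.1 * hat f₂ ξ.2 :=
        integral_integral_swap hint
    _ = _ := by
        rw [bandOp]
        refine integral_congr_ae (Filter.Eventually.of_forall fun a => ?_)
        simp only [multiplierOp]
        rw [← integral_const_mul]
        refine integral_congr_ae (Filter.Eventually.of_forall fun ξ => ?_)
        simp only
        ring

theorem bilinearOp_eq_multiplierOp (σ : Rn3 n → ℂ) (f₁ f₂ : 𝓢(Rn n, ℂ)) (x : Rn n) :
    bilinearOp σ f₁ f₂ x = (((2 * Real.pi) ^ (2 * n))⁻¹ : ℝ) *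
      multiplierOp (fun ξ => σ (triple x ξ.1 ξ.2)) f₁ f₂ x := rfl

/-- The operator of a symbol that is an absolutely convergent series of band-limited symbols is
dominated by the sum of the operators of the terms. -/
theorem enorm_bilinearOp_le_tsum {ι : Type*} [Countable ι] {σ : Rn3 n → ℂ} {A : ι → ℝ}
    (hA : Summable A) {h : ι → Rn n × Rn n × Rn n → ℂ} (hm : ∀ k, StronglyMeasurable (h k))
    (hhA : ∀ k p, ‖h k p‖ ≤ A k) {κ₀ κ₁ κ₂ : ι → Rn n} {x : Rn n}
    (hσ : ∀ᵐ ξ : Rn n × Rn n, σ (triple x ξ.1 ξ.2) =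
      ∑' k, bandSymbol (h k) (κ₀ k) (κ₁ k) (κ₂ k) x ξ) (f₁ f₂ : 𝓢(Rn n, ℂ)) :
    ‖bilinearOp σ f₁ f₂ x‖ₑ ≤ ∑' k, ‖bandOp (h k) (κ₀ k) (κ₁ k) (κ₂ k) f₁ f₂ x‖ₑ := by
  set G : ι → Rn n × Rn n → ℂ := fun k => bandSymbol (h k) (κ₀ k) (κ₁ k) (κ₂ k) x
  have hG (k : ι) (ξ : Rn n × Rn n) : ‖G k ξ‖ ≤ A k * kernelNorm n ^ 3 :=
    norm_bandSymbol_le (hhA k) _ _ _ _ _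
  have hGs (ξ : Rn n × Rn n) : Summable fun k => G k ξ :=
    Summable.of_norm_bounded (hA.mul_right _) fun k => hG k ξ
  set F : ι → Rn n × Rn n → ℂ := fun k ξ =>
    Complex.exp (Complex.I * ((inner ℝ x (ξ.1 + ξ.2) : ℝ) : ℂ)) * G k ξ * hat f₁ ξ.1 * hat f₂ ξ.2
  have hF (k : ι) : Integrable (F k) :=
    integrable_multiplierOp (stronglyMeasurable_bandSymbol (hm k) _ _ _ _).aestronglyMeasurable
      (Filter.Eventually.of_forall (hG k)) f₁ f₂ x
  have hFsum : Summable fun k => ∫ ξ, ‖F k ξ‖ := by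
    refine Summable.of_nonneg_of_le (fun k => integral_nonneg fun _ => norm_nonneg _)
      (fun k => ?_) ((hA.mul_right (kernelNorm n ^ 3)).mul_right
        (∫ ξ : Rn n × Rn n, ‖hat f₁ ξ.1 * hat f₂ ξ.2‖))
    rw [← integral_const_mul]
    refine integral_mono (hF k).norm ((integrable_hat_prod f₁ f₂).norm.const_mul _) fun ξ => ?_
    simp only [F, norm_mul, norm_exp_I_inner, one_mul]
    rw [mul_assoc ‖G k ξ‖]
    gcongr
    exact hG k ξ
  have hsum := (hasSum_integral_of_summable_integral_norm hF hFsum).tsum_eq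
  have hval : multiplierOp (fun ξ => σ (triple x ξ.1 ξ.2)) f₁ f₂ x =
      ∑' k, bandOp (h k) (κ₀ k) (κ₁ k) (κ₂ k) f₁ f₂ x := by
    simp_rw [← multiplierOp_bandSymbol (hm _) (hhA _)]
    change _ = ∑' k, ∫ ξ, F k ξ
    rw [hsum, multiplierOp]
    refine integral_congr_ae ?_
    filter_upwards [hσ] with ξ hξ
    rw [hξ, ← tsum_mul_left, ← tsum_mul_right, ← tsum_mul_right]
  rw [bilinearOp_eq_multiplierOp, hval, enorm_mul]
  calc _ ≤ 1 * ‖∑' k, bandOp (h k) (κ₀ k) (κ₁ k) (κ₂ k) f₁ f₂ x‖ₑ := by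
        gcongr
        rw [← ofReal_norm, ← ENNReal.ofReal_one, Complex.norm_real]
        apply ENNReal.ofReal_le_ofReal
        rw [Real.norm_of_nonneg (by positivity)]
        exact inv_le_one_of_one_le₀ (one_le_pow₀ (by linarith [Real.pi_gt_three]))
    _ ≤ _ := by rw [one_mul]; exact enorm_tsum_le_tsum_enorm

theorem measurable_sobolevNorm_localize (s : ℝ) (f : 𝓢(Rn n, ℂ)) :
    Measurable fun c => sobolevNorm s (localize f c) := by
  have h1 : Measurable fun p : Rn n × Rn n => (weight s p.2 * ‖hat (localize f p.1) p.2‖ₑ) ^ 2 :=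
    (((measurable_weight s).comp measurable_snd).mul (measurable_hat_localize f).enorm).pow_const 2
  have h2 : Measurable fun c => sobolevNorm s (localize f c) ^ 2 := by
    simp_rw [sobolevNorm_sq]
    exact h1.lintegral_prod_right'
  simpa only [sqrt_sq_ennreal] using h2.pow_const (1 / 2 : ℝ)

theorem aestronglyMeasurable_comp_triple {σ : Rn3 n → ℂ} (hσ : AEStronglyMeasurable σ volume) :
    AEStronglyMeasurable (fun p : Rn n × Rn n × Rn n => σ (triple p.1 p.2.1 p.2.2)) volume :=
  hσ.comp_quasiMeasurePreserving measurePreserving_triple.quasiMeasurePreserving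

theorem aestronglyMeasurable_bilinearOp {σ : Rn3 n → ℂ} (hσ : AEStronglyMeasurable σ volume)
    (f₁ f₂ : 𝓢(Rn n, ℂ)) : AEStronglyMeasurable (bilinearOp σ f₁ f₂) volume := by
  have h1 : AEStronglyMeasurable (fun p : Rn n × Rn n × Rn n =>
      Complex.exp (Complex.I * ((inner ℝ p.1 (p.2.1 + p.2.2) : ℝ) : ℂ)) *
        σ (triple p.1 p.2.1 p.2.2) * hat f₁ p.2.1 * hat f₂ p.2.2) (volume.prod volume) := by
    refine ((AEStronglyMeasurable.mul (Continuous.aestronglyMeasurable (by fun_prop))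
      (aestronglyMeasurable_comp_triple hσ)).mul ?_).mul ?_
    · exact ((continuous_hat f₁).comp (by fun_prop)).aestronglyMeasurable
    · exact ((continuous_hat f₂).comp (by fun_prop)).aestronglyMeasurable
  exact h1.integral_prod_right'.const_mul _

/-- The estimate for the bilinear operator with values in the amalgam space. -/
theorem exists_amalgamNorm_bilinearOp_le {s₁ s₂ : ℝ} (hs₁ : 0 < s₁) (hs₂ : 0 < s₂)
    (hs : s₁ + s₂ = (n : ℝ) / 2) {u : 𝓢'(Rn3 n, ℂ)} (hu : MemSjostrand u) {σ : Rn3 n → ℂ}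
    (hσ : MemLp σ ∞ volume) (hσu : Represents σ u) :
    ∃ C : ℝ≥0, ∀ f₁ f₂ : 𝓢(Rn n, ℂ),
      amalgamNorm (bilinearOp σ f₁ f₂) ≤ C * sobolevNorm s₁ f₁ * sobolevNorm s₂ f₂ := by
  obtain ⟨σ', A, h, κ₀, κ₁, κ₂, hσ'm, hσ'u, hAs, hm, hhA, hdec⟩ := exists_band_decomposition hu
  obtain ⟨C₀, hC₀⟩ := lintegral_bandOp_sq_le hs₁ hs₂ hs
  obtain ⟨C₁, hC₁⟩ := lintegral_sobolevNorm_localize_sq_le (n := n) hs₁.le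
  obtain ⟨C₂, hC₂⟩ := lintegral_sobolevNorm_localize_sq_le (n := n) hs₂.le
  have hA0 (k) : 0 ≤ A k := (norm_nonneg _).trans (hhA k 0)
  have hae : ∀ᵐ x : Rn n, ∀ᵐ ξ : Rn n × Rn n, σ (triple x ξ.1 ξ.2) =
      ∑' k, bandSymbol (h k) (κ₀ k) (κ₁ k) (κ₂ k) x ξ := by
    have h1 : σ =ᵐ[volume] σ' :=
      hσu.ae_eq hσ'u (hσ.locallyIntegrable (by simp)) (hσ'm.locallyIntegrable (by simp))
    have h2 := measurePreserving_triple.quasiMeasurePreserving.ae h1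
    refine Measure.ae_ae_of_ae_prod (p := fun p : Rn n × Rn n × Rn n =>
      σ (triple p.1 p.2.1 p.2.2) =
        ∑' k, bandSymbol (h k) (κ₀ k) (κ₁ k) (κ₂ k) p.1 p.2) ?_
    filter_upwards [h2, hdec] with p hp1 hp2
    rw [hp1, hp2]
    exact tsum_congr fun k => integral_eq_bandSymbol (hm k) (hhA k) _ _ _ _
  set S : ℝ≥0 := ∑' k, (A k).toNNReal
  have hS : ∑' k, ENNReal.ofReal (A k) = S := by
    rw [ENNReal.coe_tsum hAs.toNNReal]; rfl
  refine ⟨C₀ * S * (NNReal.sqrt C₁ * NNReal.sqrt C₂), fun f₁ f₂ => ?_⟩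
  set N₁ : Rn n → ℝ≥0∞ := fun c => sobolevNorm s₁ (localize f₁ c)
  set N₂ : Rn n → ℝ≥0∞ := fun c => sobolevNorm s₂ (localize f₂ c)
  have hN₁ : Measurable N₁ := measurable_sobolevNorm_localize s₁ f₁
  have hN₂ : Measurable N₂ := measurable_sobolevNorm_localize s₂ f₂
  have hN₁κ (κ : Rn n) : Measurable fun ρ => N₁ (ρ + κ) :=
    hN₁.comp (g := N₁) (f := fun ρ => ρ + κ) (by fun_prop)
  have hN₂κ (κ : Rn n) : Measurable fun ρ => N₂ (ρ + κ) :=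
    hN₂.comp (g := N₂) (f := fun ρ => ρ + κ) (by fun_prop)
  have hsqrt (C : ℝ≥0) (a : ℝ≥0∞) : (C * a ^ 2) ^ (1 / 2 : ℝ) = NNReal.sqrt C * a := by
    rw [← NNReal.sq_sqrt C, ENNReal.coe_pow, ← mul_pow, sqrt_sq_ennreal, NNReal.sq_sqrt]
  -- the local `L²` norms
  have hloc (ρ : Rn n) : (∫⁻ x in Metric.closedBall ρ (√n), ‖bilinearOp σ f₁ f₂ x‖ₑ ^ 2) ^
      (1 / 2 : ℝ) ≤ ∑' k, C₀ * ENNReal.ofReal (A k) * (N₁ (ρ + κ₁ k) * N₂ (ρ + κ₂ k)) := by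
    calc _ ≤ (∫⁻ x in Metric.closedBall ρ (√n),
          (∑' k, ‖bandOp (h k) (κ₀ k) (κ₁ k) (κ₂ k) f₁ f₂ x‖ₑ) ^ 2) ^ (1 / 2 : ℝ) := by
          gcongr ?_ ^ _
          refine lintegral_mono_ae (ae_restrict_of_ae ?_)
          filter_upwards [hae] with x hx
          gcongr
          exact enorm_bilinearOp_le_tsum hAs hm hhA hx f₁ f₂
      _ ≤ ∑' k, (∫⁻ x in Metric.closedBall ρ (√n),
          ‖bandOp (h k) (κ₀ k) (κ₁ k) (κ₂ k) f₁ f₂ x‖ₑ ^ 2) ^ (1 / 2 : ℝ) :=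
          lintegral_tsum_sq_le fun k =>
            (measurable_bandOp (hm k) _ _ _ _ _).measurable.enorm.aemeasurable
      _ ≤ _ := by
          refine ENNReal.tsum_le_tsum fun k => ?_
          have h1 := hC₀ (h k) (A k).toNNReal (hm k)
            (fun p => by rw [Real.coe_toNNReal _ (hA0 k)]; exact hhA k p)
            (κ₀ k) (κ₁ k) (κ₂ k) f₁ f₂ ρ
          calc _ ≤ _ := ENNReal.rpow_le_rpow h1 (by norm_num)
            _ = _ := by rw [sqrt_sq_ennreal, mul_assoc]; rfl
  -- the Cauchy–Schwarz inequality in the centre of the ball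
  have hCS (κ κ' : Rn n) : ∫⁻ ρ, N₁ (ρ + κ) * N₂ (ρ + κ') ≤
      (NNReal.sqrt C₁ * sobolevNorm s₁ f₁) * (NNReal.sqrt C₂ * sobolevNorm s₂ f₂) := by
    refine (lintegral_mul_le_sqrt (hN₁κ κ).aemeasurable (hN₂κ κ').aemeasurable).trans ?_
    rw [lintegral_add_right_eq_self (fun ρ => N₁ ρ ^ 2),
      lintegral_add_right_eq_self (fun ρ => N₂ ρ ^ 2), ← hsqrt, ← hsqrt]
    gcongr
    · exact hC₁ f₁
    · exact hC₂ f₂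
  calc amalgamNorm (bilinearOp σ f₁ f₂)
      ≤ ∫⁻ ρ, (∫⁻ x in Metric.closedBall ρ (√n), ‖bilinearOp σ f₁ f₂ x‖ₑ ^ 2) ^ (1 / 2 : ℝ) :=
        amalgamNorm_le_lintegral _
    _ ≤ ∫⁻ ρ, ∑' k, C₀ * ENNReal.ofReal (A k) * (N₁ (ρ + κ₁ k) * N₂ (ρ + κ₂ k)) :=
        lintegral_mono hloc
    _ = ∑' k, C₀ * ENNReal.ofReal (A k) * ∫⁻ ρ, N₁ (ρ + κ₁ k) * N₂ (ρ + κ₂ k) := by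
        have hm' (k) : Measurable fun ρ => N₁ (ρ + κ₁ k) * N₂ (ρ + κ₂ k) :=
          (hN₁κ _).mul (hN₂κ _)
        rw [lintegral_tsum fun k => ((hm' k).const_mul _).aemeasurable]
        exact tsum_congr fun k => lintegral_const_mul _ (hm' k)
    _ ≤ ∑' k, C₀ * ENNReal.ofReal (A k) * ((NNReal.sqrt C₁ * sobolevNorm s₁ f₁) *
          (NNReal.sqrt C₂ * sobolevNorm s₂ f₂)) := by
        gcongr with k
        exact hCS _ _
    _ = _ := by
        rw [ENNReal.tsum_mul_right, ENNReal.tsum_mul_left, hS]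
        push_cast
        ring

end AmalgamEstimate

/-! ### The embedding of the amalgam space into `L^r` -/

section AmalgamLp

variable {n : ℕ}

/-- The `ℓ^p` norm is at most the `ℓ¹` norm. -/
theorem tsum_rpow_le_rpow_tsum {ι : Type*} (a : ι → ℝ≥0∞) {p : ℝ} (hp : 1 ≤ p) :
    ∑' i, a i ^ p ≤ (∑' i, a i) ^ p := by
  have hsplit (b : ℝ≥0∞) : b ^ p = b * b ^ (p - 1) := by
    nth_rewrite 2 [← ENNReal.rpow_one b]
    rw [← ENNReal.rpow_add_of_nonneg _ _ zero_le_one (by linarith)]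
    congr 1; ring
  calc ∑' i, a i ^ p ≤ ∑' i, a i * (∑' j, a j) ^ (p - 1) := by
        refine ENNReal.tsum_le_tsum fun i => ?_
        rw [hsplit]
        exact mul_le_mul_right (ENNReal.rpow_le_rpow (ENNReal.le_tsum i) (by linarith)) _
    _ = _ := by rw [ENNReal.tsum_mul_right, ← hsplit]

theorem eLpNorm_le_amalgamNorm {g : Rn n → ℂ} (hg : AEStronglyMeasurable g volume) {r : ℝ≥0∞}
    (h1 : 1 ≤ r) (h2 : r ≤ 2) : eLpNorm g r volume ≤ amalgamNorm g := by
  have hr0 : r ≠ 0 := (zero_lt_one.trans_le h1).ne'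
  have hrtop : r ≠ ∞ := (h2.trans_lt (by simp)).ne
  have hr1 : 1 ≤ r.toReal := by
    rw [← ENNReal.toReal_one]; exact ENNReal.toReal_mono hrtop h1
  have hrpos : 0 < r.toReal := by linarith
  have hrp (ν : Fin n → ℤ) : ∫⁻ x in cube (n := n) ν, ‖g x‖ₑ ^ r.toReal ≤
      eLpNorm g 2 (volume.restrict (cube ν)) ^ r.toReal := by
    have : IsProbabilityMeasure (volume.restrict (cube (n := n) ν)) :=
      ⟨by rw [Measure.restrict_apply_univ, volume_cube]⟩
    refine le_trans (le_of_eq ?_) (ENNReal.rpow_le_rpow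
      (eLpNorm_le_eLpNorm_of_exponent_le (μ := volume.restrict (cube (n := n) ν)) h2 hg.restrict)
      hrpos.le)
    rw [eLpNorm_eq_lintegral_rpow_enorm_toReal hr0 hrtop, ← ENNReal.rpow_mul,
      one_div_mul_cancel hrpos.ne', ENNReal.rpow_one]
  rw [eLpNorm_eq_lintegral_rpow_enorm_toReal hr0 hrtop, one_div, ENNReal.rpow_inv_le_iff hrpos,
    ← setLIntegral_univ, ← iUnion_cube, lintegral_iUnion measurableSet_cube pairwise_disjoint_cube]
  exact (ENNReal.tsum_le_tsum hrp).trans (tsum_rpow_le_rpow_tsum _ hr1)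

end AmalgamLp

/-! ### The dyadic Hardy–Littlewood maximal function -/

section Maximal

variable {n : ℕ}

/-- The centred Hardy–Littlewood maximal function of `G ≥ 0`, with radii restricted to powers of
`2` and averages normalized by the `n`-th power of the radius. -/
def dyadicMaximal (G : Rn n → ℝ≥0∞) (x : Rn n) : ℝ≥0∞ :=
  ⨆ k : ℤ, ENNReal.ofReal (((2 : ℝ) ^ k) ^ n)⁻¹ * ∫⁻ y in Metric.closedBall x (2 ^ k), G y

theorem measurable_dyadicMaximal {G : Rn n → ℝ≥0∞} (hG : Measurable G) :
    Measurable (dyadicMaximal G) := by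
  refine Measurable.iSup fun k => Measurable.const_mul ?_ _
  have hS : MeasurableSet {p : Rn n × Rn n | dist p.2 p.1 ≤ (2 : ℝ) ^ k} :=
    measurableSet_le (by fun_prop) measurable_const
  have h1 : Measurable fun p : Rn n × Rn n =>
      {p : Rn n × Rn n | dist p.2 p.1 ≤ (2 : ℝ) ^ k}.indicator (fun p => G p.2) p :=
    (hG.comp measurable_snd).indicator hS
  have h2 : Measurable fun x : Rn n => ∫⁻ y,
      {p : Rn n × Rn n | dist p.2 p.1 ≤ (2 : ℝ) ^ k}.indicator (fun p => G p.2) (x, y) :=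
    h1.lintegral_prod_right'
  have h3 (x : Rn n) : ∫⁻ y, {p : Rn n × Rn n | dist p.2 p.1 ≤ (2 : ℝ) ^ k}.indicator
      (fun p => G p.2) (x, y) = ∫⁻ y in Metric.closedBall x (2 ^ k), G y := by
    rw [← lintegral_indicator measurableSet_closedBall]
    rfl
  simpa only [h3] using h2

theorem ofReal_mul_ofReal_inv {a : ℝ} (ha : 0 < a) :
    ENNReal.ofReal a * ENNReal.ofReal a⁻¹ = 1 := by
  rw [← ENNReal.ofReal_mul ha.le, mul_inv_cancel₀ ha.ne', ENNReal.ofReal_one]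

/-- The weak type `(1, 1)` inequality, from the Vitali covering lemma. -/
theorem volume_lt_dyadicMaximal_mul_le (hn : n ≠ 0) (G : Rn n → ℝ≥0∞) (hG : ∫⁻ y, G y ≠ ∞)
    {c : ℝ≥0∞} (hc : c ≠ 0) :
    volume {x | c < dyadicMaximal G x} * c ≤
      ENNReal.ofReal (5 ^ n) * volume (Metric.ball (0 : Rn n) 1) * ∫⁻ y, G y := by
  set E := {x | c < dyadicMaximal G x}
  have hex (x : Rn n) : ∃ k : ℤ, x ∈ E →
      c * ENNReal.ofReal (((2 : ℝ) ^ k) ^ n) ≤ ∫⁻ y in Metric.closedBall x (2 ^ k), G y := by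
    by_cases hx : x ∈ E
    · obtain ⟨k, hk⟩ := lt_iSup_iff.mp (show c < dyadicMaximal G x from hx)
      refine ⟨k, fun _ => ?_⟩
      calc c * ENNReal.ofReal (((2 : ℝ) ^ k) ^ n)
          ≤ (ENNReal.ofReal (((2 : ℝ) ^ k) ^ n)⁻¹ * ∫⁻ y in Metric.closedBall x (2 ^ k), G y) *
              ENNReal.ofReal (((2 : ℝ) ^ k) ^ n) := by gcongr
        _ = (ENNReal.ofReal (((2 : ℝ) ^ k) ^ n) * ENNReal.ofReal (((2 : ℝ) ^ k) ^ n)⁻¹) *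
              ∫⁻ y in Metric.closedBall x (2 ^ k), G y := by ring
        _ = _ := by rw [ofReal_mul_ofReal_inv (by positivity), one_mul]
    · exact ⟨0, fun h => absurd h hx⟩
  choose k hk using hex
  -- the covering lemma needs bounded radii; they are bounded since `G` is integrable and `n ≠ 0`
  have hbdd : ∀ x ∈ E, (2 : ℝ) ^ k x ≤ max 1 ((∫⁻ y, G y) / c).toReal := by
    intro x hx
    rcases le_or_gt ((2 : ℝ) ^ k x) 1 with h | h
    · exact le_max_of_le_left h
    · refine le_max_of_le_right ((le_self_pow₀ h.le hn).trans ?_)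
      rw [← ENNReal.ofReal_le_iff_le_toReal (ENNReal.div_ne_top hG hc)]
      rw [ENNReal.le_div_iff_mul_le (Or.inl hc) (Or.inr hG), mul_comm]
      exact (hk x hx).trans (setLIntegral_le_lintegral _ _)
  obtain ⟨u, huE, hdisj, hcov⟩ := Vitali.exists_disjoint_subfamily_covering_enlargement_closedBall
    E (fun x => x) (fun x => (2 : ℝ) ^ k x) _ hbdd 5 (by norm_num)
  have hcount : u.Countable := hdisj.countable_of_nonempty_interior fun x _ =>
    (Metric.nonempty_ball.mpr (by positivity : (0 : ℝ) < 2 ^ k x)).mono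
      Metric.ball_subset_interior_closedBall
  have hsub : E ⊆ ⋃ b ∈ u, Metric.closedBall b (5 * 2 ^ k b) := by
    intro x hx
    obtain ⟨b, hb, hxb⟩ := hcov x hx
    exact Set.mem_biUnion hb (hxb (Metric.mem_closedBall_self (by positivity)))
  calc volume E * c
      ≤ (∑' b : u, volume (Metric.closedBall (b : Rn n) (5 * 2 ^ k b))) * c := by
        gcongr
        exact (measure_mono hsub).trans (measure_biUnion_le _ hcount _)
    _ = ∑' b : u, ENNReal.ofReal (5 ^ n) * volume (Metric.ball (0 : Rn n) 1) *
          (c * ENNReal.ofReal (((2 : ℝ) ^ k b) ^ n)) := by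
        rw [← ENNReal.tsum_mul_right]
        refine tsum_congr fun b => ?_
        rw [Measure.addHaar_closedBall _ _ (by positivity), finrank_euclideanSpace_fin, mul_pow,
          ENNReal.ofReal_mul (by positivity)]
        ring
    _ ≤ ∑' b : u, ENNReal.ofReal (5 ^ n) * volume (Metric.ball (0 : Rn n) 1) *
          ∫⁻ y in Metric.closedBall (b : Rn n) (2 ^ k b), G y := by
        gcongr with b
        exact hk b (huE b.2)
    _ ≤ _ := by
        rw [ENNReal.tsum_mul_left]
        gcongr
        rw [← lintegral_biUnion hcount (fun _ _ => measurableSet_closedBall) hdisj]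
        exact setLIntegral_le_lintegral _ _

/-- Kolmogorov's inequality: a function in weak `L²` is integrable on sets of finite measure. -/
theorem setLIntegral_le_of_weak_two {α : Type*} [MeasurableSpace α] {μ : Measure α}
    {H : α → ℝ≥0∞} (hH : Measurable H) {K C : ℝ≥0∞} (hK0 : K ≠ 0) (hK : K ≠ ∞)
    (hweak : ∀ c : ℝ≥0∞, c ≠ 0 → μ {x | c < H x} * c ^ 2 ≤ C * K ^ 2) (E : Set α) :
    ∫⁻ x in E, H x ∂μ ≤ (μ E + 4 * C) * K := by
  have hpt (x : α) : H x ≤ K + ∑' m : ℕ, {x | 2 ^ m * K < H x}.indicator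
      (fun _ => 2 ^ (m + 1) * K) x := by
    rcases le_or_gt (H x) K with h | h
    · exact le_add_right h
    rcases eq_or_ne (H x) ∞ with htop | htop
    · have hsum : ∑' m : ℕ, {x | 2 ^ m * K < H x}.indicator (fun _ => 2 ^ (m + 1) * K) x = ∞ := by
        rw [eq_top_iff, ← ENNReal.tsum_const_eq_top_of_ne_zero (α := ℕ) hK0]
        refine ENNReal.tsum_le_tsum fun m => ?_
        have hm : x ∈ {x | 2 ^ m * K < H x} := by
          rw [Set.mem_ofPred_eq, htop]
          exact ENNReal.mul_lt_top (by finiteness) hK.lt_top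
        rw [Set.indicator_of_mem hm]
        exact le_mul_of_one_le_left' (one_le_pow₀ one_le_two)
      rw [hsum, add_top]
      exact le_top
    · -- choose `m` with `2 ^ m * K < H x ≤ 2 ^ (m + 1) * K`
      have hex : ∃ m : ℕ, H x ≤ 2 ^ m * K := by
        obtain ⟨m, hm⟩ := ENNReal.exists_nat_mul_gt hK0 htop
        refine ⟨m, hm.le.trans ?_⟩
        gcongr
        exact_mod_cast Nat.lt_two_pow_self.le
      obtain ⟨m, hm, hmin⟩ : ∃ m : ℕ, H x ≤ 2 ^ (m + 1) * K ∧ 2 ^ m * K < H x := by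
        classical
        obtain ⟨m, hm⟩ : ∃ m, Nat.find hex = m + 1 := by
          refine Nat.exists_eq_succ_of_ne_zero fun h0 => ?_
          have := Nat.find_spec hex
          rw [h0, pow_zero, one_mul] at this
          exact this.not_gt h
        exact ⟨m, hm ▸ Nat.find_spec hex, not_le.mp (Nat.find_min hex (m := m) (by omega))⟩
      refine le_add_left (hm.trans (le_trans (le_of_eq ?_) (ENNReal.le_tsum m)))
      rw [Set.indicator_of_mem (by exact hmin)]
  have hmeas (m : ℕ) : MeasurableSet {x | 2 ^ m * K < H x} := measurableSet_lt measurable_const hH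
  have hterm (m : ℕ) : 2 ^ (m + 1) * K * μ {x | 2 ^ m * K < H x} ≤ 2 * C * K * 2⁻¹ ^ m := by
    have h20 : (2 : ℝ≥0∞) ^ m * K ≠ 0 := mul_ne_zero (by simp) hK0
    have h2t : (2 : ℝ≥0∞) ^ m * K ≠ ∞ := ENNReal.mul_ne_top (by finiteness) hK
    have h3 : (2 : ℝ≥0∞) ^ m * 2⁻¹ ^ m = 1 := by
      rw [← mul_pow, ENNReal.mul_inv_cancel two_ne_zero (by simp), one_pow]
    rw [← ENNReal.mul_le_mul_iff_left h20 h2t]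
    calc 2 ^ (m + 1) * K * μ {x | 2 ^ m * K < H x} * (2 ^ m * K)
        = 2 * (μ {x | 2 ^ m * K < H x} * (2 ^ m * K) ^ 2) := by ring
      _ ≤ 2 * (C * K ^ 2) := by exact mul_le_mul_right (hweak _ h20) _
      _ = 2 * C * K * K * (2 ^ m * 2⁻¹ ^ m) := by rw [h3]; ring
      _ = _ := by ring
  calc ∫⁻ x in E, H x ∂μ
      ≤ ∫⁻ x in E, (K + ∑' m : ℕ, {x | 2 ^ m * K < H x}.indicator
          (fun _ => 2 ^ (m + 1) * K) x) ∂μ := lintegral_mono hpt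
    _ = K * μ E + ∑' m : ℕ, ∫⁻ x in E, {x | 2 ^ m * K < H x}.indicator
          (fun _ => 2 ^ (m + 1) * K) x ∂μ := by
        rw [lintegral_add_left measurable_const, setLIntegral_const,
          lintegral_tsum fun m => (measurable_const.indicator (hmeas m)).aemeasurable]
    _ ≤ K * μ E + ∑' m : ℕ, 2 * C * K * 2⁻¹ ^ m := by
        gcongr with m
        refine (setLIntegral_le_lintegral _ _).trans ?_
        rw [lintegral_indicator_const (hmeas m)]
        exact hterm m
    _ = _ := by
        rw [ENNReal.tsum_mul_left, ENNReal.tsum_geometric, ENNReal.one_sub_inv_two, inv_inv]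
        ring

end Maximal

/-! ### The embedding of the amalgam space into `h¹` -/

section LocalHardy

variable {n : ℕ}

theorem exists_dilate_decay (φ : 𝓢(Rn n, ℂ)) :
    ∃ C : ℝ, 0 ≤ C ∧ ∀ (t : ℝ) (ht : 0 < t) (x y : Rn n),
      ‖dilate φ t ht.ne' x y‖ ≤ C * (t / (t + ‖x - y‖) ^ (n + 1)) := by
  obtain ⟨C, hC⟩ : ∃ C : ℝ, ∀ z : Rn n, (1 + ‖z‖) ^ (n + 1) * ‖φ z‖ ≤ C := by
    refine ⟨2 ^ (n + 1) * ((Finset.Iic (n + 1, 0)).sup fun m : ℕ × ℕ =>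
      SchwartzMap.seminorm ℂ m.1 m.2) φ, fun z => ?_⟩
    have := SchwartzMap.one_add_le_sup_seminorm_apply (𝕜 := ℂ) (m := (n + 1, 0)) (k := n + 1)
      (n := 0) le_rfl le_rfl φ z
    rw [norm_iteratedFDeriv_zero] at this
    exact this
  refine ⟨C, le_trans (by positivity) (hC 0), fun t ht x y => ?_⟩
  rw [dilate_apply, norm_mul, Complex.norm_real, Real.norm_of_nonneg (by positivity),
    ← mul_div_assoc, le_div_iff₀ (by positivity)]
  have h1 : t + ‖x - y‖ = t * (1 + ‖t⁻¹ • (x - y)‖) := by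
    rw [norm_smul, Real.norm_of_nonneg (by positivity)]
    field_simp
  calc (t ^ n)⁻¹ * ‖φ (t⁻¹ • (x - y))‖ * (t + ‖x - y‖) ^ (n + 1)
      = ((t ^ n)⁻¹ * t ^ n) * t * ((1 + ‖t⁻¹ • (x - y)‖) ^ (n + 1) * ‖φ (t⁻¹ • (x - y))‖) := by
        rw [h1, mul_pow]; ring
    _ ≤ 1 * t * C := by
        rw [inv_mul_cancel₀ (by positivity)]
        gcongr
        exact hC _
    _ = C * t := by ring

/-- A dilated Schwartz function is dominated by a rapidly converging combination of normalized
indicator functions of dyadic balls. -/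
theorem exists_dilate_le_tsum (φ : 𝓢(Rn n, ℂ)) : ∃ C : ℝ≥0, ∀ (t : ℝ) (ht : 0 < t), ∃ k : ℤ,
    ∀ x y : Rn n, ‖dilate φ t ht.ne' x y‖ₑ ≤ C * ∑' j : ℕ, 2⁻¹ ^ j *
      (ENNReal.ofReal (((2 : ℝ) ^ (k + j)) ^ n)⁻¹ *
        (Metric.closedBall x (2 ^ (k + j))).indicator 1 y) := by
  obtain ⟨C, hC0, hC⟩ := exists_dilate_decay φ
  refine ⟨(C * 2 ^ (n + 2)).toNNReal, fun t ht => ?_⟩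
  obtain ⟨k, hk1, hk2⟩ := exists_mem_Ioc_zpow ht (one_lt_two (α := ℝ))
  refine ⟨k, fun x y => ?_⟩
  have hk0 : (0 : ℝ) < 2 ^ k := by positivity
  have hk2' : t ≤ 2 ^ k * 2 := by rwa [zpow_add_one₀ two_ne_zero] at hk2
  set w := ‖x - y‖ with hw
  -- a single term of the series suffices: the smallest dyadic ball that contains `y`
  obtain ⟨j, hj, hjle⟩ : ∃ j : ℕ, w ≤ 2 ^ k * 2 ^ j ∧
      t / (t + w) ^ (n + 1) ≤ 2 ^ (n + 2) * ((2 ^ j)⁻¹ * ((2 ^ k * 2 ^ j) ^ n)⁻¹) := by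
    rcases le_or_gt w (2 ^ k) with h | h
    · refine ⟨0, by simpa using h, ?_⟩
      calc t / (t + w) ^ (n + 1) ≤ t / t ^ (n + 1) := by
            gcongr
            exact le_add_of_nonneg_right (norm_nonneg _)
        _ = (t ^ n)⁻¹ := by rw [pow_succ]; field_simp
        _ ≤ ((2 ^ k) ^ n)⁻¹ := by gcongr
        _ ≤ 2 ^ (n + 2) * ((2 ^ k) ^ n)⁻¹ :=
            le_mul_of_one_le_left (by positivity) (one_le_pow₀ one_le_two)
        _ = _ := by simp
    · obtain ⟨m, hm1, hm2⟩ := exists_nat_pow_near (x := w / 2 ^ k) (y := (2 : ℝ))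
        (by rw [one_le_div hk0]; exact h.le) one_lt_two
      rw [le_div_iff₀ hk0] at hm1
      rw [div_lt_iff₀ hk0] at hm2
      refine ⟨m + 1, by rw [mul_comm]; exact hm2.le, ?_⟩
      calc t / (t + w) ^ (n + 1) ≤ (2 ^ k * 2) / (2 ^ m * 2 ^ k) ^ (n + 1) := by
            gcongr
            linarith
        _ = _ := by
            field_simp
            ring
  have hC' : ‖dilate φ t ht.ne' x y‖ₑ ≤ ENNReal.ofReal (C * 2 ^ (n + 2)) *
      (2⁻¹ ^ j * ENNReal.ofReal (((2 : ℝ) ^ (k + j)) ^ n)⁻¹) := by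
    have h2 : (2⁻¹ : ℝ≥0∞) ^ j = ENNReal.ofReal (2 ^ j)⁻¹ := by
      rw [ENNReal.ofReal_inv_of_pos (by positivity), ENNReal.ofReal_pow (by norm_num),
        ENNReal.ofReal_ofNat, ENNReal.inv_pow]
    rw [h2, ← ENNReal.ofReal_mul (by positivity), ← ENNReal.ofReal_mul (by positivity),
      ← ofReal_norm]
    apply ENNReal.ofReal_le_ofReal
    rw [zpow_add₀ two_ne_zero, zpow_natCast, mul_assoc]
    exact (hC t ht x y).trans (by gcongr)
  refine hC'.trans ?_
  rw [← ENNReal.ofReal]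
  gcongr
  refine le_trans (le_of_eq ?_) (ENNReal.le_tsum j)
  rw [Set.indicator_of_mem, Pi.one_apply, mul_one]
  rw [Metric.mem_closedBall, dist_comm, dist_eq_norm, zpow_add₀ two_ne_zero, zpow_natCast]
  exact hj

theorem exists_lintegral_dilate_le_dyadicMaximal (φ : 𝓢(Rn n, ℂ)) :
    ∃ C : ℝ≥0, ∀ (t : ℝ) (ht : 0 < t) (x : Rn n) (G : Rn n → ℝ≥0∞), Measurable G →
      ∫⁻ y, ‖dilate φ t ht.ne' x y‖ₑ * G y ≤ C * dyadicMaximal G x := by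
  obtain ⟨C, hC⟩ := exists_dilate_le_tsum φ
  refine ⟨C * 2, fun t ht x G hG => ?_⟩
  obtain ⟨k, hk⟩ := hC t ht
  have hmul (j : ℕ) (y : Rn n) : (Metric.closedBall x (2 ^ (k + j))).indicator 1 y * G y =
      (Metric.closedBall x (2 ^ (k + j))).indicator G y := by
    by_cases hy : y ∈ Metric.closedBall x ((2 : ℝ) ^ (k + j)) <;> simp [hy]
  have hGm (j : ℕ) : Measurable ((Metric.closedBall x ((2 : ℝ) ^ (k + j))).indicator G) :=
    hG.indicator measurableSet_closedBall
  calc ∫⁻ y, ‖dilate φ t ht.ne' x y‖ₑ * G y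
      ≤ ∫⁻ y, C * ∑' j : ℕ, 2⁻¹ ^ j * (ENNReal.ofReal (((2 : ℝ) ^ (k + j)) ^ n)⁻¹ *
          (Metric.closedBall x (2 ^ (k + j))).indicator G y) := by
        refine lintegral_mono fun y => (mul_le_mul_left (hk x y) _).trans (le_of_eq ?_)
        simp_rw [mul_assoc, ← ENNReal.tsum_mul_right, mul_assoc, hmul]
    _ = C * ∑' j : ℕ, 2⁻¹ ^ j * (ENNReal.ofReal (((2 : ℝ) ^ (k + j)) ^ n)⁻¹ *
          ∫⁻ y in Metric.closedBall x (2 ^ (k + j)), G y) := by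
        rw [lintegral_const_mul' _ _ ENNReal.coe_ne_top,
          lintegral_tsum fun j => (((hGm j).const_mul _).const_mul _).aemeasurable]
        congr 1
        refine tsum_congr fun j => ?_
        rw [lintegral_const_mul _ ((hGm j).const_mul _), lintegral_const_mul _ (hGm j),
          lintegral_indicator measurableSet_closedBall]
    _ ≤ C * ∑' j : ℕ, 2⁻¹ ^ j * dyadicMaximal G x := by
        gcongr with j
        exact le_iSup (fun k : ℤ => ENNReal.ofReal (((2 : ℝ) ^ k) ^ n)⁻¹ *
          ∫⁻ y in Metric.closedBall x (2 ^ k), G y) (k + j)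
    _ = _ := by
        rw [ENNReal.tsum_mul_right, ENNReal.tsum_geometric, ENNReal.one_sub_inv_two, inv_inv]
        push_cast
        ring

theorem dyadicMaximal_one_le (x : Rn n) :
    dyadicMaximal 1 x ≤ volume (Metric.ball (0 : Rn n) 1) := by
  refine iSup_le fun k => ?_
  simp only [Pi.one_apply, lintegral_const, Measure.restrict_apply_univ, one_mul]
  rw [Measure.addHaar_closedBall _ _ (by positivity), finrank_euclideanSpace_fin, ← mul_assoc,
    mul_comm (ENNReal.ofReal _) (ENNReal.ofReal _), ofReal_mul_ofReal_inv (by positivity), one_mul]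

theorem dyadicMaximal_eq_zero {G : Rn n → ℝ≥0∞} (hG : ∫⁻ y, G y = 0) (x : Rn n) :
    dyadicMaximal G x = 0 := by
  simp only [dyadicMaximal, ENNReal.iSup_eq_zero]
  intro k
  have : ∫⁻ y in Metric.closedBall x (2 ^ k), G y = 0 :=
    le_antisymm ((setLIntegral_le_lintegral _ _).trans hG.le) zero_le
  rw [this, mul_zero]

/-- The averages of a function over dilated Schwartz functions are controlled by the maximal
function of its square. -/
theorem exists_lintegral_dilate_le_sqrt (φ : 𝓢(Rn n, ℂ)) :
    ∃ C : ℝ≥0, ∀ (t : ℝ) (ht : 0 < t) (x : Rn n) (F : Rn n → ℝ≥0∞), Measurable F →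
      ∫⁻ y, ‖dilate φ t ht.ne' x y‖ₑ * F y ≤
        C * dyadicMaximal (fun y => F y ^ 2) x ^ (1 / 2 : ℝ) := by
  obtain ⟨C, hC⟩ := exists_lintegral_dilate_le_dyadicMaximal φ
  set v := volume (Metric.ball (0 : Rn n) 1)
  have hv : v ≠ ∞ := measure_ball_lt_top.ne
  refine ⟨C * NNReal.sqrt v.toNNReal, fun t ht x F hF => ?_⟩
  set d : Rn n → ℝ≥0∞ := fun y => ‖dilate φ t ht.ne' x y‖ₑ
  have hd : Measurable d := (dilate φ t ht.ne' x).continuous.measurable.enorm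
  have h1 : ∫⁻ y, d y ≤ C * v := by
    have := hC t ht x 1 measurable_one
    simp only [Pi.one_apply, mul_one] at this
    exact this.trans (by gcongr; exact dyadicMaximal_one_le x)
  have hsq : (C : ℝ≥0∞) * v = (C : ℝ≥0∞) * (NNReal.sqrt v.toNNReal : ℝ≥0∞) ^ 2 := by
    rw [← ENNReal.coe_pow, NNReal.sq_sqrt, ENNReal.coe_toNNReal hv]
  calc ∫⁻ y, d y * F y = ∫⁻ y, d y ^ (1 / 2 : ℝ) * (d y ^ (1 / 2 : ℝ) * F y) := by
        refine lintegral_congr fun y => ?_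
        rw [← mul_assoc, ← sq, sq_sqrt_ennreal]
    _ ≤ (∫⁻ y, (d y ^ (1 / 2 : ℝ)) ^ 2) ^ (1 / 2 : ℝ) *
          (∫⁻ y, (d y ^ (1 / 2 : ℝ) * F y) ^ 2) ^ (1 / 2 : ℝ) :=
        lintegral_mul_le_sqrt (hd.pow_const _).aemeasurable
          ((hd.pow_const _).mul hF).aemeasurable
    _ ≤ (C * v) ^ (1 / 2 : ℝ) * (C * dyadicMaximal (fun y => F y ^ 2) x) ^ (1 / 2 : ℝ) := by
        simp_rw [mul_pow, sq_sqrt_ennreal]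
        gcongr
        exact hC t ht x _ (hF.pow_const 2)
    _ = ((C * NNReal.sqrt v.toNNReal) ^ 2 * dyadicMaximal (fun y => F y ^ 2) x) ^
          (1 / 2 : ℝ) := by
        rw [← ENNReal.mul_rpow_of_nonneg _ _ (by norm_num), hsq]
        congr 1
        ring
    _ = _ := by
        rw [ENNReal.mul_rpow_of_nonneg _ _ (by norm_num), sqrt_sq_ennreal]
        push_cast
        rfl

theorem latticePt_mem_cube (ν : Fin n → ℤ) : latticePt ν ∈ cube (n := n) ν := fun i => by
  simp [latticePt]; norm_num

/-- The maximal function of the part of a function in a unit cube is integrable, with a bound by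
the `L²` norm: near the cube by the maximal inequality, far away by the decay of the kernel. -/
theorem exists_majorant_of_cube (hn : n ≠ 0) (φ : 𝓢(Rn n, ℂ)) :
    ∃ C : ℝ≥0, ∀ (ν : Fin n → ℤ) (g : Rn n → ℂ), Measurable g →
      eLpNorm g 2 (volume.restrict (cube ν)) ≠ ∞ →
      ∃ F : Rn n → ℝ≥0∞, Measurable F ∧
        (∀ (t : ℝ) (ht : 0 < t), t < 1 → ∀ x,
          ∫⁻ y in cube ν, ‖dilate φ t ht.ne' x y‖ₑ * ‖g y‖ₑ ≤ F x) ∧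
        ∫⁻ x, F x ≤ C * eLpNorm g 2 (volume.restrict (cube ν)) := by
  obtain ⟨C₁, hC₁⟩ := exists_lintegral_dilate_le_sqrt φ
  obtain ⟨C₂, hC₂0, hC₂⟩ := exists_dilate_decay φ
  set v := volume (Metric.ball (0 : Rn n) 1)
  set V : ℝ≥0∞ := volume (Metric.closedBall (0 : Rn n) (2 * √n))
  set D : Rn n → ℝ≥0∞ := fun z => ENNReal.ofReal (C₂ * 4 ^ (n + 1)) *
    ENNReal.ofReal ((1 + ‖z‖) ^ (-((n + 1 : ℕ) : ℝ))) with hD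
  have hDm : Measurable D := by fun_prop
  have hDI : ∫⁻ z, D z ≠ ∞ := by
    rw [lintegral_const_mul _ (by fun_prop)]
    refine ENNReal.mul_ne_top ENNReal.ofReal_ne_top (finite_integral_one_add_norm ?_).ne
    rw [finrank_euclideanSpace_fin]
    push_cast; linarith
  set K : ℝ≥0∞ := C₁ * (V + 4 * (ENNReal.ofReal (5 ^ n) * v)) + ∫⁻ z, D z
  have hK : K ≠ ∞ := by
    have hv : v ≠ ∞ := measure_ball_lt_top.ne
    have hV : V ≠ ∞ := measure_closedBall_lt_top.ne
    finiteness
  refine ⟨K.toNNReal, fun ν g hg hfin => ?_⟩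
  rw [ENNReal.coe_toNNReal hK]
  set a := eLpNorm g 2 (volume.restrict (cube ν)) with ha
  set f : Rn n → ℝ≥0∞ := (cube ν).indicator fun y => ‖g y‖ₑ with hf
  have hfm : Measurable f := hg.enorm.indicator (measurableSet_cube ν)
  have hf2 : ∫⁻ y, f y ^ 2 = a ^ 2 := by
    rw [ha, eLpNorm_two_sq, ← lintegral_indicator (measurableSet_cube ν)]
    refine lintegral_congr fun y => ?_
    by_cases hy : y ∈ cube ν <;> simp [hf, hy]
  have hf1 : ∫⁻ y in cube ν, ‖g y‖ₑ ≤ a := by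
    have : IsProbabilityMeasure (volume.restrict (cube (n := n) ν)) :=
      ⟨by rw [Measure.restrict_apply_univ, volume_cube]⟩
    rw [← eLpNorm_one_eq_lintegral_enorm]
    exact eLpNorm_le_eLpNorm_of_exponent_le (by norm_num) hg.aestronglyMeasurable
  have hdil (t : ℝ) (ht : 0 < t) (x : Rn n) :
      ∫⁻ y in cube ν, ‖dilate φ t ht.ne' x y‖ₑ * ‖g y‖ₑ =
        ∫⁻ y, ‖dilate φ t ht.ne' x y‖ₑ * f y := by
    rw [← lintegral_indicator (measurableSet_cube ν)]
    refine lintegral_congr fun y => ?_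
    by_cases hy : y ∈ cube ν <;> simp [hf, hy]
  set H : Rn n → ℝ≥0∞ := fun x => dyadicMaximal (fun y => f y ^ 2) x ^ (1 / 2 : ℝ) with hH
  have hHm : Measurable H := (measurable_dyadicMaximal (hfm.pow_const 2)).pow_const _
  set B := Metric.closedBall (latticePt ν : Rn n) (2 * √n)
  -- near the cube: weak `L²` bound for the maximal function on a set of bounded measure
  have hHB : ∫⁻ x in B, H x ≤ (V + 4 * (ENNReal.ofReal (5 ^ n) * v)) * a := by
    have hBV : volume B = V := by
      simp only [B, V, Measure.addHaar_closedBall_center]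
    rw [← hBV]
    rcases eq_or_ne a 0 with h0 | h0
    · have hH0 (x : Rn n) : H x = 0 := by
        simp only [hH]
        rw [dyadicMaximal_eq_zero (by rw [hf2, h0]; simp)]
        simp
      simp [hH0]
    · refine setLIntegral_le_of_weak_two hHm h0 hfin (fun c hc => ?_) _
      have hset : {x | c < H x} = {x | c ^ 2 < dyadicMaximal (fun y => f y ^ 2) x} := by
        ext x
        simp only [Set.mem_ofPred_eq, hH]
        rw [one_div, ENNReal.lt_rpow_inv_iff (by norm_num), ENNReal.rpow_two]
      rw [hset, ← hf2]
      exact volume_lt_dyadicMaximal_mul_le hn _ (by rw [hf2]; finiteness) (pow_ne_zero 2 hc)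
  refine ⟨fun x => B.indicator (fun x => C₁ * H x) x + D (x - latticePt ν) * a, ?_, ?_, ?_⟩
  · have hDν : Measurable fun x => D (x - latticePt ν) :=
      hDm.comp (g := D) (f := fun x => x - latticePt ν) (by fun_prop)
    exact ((hHm.const_mul _).indicator measurableSet_closedBall).add (hDν.mul_const _)
  · intro t ht ht1 x
    beta_reduce
    by_cases hx : x ∈ B
    · rw [Set.indicator_of_mem hx, hdil t ht]
      exact le_add_right (hC₁ t ht x f hfm)
    · refine le_add_left ?_
      calc ∫⁻ y in cube ν, ‖dilate φ t ht.ne' x y‖ₑ * ‖g y‖ₑ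
          ≤ ∫⁻ y in cube ν, D (x - latticePt ν) * ‖g y‖ₑ := by
            refine setLIntegral_mono_ae' (measurableSet_cube ν)
              (Filter.Eventually.of_forall fun y hy => ?_)
            gcongr
            simp only [hD]
            rw [← ENNReal.ofReal_mul (by positivity), ← ofReal_norm]
            apply ENNReal.ofReal_le_ofReal
            rw [Real.rpow_neg (by positivity), Real.rpow_natCast]
            have hn1 : 1 ≤ √(n : ℝ) := by
              rw [Real.one_le_sqrt]; exact_mod_cast Nat.one_le_iff_ne_zero.mpr hn
            have hx' : 2 * √n < ‖x - latticePt ν‖ := by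
              rw [← dist_eq_norm]; simpa [B] using hx
            have hy' := norm_sub_le_of_mem_cube hy (latticePt_mem_cube ν)
            have htri : ‖x - latticePt ν‖ ≤ ‖x - y‖ + ‖y - latticePt ν‖ := by
              simpa using norm_add_le (x - y) (y - latticePt ν)
            have hle : (1 + ‖x - latticePt ν‖) / 4 ≤ t + ‖x - y‖ := by linarith
            calc ‖dilate φ t ht.ne' x y‖ ≤ C₂ * (t / (t + ‖x - y‖) ^ (n + 1)) := hC₂ t ht x y
              _ ≤ C₂ * (1 / ((1 + ‖x - latticePt ν‖) / 4) ^ (n + 1)) := by gcongr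
              _ = _ := by rw [div_pow]; field_simp
        _ = D (x - latticePt ν) * ∫⁻ y in cube ν, ‖g y‖ₑ := lintegral_const_mul _ hg.enorm
        _ ≤ _ := by gcongr
  · have hDν : Measurable fun x => D (x - latticePt ν) :=
      hDm.comp (g := D) (f := fun x => x - latticePt ν) (by fun_prop)
    rw [lintegral_add_left ((hHm.const_mul _).indicator measurableSet_closedBall),
      lintegral_indicator measurableSet_closedBall, lintegral_const_mul _ hHm,
      lintegral_mul_const _ hDν, lintegral_sub_right_eq_self D]
    calc _ ≤ C₁ * ((V + 4 * (ENNReal.ofReal (5 ^ n) * v)) * a) + (∫⁻ z, D z) * a := by gcongr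
      _ = _ := by simp only [K]; ring

/-- The amalgam space embeds into the local Hardy space. -/
theorem exists_localHardyNorm_le (hn : n ≠ 0) (φ : 𝓢(Rn n, ℂ)) :
    ∃ C : ℝ≥0, ∀ (g : Rn n → ℂ) (w : 𝓢'(Rn n, ℂ)), MemAmalgam g → Represents g w →
      localHardyNorm φ w ≤ C * amalgamNorm g := by
  obtain ⟨C, hC⟩ := exists_majorant_of_cube hn φ
  refine ⟨C, fun g w hg hw => ?_⟩
  -- the majorants need a measurable representative
  set g' := hg.1.mk g
  have hg'm : Measurable g' := hg.1.stronglyMeasurable_mk.measurable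
  have hgg' : g =ᵐ[volume] g' := hg.1.ae_eq_mk
  have hnorm (ν : Fin n → ℤ) : eLpNorm g 2 (volume.restrict (cube ν)) =
      eLpNorm g' 2 (volume.restrict (cube ν)) := eLpNorm_congr_ae (ae_restrict_of_ae hgg')
  have hfin (ν : Fin n → ℤ) : eLpNorm g' 2 (volume.restrict (cube ν)) ≠ ∞ :=
    hnorm ν ▸ ENNReal.ne_top_of_tsum_ne_top hg.2.ne ν
  choose F hFm hF hFI using fun ν => hC ν g' hg'm (hfin ν)
  have hpt (x : Rn n) (t : Set.Ioo (0 : ℝ) 1) :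
      ‖w (dilate φ t.1 t.2.1.ne' x)‖ₑ ≤ ∑' ν, F ν x := by
    rw [(hw _).2]
    calc ‖∫ y, dilate φ t.1 t.2.1.ne' x y * g y‖ₑ
        ≤ ∫⁻ y, ‖dilate φ t.1 t.2.1.ne' x y * g y‖ₑ := enorm_integral_le_lintegral_enorm _
      _ = ∫⁻ y, ‖dilate φ t.1 t.2.1.ne' x y‖ₑ * ‖g' y‖ₑ := by
          refine lintegral_congr_ae ?_
          filter_upwards [hgg'] with y hy
          rw [enorm_mul, hy]
      _ = ∑' ν, ∫⁻ y in cube ν, ‖dilate φ t.1 t.2.1.ne' x y‖ₑ * ‖g' y‖ₑ := by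
          rw [← lintegral_iUnion measurableSet_cube pairwise_disjoint_cube, iUnion_cube,
            setLIntegral_univ]
      _ ≤ _ := ENNReal.tsum_le_tsum fun ν => hF ν t.1 t.2.1 t.2.2 x
  calc localHardyNorm φ w ≤ ∫⁻ x, ∑' ν, F ν x := lintegral_mono fun x => iSup_le (hpt x)
    _ = ∑' ν, ∫⁻ x, F ν x := lintegral_tsum fun ν => (hFm ν).aemeasurable
    _ ≤ ∑' ν, C * eLpNorm g' 2 (volume.restrict (cube ν)) := ENNReal.tsum_le_tsum hFI
    _ = C * amalgamNorm g := by simp_rw [ENNReal.tsum_mul_left, ← hnorm]; rfl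

end LocalHardy

end BilinearPDO

end

open BilinearPDO
theorem theorem1p1 (n : ℕ) (s₁ s₂ : ℝ) (hs₁ : 0 < s₁) (hs₂ : 0 < s₂)
    (hs : s₁ + s₂ = (n : ℝ) / 2)
    (u : 𝓢'(Rn3 n, ℂ)) (hu : MemSjostrand u) :
    -- `u` is a bounded measurable function
    (∃ σ : Rn3 n → ℂ, MemLp σ ∞ volume ∧ Represents σ u) ∧
    ∀ σ : Rn3 n → ℂ, MemLp σ ∞ volume → Represents σ u →
      -- boundedness into the amalgam space
      (∃ C : ℝ≥0, ∀ f₁ f₂ : 𝓢(Rn n, ℂ),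
        MemAmalgam (bilinearOp σ f₁ f₂) ∧
        amalgamNorm (bilinearOp σ f₁ f₂) ≤ C * sobolevNorm s₁ f₁ * sobolevNorm s₂ f₂) ∧
      -- boundedness into `L^r`
      (∀ r : ℝ≥0∞, 1 < r → r ≤ 2 → ∃ C : ℝ≥0, ∀ f₁ f₂ : 𝓢(Rn n, ℂ),
        MemLp (bilinearOp σ f₁ f₂) r volume ∧
        eLpNorm (bilinearOp σ f₁ f₂) r volume ≤
          C * sobolevNorm s₁ f₁ * sobolevNorm s₂ f₂) ∧
      -- boundedness into `h¹`, for every choice of the function that defines its norm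
      (∀ φ : 𝓢(Rn n, ℂ), (∫ x, φ x) ≠ 0 → ∃ C : ℝ≥0, ∀ f₁ f₂ : 𝓢(Rn n, ℂ),
        ∃ w : 𝓢'(Rn n, ℂ), Represents (bilinearOp σ f₁ f₂) w ∧
          localHardyNorm φ w < ∞ ∧
          localHardyNorm φ w ≤ C * sobolevNorm s₁ f₁ * sobolevNorm s₂ f₂) := by
  have hn : n ≠ 0 := by
    rintro rfl
    norm_num at hs
    linarith
  refine ⟨?_, fun σ hσ hσu => ?_⟩
  · obtain ⟨σ, _, _, _, _, _, hσ, hσu, _⟩ := exists_band_decomposition hu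
    exact ⟨σ, hσ, hσu⟩
  obtain ⟨C, hC⟩ := exists_amalgamNorm_bilinearOp_le hs₁ hs₂ hs hu hσ hσu
  have hmem (f₁ f₂ : 𝓢(Rn n, ℂ)) : MemAmalgam (bilinearOp σ f₁ f₂) := by
    refine ⟨aestronglyMeasurable_bilinearOp hσ.1 f₁ f₂, (hC f₁ f₂).trans_lt ?_⟩
    exact ENNReal.mul_lt_top (ENNReal.mul_lt_top ENNReal.coe_lt_top (sobolevNorm_lt_top _ _))
      (sobolevNorm_lt_top _ _)
  have hLr (r : ℝ≥0∞) (h1 : 1 ≤ r) (h2 : r ≤ 2) (f₁ f₂ : 𝓢(Rn n, ℂ)) :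
      MemLp (bilinearOp σ f₁ f₂) r volume :=
    ⟨(hmem f₁ f₂).1, (eLpNorm_le_amalgamNorm (hmem f₁ f₂).1 h1 h2).trans_lt (hmem f₁ f₂).2⟩
  refine ⟨⟨C, fun f₁ f₂ => ⟨hmem f₁ f₂, hC f₁ f₂⟩⟩, fun r h1 h2 => ⟨C, fun f₁ f₂ =>
    ⟨hLr r h1.le h2 f₁ f₂, (eLpNorm_le_amalgamNorm (hmem f₁ f₂).1 h1.le h2).trans (hC f₁ f₂)⟩⟩,
    fun φ _ => ?_⟩
  obtain ⟨C', hC'⟩ := exists_localHardyNorm_le hn φ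
  refine ⟨C' * C, fun f₁ f₂ => ?_⟩
  have hrep := represents_toTemperedDistribution (hLr 2 one_le_two le_rfl f₁ f₂)
  have hle := hC' _ _ (hmem f₁ f₂) hrep
  refine ⟨_, hrep, hle.trans_lt (ENNReal.mul_lt_top ENNReal.coe_lt_top (hmem f₁ f₂).2), ?_⟩
  calc _ ≤ C' * amalgamNorm (bilinearOp σ f₁ f₂) := hle
    _ ≤ C' * (C * sobolevNorm s₁ f₁ * sobolevNorm s₂ f₂) := by gcongr; exact hC f₁ f₂
    _ = _ := by push_cast; ring
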